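/- Let $G=(V,E)$ be a finite simple outerplanar graph, i.e. the vertices of $G$ can be placed at distinct points of a circle so that the edges, drawn as chords, do not cross. Let $T\subseteq V$ be a set of exactly two vertices (the posts), and let $\widetilde G_T$ be the bunkbed graph of $G$ with posts $T$: its vertices are two copies $v_1,v_2$ of each $v\in V$, and its edges are $x_iy_i$ for every $xy\in E$ and $i\in\{1,2\}$, together with the vertical edges $t_1t_2$ for $t\in T$. For real $\lambda>0$, the arboreal gas measure on a finite graph $H$ is the probability measure on the set of edge subsets of $H$ that is supported on the (edge sets of) forests $F$ of $H$ and gives $F$ probability proportional to $\lambda^{|F|}$. Let $\mu$ be the arboreal gas measure on $\widetilde G_T$ with parameter $\lambda$, conditioned on both vertical edges $t_1t_2$ $(t\in T)$ being present. Then for all $u,v\in V$, $$\mu(u_1\leftrightarrow v_1)\;\ge\;\mu(u_1\leftrightarrow v_2),$$ where $a\leftrightarrow b$ is the event that $a$ and $b$ are in the same connected component of the random forest. -/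

import Mathlib

/-- A graph is outerplanar if its vertices can be placed at distinct points of a circle
in such a way that its edges, drawn as chords, do not cross. -/
def IsOuterplanar {V : Type*} (G : SimpleGraph V) : Prop :=
  ∃ f : V → ℂ, Function.Injective f ∧ (∀ v, ‖f v‖ = 1) ∧
    ∀ a b c d : V, G.Adj a b → G.Adj c d → s(a, b) ≠ s(c, d) →
      Disjoint (openSegment ℝ (f a) (f b)) (openSegment ℝ (f c) (f d))

/-- The bunkbed graph with posts `T`: two copies `(v, 0)`, `(v, 1)` of every vertex, two copies of
every edge (one on each level), and a vertical edge between `(t, 0)` and `(t, 1)` exactly for the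
posts `t ∈ T`. -/
def bunkbedGraph {V : Type*} (G : SimpleGraph V) (T : Finset V) : SimpleGraph (V × Fin 2) where
  Adj x y := (x.2 = y.2 ∧ G.Adj x.1 y.1) ∨ (x.1 = y.1 ∧ x.2 ≠ y.2 ∧ x.1 ∈ T)
  symm := ⟨by
    rintro x y (⟨h, h'⟩ | ⟨h, h', h''⟩)
    · exact Or.inl ⟨h.symm, h'.symm⟩
    · exact Or.inr ⟨h.symm, h'.symm, h ▸ h''⟩⟩
  loopless := ⟨by
    rintro x (⟨_, h⟩ | ⟨_, h, _⟩)
    · exact G.loopless.irrefl _ h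
    · exact h rfl⟩

/-- `F` is the edge set of a (spanning) forest of `H`. -/
def IsForestOf {W : Type*} (H : SimpleGraph W) (F : Finset (Sym2 W)) : Prop :=
  (F : Set (Sym2 W)) ⊆ H.edgeSet ∧
    (SimpleGraph.fromEdgeSet (F : Set (Sym2 W))).IsAcyclic

open Classical in
/-- The unnormalized arboreal gas weight: `lam ^ |F|` on forests, `0` on all other edge sets. -/
noncomputable def arborealWeight {W : Type*} (H : SimpleGraph W) (lam : ℝ)
    (F : Finset (Sym2 W)) : ENNReal :=
  if IsForestOf H F then ENNReal.ofReal lam ^ F.card else 0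

theorem arborealWeight_tsum_ne_zero {W : Type*} (H : SimpleGraph W) (lam : ℝ) :
    ∑' F, arborealWeight H lam F ≠ 0 := by
  intro h
  have h0 := ENNReal.tsum_eq_zero.1 h ∅
  have hF : IsForestOf H ∅ := by
    refine ⟨by simp, ?_⟩
    simp
  simp [arborealWeight, hF] at h0

theorem arborealWeight_tsum_ne_top {W : Type*} [Finite W] (H : SimpleGraph W) (lam : ℝ) :
    ∑' F, arborealWeight H lam F ≠ ⊤ := by
  classical
  cases nonempty_fintype (Finset (Sym2 W))
  rw [tsum_fintype]
  refine ENNReal.sum_ne_top.2 fun F _ => ?_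
  unfold arborealWeight
  split_ifs
  · exact ENNReal.pow_ne_top ENNReal.ofReal_ne_top
  · exact ENNReal.zero_ne_top

/-- Every set of edge configurations of a finite graph is an event. -/
instance edgeConfigurationMeasurableSpace {W : Type*} : MeasurableSpace (Finset (Sym2 W)) := ⊤

/-- The arboreal gas measure of a finite graph `H` with parameter `lam`: the probability measure
on edge sets that is supported on forests `F` and proportional to `lam ^ |F|`. -/
noncomputable def arborealGas {W : Type*} [Finite W] (H : SimpleGraph W) (lam : ℝ) :
    MeasureTheory.Measure (Finset (Sym2 W)) :=
  (PMF.normalize (arborealWeight H lam) (arborealWeight_tsum_ne_zero H lam)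
    (arborealWeight_tsum_ne_top H lam)).toMeasure

/-- The event that all vertical edges at the posts are present. -/
def postsOpen {V : Type*} (T : Finset V) : Set (Finset (Sym2 (V × Fin 2))) :=
  {F | ∀ t ∈ T, s((t, 0), (t, 1)) ∈ F}

/-- The event that `x` and `y` are connected by present edges. -/
def connectionEvent {W : Type*} (x y : W) : Set (Finset (Sym2 W)) :=
  {F | (SimpleGraph.fromEdgeSet (F : Set (Sym2 W))).Reachable x y}

/-- The arboreal gas measure on the bunkbed graph with posts `T`, conditioned on the vertical edges
at the posts being present. -/
noncomputable def bunkbedArborealGas {V : Type*} [Finite V] (G : SimpleGraph V) (T : Finset V)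
    (lam : ℝ) : MeasureTheory.Measure (Finset (Sym2 (V × Fin 2))) :=
  ProbabilityTheory.cond (arborealGas (bunkbedGraph G T) lam) (postsOpen T)

/-!
Connection probabilities are encoded by polynomials. There is one variable for every possible edge
of the vertex set of the bunkbed graph, enlarged by two ghost vertices, and `connSum a b` is the
linear functional that counts the monomials which are forests connecting `a` and `b`. For the
generating function `P` of the edges of the bunkbed graph (with the posts present), `connSum x y P`
is the weight of the forests connecting `x` and `y`, up to a constant (`forestSum_eq`). If the ghost
`0` is attached to `u` and the ghost `1` to `v`, in both cases with a sign depending on the level,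
`connSum` of the two ghosts becomes the sum over the four pairs of copies of `u` and `v` with the
corresponding signs. By the symmetry between the two levels this is twice the difference in
question, and therefore it is to be shown to be nonnegative (`connSum_bunkbed_nonneg`). If `u` or
`v` is a post, or if `u = v`, the claim is immediate.

The vertices are ordered along the circle, starting from `v`. Edges do not cross, since interleaved
chords of a circle intersect. Hence, if there are vertices between `p` and `q`, one of them is a
vertex `k` over which no edge between `p` and `q` jumps, apart from `pq` itself
(`IsNoncrossing.exists_split`). Thus the part of the bunkbed graph between `p` and `q` arises by
gluing the parts between `p` and `k` and between `k` and `q`, with a post or a mark at `k`, and by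
adding the edges `pq` on both levels (`intervalPoly_eq_glue`). Such a part only matters up to gluing
equivalence: its four terminals (the copies of `p` and `q`), and the ghost if it is attached to it,
are all that the rest of the graph sees.

The core of the proof is that, up to gluing equivalence, the part between `p` and `q` is a
nonnegative combination of an explicit finite list of generators, which are formal integer
combinations of graphs on the terminals and the ghost. The list depends on the number of posts in
the part (`unmarkedGens`, and `markedGens` if it contains `u`). These cones are closed under the
operations above (`isState_intervalPoly`). This is a finite verification: a positive multiple of
each product of generators equals a nonnegative integral combination of generators, in the sense
that both sides have the same number of forests inducing each partition of the terminals and the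
ghost (`partitionSum`), where for marked parts the forests in which the ghost is isolated are
ignored. The coefficients are listed, and checked by evaluation. For marked parts that contain both
posts the number of generators would be large, and only the nonnegativity of the pairings with
marked parts without posts is recorded (`IsMarkedStateTwo`). An unmarked part that is glued on can
be moved to the other side of such a pairing (`IsMarkedPart.glue`). The remaining pairings of
generators are again evaluated (`connCount`).
-/

/-! ### Spans of edge multisets and the connection functional -/

section EdgeAlgebra

variable {α : Type*}

/-- The line spanned by `a - b` in the free vector space on the vertices, for the edge `ab`. -/
noncomputable def edgeLine : Sym2 α → Submodule ℚ (α →₀ ℚ) :=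
  Sym2.lift ⟨fun a b => ℚ ∙ (Finsupp.single a 1 - Finsupp.single b 1), fun a b => by
    beta_reduce
    rw [← Submodule.span_neg, Set.neg_singleton, neg_sub]⟩

/-- The cut space of a multigraph: the span of the differences of endpoints of its edges.
Its dimension is the rank of the multigraph, and `a - b` lies in it exactly if `a` and `b`
are connected. -/
noncomputable def edgeSpan (M : Multiset (Sym2 α)) : Submodule ℚ (α →₀ ℚ) :=
  (M.map edgeLine).sup

theorem edgeLine_mk (a b : α) :
    edgeLine s(a, b) = ℚ ∙ (Finsupp.single a 1 - Finsupp.single b 1 : α →₀ ℚ) := rfl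

@[simp] theorem edgeSpan_zero : edgeSpan (0 : Multiset (Sym2 α)) = ⊥ := by simp [edgeSpan]

@[simp] theorem edgeSpan_add (M N : Multiset (Sym2 α)) :
    edgeSpan (M + N) = edgeSpan M ⊔ edgeSpan N := by simp [edgeSpan]

@[simp] theorem edgeSpan_cons (e : Sym2 α) (M : Multiset (Sym2 α)) :
    edgeSpan (e ::ₘ M) = edgeLine e ⊔ edgeSpan M := by simp [edgeSpan]

@[simp] theorem edgeSpan_singleton (e : Sym2 α) :
    edgeSpan ({e} : Multiset (Sym2 α)) = edgeLine e := by simp [edgeSpan]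

theorem single_sub_mem_edgeSpan {a b : α} {M : Multiset (Sym2 α)} (h : s(a, b) ∈ M) :
    (Finsupp.single a 1 - Finsupp.single b 1 : α →₀ ℚ) ∈ edgeSpan M := by
  obtain ⟨N, rfl⟩ := Multiset.exists_cons_of_mem h
  rw [edgeSpan_cons, edgeLine_mk]
  exact Submodule.mem_sup_left (Submodule.mem_span_singleton_self _)

theorem edgeSpan_le_iff {M : Multiset (Sym2 α)} {U : Submodule ℚ (α →₀ ℚ)} :
    edgeSpan M ≤ U ↔ ∀ a b, s(a, b) ∈ M →
      (Finsupp.single a 1 - Finsupp.single b 1 : α →₀ ℚ) ∈ U := by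
  constructor
  · intro h a b hab
    exact h (single_sub_mem_edgeSpan hab)
  · intro h
    rw [edgeSpan, Multiset.sup_le]
    intro l hl
    obtain ⟨e, he, rfl⟩ := Multiset.mem_map.1 hl
    induction e with
    | h a b =>
      rw [edgeLine_mk, Submodule.span_singleton_le_iff_mem]
      exact h a b he

theorem finrank_edgeSpan_add_le [Finite α] (M N : Multiset (Sym2 α)) :
    Module.finrank ℚ (edgeSpan (M + N)) ≤
      Module.finrank ℚ (edgeSpan M) + Module.finrank ℚ (edgeSpan N) := by
  rw [edgeSpan_add]
  exact Submodule.finrank_add_le_finrank_add_finrank _ _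

theorem finrank_edgeSpan_le_card [Finite α] (M : Multiset (Sym2 α)) :
    Module.finrank ℚ (edgeSpan M) ≤ Multiset.card M := by
  induction M using Multiset.induction with
  | empty => simp
  | cons e M ih =>
    rw [← Multiset.singleton_add]
    refine (finrank_edgeSpan_add_le _ _).trans ?_
    rw [Multiset.card_add, Multiset.card_singleton]
    refine add_le_add ?_ ih
    induction e with
    | h a b =>
      rw [edgeSpan_singleton, edgeLine_mk]
      exact (finrank_span_le_card _).trans (by simp)

theorem edgeSpan_apply_eq_zero {M : Multiset (Sym2 α)} {w : α} (hw : ∀ e ∈ M, w ∉ e)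
    {f : α →₀ ℚ} (hf : f ∈ edgeSpan M) : f w = 0 := by
  have : edgeSpan M ≤ LinearMap.ker (Finsupp.lapply w : (α →₀ ℚ) →ₗ[ℚ] ℚ) := by
    rw [edgeSpan_le_iff]
    intro a b hab
    have h := hw _ hab
    rw [Sym2.mem_iff, not_or] at h
    simp [Ne.symm h.1, Ne.symm h.2]
  exact this hf

/-- Attaching a new vertex by a single edge does not affect connections of other vertices. -/
theorem mem_edgeSpan_cons_leaf {M : Multiset (Sym2 α)} {w x : α} (hw : ∀ e ∈ M, w ∉ e)
    (hx : x ≠ w) {f : α →₀ ℚ} (hf : f w = 0) :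
    f ∈ edgeSpan (s(w, x) ::ₘ M) ↔ f ∈ edgeSpan M := by
  rw [edgeSpan_cons, edgeLine_mk]
  constructor
  · intro h
    obtain ⟨y, hy, z, hz, rfl⟩ := Submodule.mem_sup.1 h
    obtain ⟨c, rfl⟩ := Submodule.mem_span_singleton.1 hy
    have hz0 := edgeSpan_apply_eq_zero hw hz
    have : c = 0 := by simpa [hz0, Finsupp.single_apply, hx] using hf
    simpa [this] using hz
  · exact fun h => Submodule.mem_sup_right h

theorem finrank_edgeSpan_cons [Finite α] {M : Multiset (Sym2 α)} {a b : α}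
    (h : (Finsupp.single a 1 - Finsupp.single b 1 : α →₀ ℚ) ∉ edgeSpan M) :
    Module.finrank ℚ (edgeSpan (s(a, b) ::ₘ M)) = Module.finrank ℚ (edgeSpan M) + 1 := by
  rw [edgeSpan_cons, edgeLine_mk, sup_comm, Submodule.finrank_sup_span_singleton h]

open Classical in
/-- The indicator that the multigraph `M` is a forest in which `a` and `b` are connected. -/
noncomputable def connIndicator (a b : α) (M : Multiset (Sym2 α)) : ℝ :=
  if Module.finrank ℚ (edgeSpan M) = Multiset.card M ∧
    (Finsupp.single a 1 - Finsupp.single b 1 : α →₀ ℚ) ∈ edgeSpan M then 1 else 0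

theorem connIndicator_congr {M N : Multiset (Sym2 α)} (h : edgeSpan M = edgeSpan N)
    (hc : Multiset.card M = Multiset.card N) (a b : α) :
    connIndicator a b M = connIndicator a b N := by
  rw [connIndicator, connIndicator, h, hc]

/-- A multigraph containing a cycle contributes nothing, whatever is added to it. -/
theorem connIndicator_add_eq_zero [Finite α] {M : Multiset (Sym2 α)}
    (h : Module.finrank ℚ (edgeSpan M) < Multiset.card M) (N : Multiset (Sym2 α)) (a b : α) :
    connIndicator a b (M + N) = 0 := by
  rw [connIndicator, if_neg]
  rintro ⟨h1, -⟩
  have h2 := finrank_edgeSpan_add_le M N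
  have h3 := finrank_edgeSpan_le_card N
  rw [h1, Multiset.card_add] at h2
  omega

theorem connIndicator_cons_leaf [Finite α] {M : Multiset (Sym2 α)} {w x a b : α}
    (hw : ∀ e ∈ M, w ∉ e)
    (hx : x ≠ w) (ha : a ≠ w) (hb : b ≠ w) :
    connIndicator a b (s(w, x) ::ₘ M) = connIndicator a b M := by
  have h1 : (Finsupp.single w 1 - Finsupp.single x 1 : α →₀ ℚ) ∉ edgeSpan M := by
    intro h
    have := edgeSpan_apply_eq_zero hw h
    simp [hx] at this
  have h2 := finrank_edgeSpan_cons h1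
  have h3 := mem_edgeSpan_cons_leaf (M := M) hw hx
    (f := Finsupp.single a 1 - Finsupp.single b 1) (by simp [ha, hb])
  classical exact if_congr (by rw [h2, h3, Multiset.card_cons, Nat.add_right_cancel_iff]) rfl rfl

/-- Transferring the test from a pendant vertex to its neighbour. -/
theorem connIndicator_cons_leaf_left [Finite α] {M : Multiset (Sym2 α)} {w x b : α}
    (hw : ∀ e ∈ M, w ∉ e)
    (hx : x ≠ w) (hb : b ≠ w) :
    connIndicator w b (s(w, x) ::ₘ M) = connIndicator x b M := by
  rw [← connIndicator_cons_leaf hw hx hx hb]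
  have h1 : (Finsupp.single w 1 - Finsupp.single x 1 : α →₀ ℚ) ∈ edgeSpan (s(w, x) ::ₘ M) :=
    single_sub_mem_edgeSpan (Multiset.mem_cons_self _ _)
  have h2 : (Finsupp.single w 1 - Finsupp.single b 1 : α →₀ ℚ) ∈ edgeSpan (s(w, x) ::ₘ M) ↔
      (Finsupp.single x 1 - Finsupp.single b 1 : α →₀ ℚ) ∈ edgeSpan (s(w, x) ::ₘ M) := by
    rw [← sub_add_sub_cancel (Finsupp.single w 1) (Finsupp.single x 1) (Finsupp.single b 1)]
    exact Submodule.add_mem_iff_right _ h1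
  classical exact if_congr (by rw [h2]) rfl rfl

theorem connIndicator_comm (a b : α) (M : Multiset (Sym2 α)) :
    connIndicator a b M = connIndicator b a M := by
  have h : (Finsupp.single a 1 - Finsupp.single b 1 : α →₀ ℚ) ∈ edgeSpan M ↔
      (Finsupp.single b 1 - Finsupp.single a 1 : α →₀ ℚ) ∈ edgeSpan M := by
    rw [← neg_sub, Submodule.neg_mem_iff]
  classical exact if_congr (by rw [h]) rfl rfl

/-- The product of the edge variables of a multigraph. -/
noncomputable def edgeMonomial (M : Multiset (Sym2 α)) : MvPolynomial (Sym2 α) ℝ :=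
  (M.map MvPolynomial.X).prod

theorem edgeMonomial_add (M N : Multiset (Sym2 α)) :
    edgeMonomial (M + N) = edgeMonomial M * edgeMonomial N := by simp [edgeMonomial]

open Classical in
theorem edgeMonomial_eq_monomial (M : Multiset (Sym2 α)) :
    edgeMonomial M = MvPolynomial.monomial (Multiset.toFinsupp M) 1 := by
  induction M using Multiset.induction with
  | empty => simp [edgeMonomial]
  | cons e M ih =>
    rw [← Multiset.singleton_add, edgeMonomial_add, ih, map_add, edgeMonomial]
    simp [MvPolynomial.X, MvPolynomial.monomial_mul]

open Classical in
/-- The linear functional on polynomials in edge variables that counts the monomials which are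
forests connecting `a` and `b`. -/
noncomputable def connSum (a b : α) : MvPolynomial (Sym2 α) ℝ →ₗ[ℝ] ℝ :=
  (MvPolynomial.basisMonomials (Sym2 α) ℝ).constr ℝ
    fun m => connIndicator a b (Finsupp.toMultiset m)

@[simp] theorem connSum_edgeMonomial (a b : α) (M : Multiset (Sym2 α)) :
    connSum a b (edgeMonomial M) = connIndicator a b M := by
  classical
  have h := (MvPolynomial.basisMonomials (Sym2 α) ℝ).constr_basis ℝ
    (fun m => connIndicator a b (Finsupp.toMultiset m)) (Multiset.toFinsupp M)
  rw [MvPolynomial.coe_basisMonomials] at h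
  rw [edgeMonomial_eq_monomial, connSum, h]
  simp

/-- The polynomials in the variables of edges with both endpoints in `S`. -/
noncomputable def edgesWithin (S : Set α) : Subalgebra ℝ (MvPolynomial (Sym2 α) ℝ) :=
  MvPolynomial.supported ℝ {e | ∀ x ∈ e, x ∈ S}

theorem edgesWithin_mono {S S' : Set α} (h : S ⊆ S') : edgesWithin S ≤ edgesWithin S' :=
  MvPolynomial.supported_mono fun _ he x hx => h (he x hx)

theorem X_mem_edgesWithin {S : Set α} {a b : α} (ha : a ∈ S) (hb : b ∈ S) :
    MvPolynomial.X s(a, b) ∈ edgesWithin S := by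
  refine Algebra.subset_adjoin ⟨s(a, b), ?_, rfl⟩
  intro x hx
  rcases Sym2.mem_iff.1 hx with rfl | rfl
  exacts [ha, hb]

/-- Two polynomials are equivalent relative to `A` and `S` if they contribute equally to
connections between a vertex of `A` and a vertex of `S`, whatever edges inside `S` are added. -/
def GluingEquiv (A S : Set α) (X Y : MvPolynomial (Sym2 α) ℝ) : Prop :=
  ∀ Q ∈ edgesWithin S, ∀ a ∈ A, ∀ b ∈ S, connSum a b (X * Q) = connSum a b (Y * Q)

namespace GluingEquiv

variable {A A' S S' : Set α} {X Y Z X' Y' : MvPolynomial (Sym2 α) ℝ}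

theorem refl (A S : Set α) (X : MvPolynomial (Sym2 α) ℝ) : GluingEquiv A S X X :=
  fun _ _ _ _ _ _ => rfl

theorem symm (h : GluingEquiv A S X Y) : GluingEquiv A S Y X :=
  fun Q hQ a ha b hb => (h Q hQ a ha b hb).symm

theorem trans (h : GluingEquiv A S X Y) (h' : GluingEquiv A S Y Z) : GluingEquiv A S X Z :=
  fun Q hQ a ha b hb => (h Q hQ a ha b hb).trans (h' Q hQ a ha b hb)

theorem anti (h : GluingEquiv A' S' X Y) (hA : A ⊆ A') (hS : S ⊆ S') : GluingEquiv A S X Y :=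
  fun Q hQ a ha b hb => h Q (edgesWithin_mono hS hQ) a (hA ha) b (hS hb)

theorem add (h : GluingEquiv A S X Y) (h' : GluingEquiv A S X' Y') :
    GluingEquiv A S (X + X') (Y + Y') := fun Q hQ a ha b hb => by
  rw [add_mul, add_mul, map_add, map_add, h Q hQ a ha b hb, h' Q hQ a ha b hb]

theorem smul (c : ℝ) (h : GluingEquiv A S X Y) : GluingEquiv A S (c • X) (c • Y) :=
  fun Q hQ a ha b hb => by
    rw [smul_mul_assoc, smul_mul_assoc, map_smul, map_smul, h Q hQ a ha b hb]

theorem mul_right (h : GluingEquiv A S X Y) (hZ : Z ∈ edgesWithin S) :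
    GluingEquiv A S (X * Z) (Y * Z) := fun Q hQ a ha b hb => by
  rw [mul_assoc, mul_assoc]
  exact h _ (mul_mem hZ hQ) a ha b hb

theorem connSum_eq (h : GluingEquiv A S X Y) {Q : MvPolynomial (Sym2 α) ℝ} (hQ : Q ∈ edgesWithin S)
    {a b : α} (ha : a ∈ A) (hb : b ∈ S) : connSum a b (X * Q) = connSum a b (Y * Q) :=
  h Q hQ a ha b hb

/-- It suffices to test gluing equivalence against monomials. -/
theorem of_monomial (h : ∀ M : Multiset (Sym2 α), (∀ e ∈ M, ∀ x ∈ e, x ∈ S) →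
    ∀ a ∈ A, ∀ b ∈ S,
      connSum a b (X * edgeMonomial M) = connSum a b (Y * edgeMonomial M)) :
    GluingEquiv A S X Y := by
  classical
  intro Q hQ a ha b hb
  rw [Q.as_sum, Finset.mul_sum, Finset.mul_sum, map_sum, map_sum]
  refine Finset.sum_congr rfl fun m hm => ?_
  have hmon : MvPolynomial.monomial m (Q.coeff m) =
      Q.coeff m • edgeMonomial (Finsupp.toMultiset m) := by
    rw [edgeMonomial_eq_monomial, MvPolynomial.smul_monomial]
    simp
  rw [hmon, mul_smul_comm, mul_smul_comm, map_smul, map_smul]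
  congr 1
  refine h _ (fun e he => ?_) a ha b hb
  refine MvPolynomial.mem_supported.1 hQ ?_
  exact (MvPolynomial.mem_vars_iff_mem_support e).2 ⟨m, hm, by simpa using he⟩

end GluingEquiv

end EdgeAlgebra

/-! ### Computing with edge multisets on labelled vertices -/

section Labels

/-- A formal integer combination of multigraphs on vertices labelled by natural numbers,
each multigraph given by its list of edges. -/
abbrev EdgeSum := List (ℤ × List (ℕ × ℕ))

namespace EdgeSum

/-- The product: multigraphs are multiplied by taking the union of their edges. -/
def mul (s t : EdgeSum) : EdgeSum :=
  s.flatMap fun a => t.map fun b => (a.1 * b.1, a.2 ++ b.2)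

/-- The integer multiple of an edge sum. -/
def smul (c : ℤ) (s : EdgeSum) : EdgeSum := s.map fun a => (c * a.1, a.2)

/-- Moves the edges along a map of the labels. -/
def relabel (σ : ℕ → ℕ) (s : EdgeSum) : EdgeSum :=
  s.map fun a => (a.1, a.2.map fun e => (σ e.1, σ e.2))

end EdgeSum

/-- Partitions of `0, …, n - 1` are encoded by the list that maps every label to the least label
of its block. `joinBlocks` adds an edge to such a partition, and fails if the edge closes a
cycle. -/
def joinBlocks (L : List ℕ) (e : ℕ × ℕ) : Option (List ℕ) :=
  let a := L.getD e.1 0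
  let b := L.getD e.2 0
  bif Nat.beq a b then none
  else some (L.map fun c => bif Nat.beq c (max a b) then min a b else c)

/-- Adds a list of edges to a partition, and fails if a cycle is closed. -/
def addEdges (L : List ℕ) : List (ℕ × ℕ) → Option (List ℕ)
  | [] => some L
  | e :: F => (joinBlocks L e).bind fun L' => addEdges L' F

/-- The partition of the labels below `m` induced by a forest on the labels below `n`. -/
def inducedPartition (n m : ℕ) (F : List (ℕ × ℕ)) : Option (List ℕ) :=
  (addEdges (List.range n) F).map (List.take m)

/-- Adds a multiple of a partition to a formal combination of partitions. -/
def addTerm (c : ℤ) (L : List ℕ) : List (ℤ × List ℕ) → List (ℤ × List ℕ)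
  | [] => [(c, L)]
  | (d, K) :: t => bif decide (L = K) then (c + d, K) :: t else (d, K) :: addTerm c L t

/-- The formal combination of partitions of the labels below `m` induced by an edge sum on the
labels below `n`. -/
def partitionSum (n m : ℕ) : EdgeSum → List (ℤ × List ℕ)
  | [] => []
  | (c, F) :: s => match inducedPartition n m F with
    | none => partitionSum n m s
    | some L => addTerm c L (partitionSum n m s)

/-- All edges join labels below `n`. -/
def labelsBelow (n : ℕ) (s : EdgeSum) : Bool :=
  s.all fun a => a.2.all fun e => Nat.blt e.1 n && Nat.blt e.2 n

/-- The edge sum induces the zero combination of partitions on the labels below `m`. -/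
def vanishes (n m : ℕ) (s : EdgeSum) : Bool :=
  labelsBelow n s && (partitionSum n m s).all fun a => decide (a.1 = 0)

/-- The edge sum induces the zero combination of partitions on the labels below `m`, if
partitions in which the label `0` forms a block of its own are ignored. -/
def vanishesMarked (n m : ℕ) (s : EdgeSum) : Bool :=
  labelsBelow n s &&
    (partitionSum n m s).all fun a => decide (a.1 = 0) || (List.range m).all fun i =>
      Nat.ble (a.2.getD i 0) i && (Nat.beq i 0 || Nat.blt 0 (a.2.getD i 0))

/-- The signed number of forests in an edge sum that connect the labels `0` and `1`. -/
def connCount (n : ℕ) : EdgeSum → ℤ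
  | [] => 0
  | (c, F) :: s => match inducedPartition n 2 F with
    | none => connCount n s
    | some L => bif Nat.beq (L.getD 1 0) 0 then c + connCount n s else connCount n s

variable {α : Type*}

/-- The edges `ι i — ι (f i)`, for the labels `i < n` not fixed by `f`. -/
def starEdges (ι : ℕ → α) (f : ℕ → ℕ) (n : ℕ) : Multiset (Sym2 α) :=
  ∑ i ∈ Finset.range n, if f i = i then 0 else {s(ι i, ι (f i))}

/-- The edges of a labelled multigraph, for a placement `ι` of the labels. -/
def mapEdges (ι : ℕ → α) (F : List (ℕ × ℕ)) : Multiset (Sym2 α) :=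
  (F.map fun e => s(ι e.1, ι e.2) : List (Sym2 α))

/-- `f` maps every label below `n` to the least label of its block. -/
def IsLabelling (n : ℕ) (f : ℕ → ℕ) : Prop := ∀ i < n, f i ≤ i ∧ f (f i) = f i

theorem starEdges_congr {ι : ℕ → α} {f g : ℕ → ℕ} {n : ℕ} (h : ∀ i < n, f i = g i) :
    starEdges ι f n = starEdges ι g n :=
  Finset.sum_congr rfl fun i hi => by rw [h i (Finset.mem_range.1 hi)]

theorem starEdges_succ (ι : ℕ → α) (f : ℕ → ℕ) (n : ℕ) :
    starEdges ι f (n + 1) = starEdges ι f n + if f n = n then 0 else {s(ι n, ι (f n))} :=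
  Finset.sum_range_succ _ _

theorem mem_starEdges {ι : ℕ → α} {f : ℕ → ℕ} {n : ℕ} {e : Sym2 α} :
    e ∈ starEdges ι f n ↔ ∃ i < n, f i ≠ i ∧ e = s(ι i, ι (f i)) := by
  simp only [starEdges, Multiset.mem_sum, Finset.mem_range]
  refine exists_congr fun i => and_congr_right fun _ => ?_
  split_ifs with h <;> simp [h]

theorem card_starEdges (ι : ℕ → α) (f : ℕ → ℕ) (n : ℕ) :
    Multiset.card (starEdges ι f n) = ∑ i ∈ Finset.range n, if f i = i then 0 else 1 := by
  rw [starEdges, Multiset.card_sum]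
  refine Finset.sum_congr rfl fun i _ => ?_
  split_ifs <;> simp

theorem single_sub_mem_starEdges (ι : ℕ → α) (f : ℕ → ℕ) {n i : ℕ} (hi : i < n) :
    (Finsupp.single (ι i) 1 - Finsupp.single (ι (f i)) 1 : α →₀ ℚ) ∈
      edgeSpan (starEdges ι f n) := by
  by_cases h : f i = i
  · rw [h, sub_self]
    exact zero_mem _
  · exact single_sub_mem_edgeSpan (mem_starEdges.2 ⟨i, hi, h, rfl⟩)

/-- Joining the blocks with roots `a < b` in a labelling. -/
theorem isLabelling_join {n : ℕ} {f g : ℕ → ℕ} {a b : ℕ} (hf : IsLabelling n f) (hab : a < b)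
    (ha : f a = a) (hg : ∀ i < n, g i = if f i = b then a else f i) : IsLabelling n g := by
  intro i hi
  have h1 := (hf i hi).1
  rw [hg i hi]
  split_ifs with h
  · refine ⟨by omega, ?_⟩
    rw [hg a (by omega), ha, if_neg hab.ne]
  · refine ⟨h1, ?_⟩
    rw [hg _ (by omega), (hf i hi).2, if_neg h]

theorem card_starEdges_join {ι : ℕ → α} {n : ℕ} {f g : ℕ → ℕ} {a b : ℕ} (hb : b < n)
    (hab : a < b) (ha : f a = a) (hfb : f b = b)
    (hg : ∀ i < n, g i = if f i = b then a else f i) :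
    Multiset.card (starEdges ι g n) = Multiset.card (starEdges ι f n) + 1 := by
  rw [card_starEdges, card_starEdges]
  have hbm : b ∈ Finset.range n := Finset.mem_range.2 hb
  rw [← Finset.add_sum_erase _ _ hbm, ← Finset.add_sum_erase _ _ hbm, hg b hb, if_pos hfb,
    if_neg hab.ne, if_pos hfb, add_comm, zero_add, Nat.add_right_cancel_iff]
  refine Finset.sum_congr rfl fun i hi => ?_
  obtain ⟨hib, hi⟩ := Finset.mem_erase.1 hi
  rw [hg i (Finset.mem_range.1 hi)]
  by_cases h : f i = b
  · rw [if_pos h, h, if_neg (Ne.symm hib), if_neg]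
    rintro rfl
    exact hab.ne (ha.symm.trans h)
  · rw [if_neg h]

theorem edgeSpan_starEdges_join {ι : ℕ → α} {n : ℕ} {f g : ℕ → ℕ} {a b : ℕ} (hb : b < n)
    (hfb : f b = b) (hg : ∀ i < n, g i = if f i = b then a else f i) :
    edgeSpan (starEdges ι g n) = edgeSpan (s(ι a, ι b) ::ₘ starEdges ι f n) := by
  have hgb : (Finsupp.single (ι b) 1 - Finsupp.single (ι a) 1 : α →₀ ℚ) ∈
      edgeSpan (starEdges ι g n) := by
    have := single_sub_mem_starEdges ι g hb
    rwa [hg b hb, if_pos hfb] at this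
  apply le_antisymm
  · rw [edgeSpan_le_iff]
    intro x y hxy
    obtain ⟨i, hi, -, he⟩ := mem_starEdges.1 hxy
    suffices h : (Finsupp.single (ι i) 1 - Finsupp.single (ι (g i)) 1 : α →₀ ℚ) ∈
        edgeSpan (s(ι a, ι b) ::ₘ starEdges ι f n) by
      rcases Sym2.eq_iff.1 he with ⟨rfl, rfl⟩ | ⟨rfl, rfl⟩
      · exact h
      · rw [← neg_sub]
        exact neg_mem h
    have h1 : (Finsupp.single (ι i) 1 - Finsupp.single (ι (f i)) 1 : α →₀ ℚ) ∈
        edgeSpan (s(ι a, ι b) ::ₘ starEdges ι f n) := by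
      rw [edgeSpan_cons]
      exact Submodule.mem_sup_right (single_sub_mem_starEdges ι f hi)
    rw [hg i hi]
    split_ifs with h
    · have h2 : (Finsupp.single (ι a) 1 - Finsupp.single (ι b) 1 : α →₀ ℚ) ∈
          edgeSpan (s(ι a, ι b) ::ₘ starEdges ι f n) :=
        single_sub_mem_edgeSpan (Multiset.mem_cons_self _ _)
      rw [h] at h1
      have := sub_mem h1 h2
      convert this using 1
      abel
    · exact h1
  · rw [edgeSpan_le_iff]
    intro x y hxy
    rcases Multiset.mem_cons.1 hxy with he | hxy
    · rcases Sym2.eq_iff.1 he with ⟨rfl, rfl⟩ | ⟨rfl, rfl⟩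
      · rw [← neg_sub]
        exact neg_mem hgb
      · exact hgb
    obtain ⟨i, hi, -, he⟩ := mem_starEdges.1 hxy
    suffices h : (Finsupp.single (ι i) 1 - Finsupp.single (ι (f i)) 1 : α →₀ ℚ) ∈
        edgeSpan (starEdges ι g n) by
      rcases Sym2.eq_iff.1 he with ⟨rfl, rfl⟩ | ⟨rfl, rfl⟩
      · exact h
      · rw [← neg_sub]
        exact neg_mem h
    have h1 := single_sub_mem_starEdges ι g hi
    rw [hg i hi] at h1
    split_ifs at h1 with h
    · rw [h]
      have := sub_mem h1 hgb
      convert this using 1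
      abel
    · exact h1

/-- Modulo a labelling, an edge may be moved to the roots of the blocks of its endpoints. -/
theorem edgeSpan_cons_starEdges {ι : ℕ → α} {n : ℕ} {f : ℕ → ℕ} {i j : ℕ} (hi : i < n)
    (hj : j < n) : edgeSpan (s(ι i, ι j) ::ₘ starEdges ι f n) =
      edgeSpan (s(ι (f i), ι (f j)) ::ₘ starEdges ι f n) := by
  have h1 := single_sub_mem_starEdges ι f hi
  have h2 := single_sub_mem_starEdges ι f hj
  have h3 := sub_mem h1 h2
  rw [edgeSpan_cons, edgeSpan_cons, edgeLine_mk, edgeLine_mk]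
  apply le_antisymm
  · refine sup_le ?_ le_sup_right
    rw [Submodule.span_singleton_le_iff_mem]
    have := add_mem (Submodule.mem_sup_right (S := ℚ ∙ _) h3)
      (Submodule.mem_sup_left (T := edgeSpan (starEdges ι f n))
        (Submodule.mem_span_singleton_self
          (Finsupp.single (ι (f i)) 1 - Finsupp.single (ι (f j)) 1 : α →₀ ℚ)))
    convert this using 1
    abel
  · refine sup_le ?_ le_sup_right
    rw [Submodule.span_singleton_le_iff_mem]
    have := sub_mem (Submodule.mem_sup_left (T := edgeSpan (starEdges ι f n))
        (Submodule.mem_span_singleton_self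
          (Finsupp.single (ι i) 1 - Finsupp.single (ι j) 1 : α →₀ ℚ)))
      (Submodule.mem_sup_right (S := ℚ ∙ _) h3)
    convert this using 1
    abel

/-- The partition list `L` as a function on labels. -/
abbrev blockRoot (L : List ℕ) (i : ℕ) : ℕ := L.getD i 0

theorem joinBlocks_eq_none {L : List ℕ} {e : ℕ × ℕ} (h : joinBlocks L e = none) :
    blockRoot L e.1 = blockRoot L e.2 := by
  simp only [joinBlocks, cond_eq_ite] at h
  split_ifs at h with h'
  exact Nat.eq_of_beq_eq_true h'

theorem joinBlocks_eq_some {L L' : List ℕ} {e : ℕ × ℕ} (h : joinBlocks L e = some L') :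
    blockRoot L e.1 ≠ blockRoot L e.2 ∧ L'.length = L.length ∧
      ∀ i < L.length, blockRoot L' i =
        if blockRoot L i = max (blockRoot L e.1) (blockRoot L e.2)
        then min (blockRoot L e.1) (blockRoot L e.2) else blockRoot L i := by
  simp only [joinBlocks, cond_eq_ite] at h
  split_ifs at h with h'
  rw [Option.some.injEq] at h
  subst h
  refine ⟨fun h => h' (by simpa using h), by simp, fun i hi => ?_⟩
  simp [blockRoot, List.getD_eq_getElem?_getD, hi]

/-- If `joinBlocks` fails, the edge closes a cycle; otherwise the star forest of the new partition
has the same cut space and the same number of edges as the old one with the edge added. -/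
theorem joinBlocks_spec [Finite α] (ι : ℕ → α) {L : List ℕ} {e : ℕ × ℕ}
    (hL : IsLabelling L.length (blockRoot L)) (h1 : e.1 < L.length) (h2 : e.2 < L.length) :
    match joinBlocks L e with
    | none => Module.finrank ℚ
          (edgeSpan (s(ι e.1, ι e.2) ::ₘ starEdges ι (blockRoot L) L.length)) <
        Multiset.card (s(ι e.1, ι e.2) ::ₘ starEdges ι (blockRoot L) L.length)
    | some L' => L'.length = L.length ∧ IsLabelling L.length (blockRoot L') ∧
        edgeSpan (s(ι e.1, ι e.2) ::ₘ starEdges ι (blockRoot L) L.length) =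
          edgeSpan (starEdges ι (blockRoot L') L.length) ∧
        Multiset.card (s(ι e.1, ι e.2) ::ₘ starEdges ι (blockRoot L) L.length) =
          Multiset.card (starEdges ι (blockRoot L') L.length) := by
  rw [edgeSpan_cons_starEdges h1 h2]
  cases h : joinBlocks L e with
  | none =>
    have := joinBlocks_eq_none h
    have hle := finrank_edgeSpan_le_card (starEdges ι (blockRoot L) L.length)
    dsimp only
    rw [this, edgeSpan_cons, edgeLine_mk, sub_self, Submodule.span_zero_singleton, bot_sup_eq,
      Multiset.card_cons]
    omega
  | some L' =>
    obtain ⟨hne, hlen, hL'⟩ := joinBlocks_eq_some h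
    have hlt : min (blockRoot L e.1) (blockRoot L e.2) <
        max (blockRoot L e.1) (blockRoot L e.2) := min_lt_max.2 hne
    have hmin : blockRoot L (min (blockRoot L e.1) (blockRoot L e.2)) =
        min (blockRoot L e.1) (blockRoot L e.2) := by
      rcases min_choice (blockRoot L e.1) (blockRoot L e.2) with h | h <;> rw [h]
      exacts [(hL _ h1).2, (hL _ h2).2]
    have hmax : blockRoot L (max (blockRoot L e.1) (blockRoot L e.2)) =
        max (blockRoot L e.1) (blockRoot L e.2) := by
      rcases max_choice (blockRoot L e.1) (blockRoot L e.2) with h | h <;> rw [h]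
      exacts [(hL _ h1).2, (hL _ h2).2]
    have hb : max (blockRoot L e.1) (blockRoot L e.2) < L.length :=
      max_lt ((hL _ h1).1.trans_lt h1) ((hL _ h2).1.trans_lt h2)
    refine ⟨hlen, isLabelling_join hL hlt hmin hL', ?_, ?_⟩
    · rw [edgeSpan_starEdges_join hb hmax hL']
      rcases le_total (blockRoot L e.1) (blockRoot L e.2) with h | h
      · rw [min_eq_left h, max_eq_right h]
      · rw [min_eq_right h, max_eq_left h, Sym2.eq_swap]
    · rw [card_starEdges_join hb hlt hmin hmax hL', Multiset.card_cons]

theorem addEdges_spec [Finite α] (ι : ℕ → α) (F : List (ℕ × ℕ)) {L : List ℕ}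
    (hL : IsLabelling L.length (blockRoot L))
    (hF : ∀ e ∈ F, e.1 < L.length ∧ e.2 < L.length) :
    match addEdges L F with
    | none => Module.finrank ℚ
          (edgeSpan (mapEdges ι F + starEdges ι (blockRoot L) L.length)) <
        Multiset.card (mapEdges ι F + starEdges ι (blockRoot L) L.length)
    | some L' => L'.length = L.length ∧ IsLabelling L.length (blockRoot L') ∧
        edgeSpan (mapEdges ι F + starEdges ι (blockRoot L) L.length) =
          edgeSpan (starEdges ι (blockRoot L') L.length) ∧
        Multiset.card (mapEdges ι F + starEdges ι (blockRoot L) L.length) =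
          Multiset.card (starEdges ι (blockRoot L') L.length) := by
  induction F generalizing L with
  | nil => simpa [addEdges, mapEdges] using hL
  | cons e F ih =>
    have he := hF e (List.mem_cons_self ..)
    have hspec := joinBlocks_spec ι hL he.1 he.2
    have hcons : mapEdges ι (e :: F) + starEdges ι (blockRoot L) L.length =
        mapEdges ι F + s(ι e.1, ι e.2) ::ₘ starEdges ι (blockRoot L) L.length := by
      simp [mapEdges, ← Multiset.cons_coe]
    rw [hcons, addEdges]
    cases h : joinBlocks L e with
    | none =>
      rw [h] at hspec
      simp only [Option.bind_none]
      have h1 := finrank_edgeSpan_add_le (mapEdges ι F)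
        (s(ι e.1, ι e.2) ::ₘ starEdges ι (blockRoot L) L.length)
      have h2 := finrank_edgeSpan_le_card (mapEdges ι F)
      rw [Multiset.card_add]
      omega
    | some L' =>
      rw [h] at hspec
      simp only [Option.bind_some]
      obtain ⟨hlen, hlab, hspan, hcard⟩ := hspec
      have := ih (L := L') (by rwa [hlen]) (fun e he => by
        rw [hlen]
        exact hF e (List.mem_cons_of_mem _ he))
      rw [edgeSpan_add, Multiset.card_add, hspan, hcard, ← edgeSpan_add, ← Multiset.card_add,
        ← hlen]
      exact this

/-- In a labelling, the labels above `m` are leaves and can be deleted. -/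
theorem connIndicator_starEdges_add [Finite α] {ι : ℕ → α} {f : ℕ → ℕ} {n m : ℕ} (hmn : m ≤ n)
    (hι : Set.InjOn ι (Set.Iio n)) (hf : IsLabelling n f) {N : Multiset (Sym2 α)} {a b : α}
    (hN : ∀ e ∈ N, ∀ k, m ≤ k → k < n → ι k ∉ e) (ha : ∀ k, m ≤ k → k < n → a ≠ ι k)
    (hb : ∀ k, m ≤ k → k < n → b ≠ ι k) :
    connIndicator a b (starEdges ι f n + N) = connIndicator a b (starEdges ι f m + N) := by
  induction n, hmn using Nat.le_induction with
  | base => rfl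
  | succ n hmn ih =>
    rw [← ih (hι.mono (Set.Iio_subset_Iio n.le_succ)) (fun i hi => hf i (by omega))
      (fun e he k hk hkn => hN e he k hk (by omega)) (fun k hk hkn => ha k hk (by omega))
      (fun k hk hkn => hb k hk (by omega)), starEdges_succ]
    split_ifs with h
    · rw [add_zero]
    · have hfn : f n < n := lt_of_le_of_ne (hf n n.lt_succ_self).1 h
      rw [add_right_comm, add_comm, Multiset.singleton_add]
      refine connIndicator_cons_leaf ?_ ?_ (ha n hmn n.lt_succ_self) (hb n hmn n.lt_succ_self)
      · intro e he
        rcases Multiset.mem_add.1 he with he | he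
        · obtain ⟨i, hi, -, rfl⟩ := mem_starEdges.1 he
          rw [Sym2.mem_iff, not_or]
          have hfi := (hf i (by omega)).1
          constructor
          · intro heq
            have := hι (Set.mem_Iio.2 n.lt_succ_self) (Set.mem_Iio.2 (by omega)) heq
            omega
          · intro heq
            have := hι (Set.mem_Iio.2 n.lt_succ_self) (Set.mem_Iio.2 (by omega)) heq
            omega
        · exact hN e he n hmn n.lt_succ_self
      · intro heq
        have := hι (Set.mem_Iio.2 (by omega)) (Set.mem_Iio.2 n.lt_succ_self) heq
        omega

theorem blockRoot_range {n i : ℕ} (hi : i < n) : blockRoot (List.range n) i = i := by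
  simp [blockRoot, List.getD_eq_getElem?_getD, hi]

theorem isLabelling_range (n : ℕ) : IsLabelling n (blockRoot (List.range n)) := fun i hi => by
  rw [blockRoot_range hi, blockRoot_range hi]
  exact ⟨le_rfl, rfl⟩

theorem starEdges_range (ι : ℕ → α) (n : ℕ) :
    starEdges ι (blockRoot (List.range n)) n = 0 :=
  Finset.sum_eq_zero fun i hi => by rw [if_pos (blockRoot_range (Finset.mem_range.1 hi))]

/-- Contributions of a forest to connections depend only on the induced partition of the labels
below `m`, as long as the other labels are not used elsewhere. -/
theorem connIndicator_mapEdges_add [Finite α] {ι : ℕ → α} {n m : ℕ} (hmn : m ≤ n)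
    (hι : Set.InjOn ι (Set.Iio n)) {F : List (ℕ × ℕ)} (hF : ∀ e ∈ F, e.1 < n ∧ e.2 < n)
    {N : Multiset (Sym2 α)} {a b : α}
    (hN : ∀ e ∈ N, ∀ k, m ≤ k → k < n → ι k ∉ e) (ha : ∀ k, m ≤ k → k < n → a ≠ ι k)
    (hb : ∀ k, m ≤ k → k < n → b ≠ ι k) :
    match inducedPartition n m F with
    | none => connIndicator a b (mapEdges ι F + N) = 0
    | some L => (∀ i < m, blockRoot L i ≤ i) ∧ connIndicator a b (mapEdges ι F + N) =
        connIndicator a b (starEdges ι (blockRoot L) m + N) := by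
  have hspec := addEdges_spec ι F (L := List.range n)
    (by simpa using isLabelling_range n) (by simpa using hF)
  rw [List.length_range, starEdges_range, add_zero] at hspec
  rw [inducedPartition]
  cases h : addEdges (List.range n) F with
  | none =>
    rw [h] at hspec
    dsimp only at hspec
    exact connIndicator_add_eq_zero hspec _ _ _
  | some L =>
    rw [h] at hspec
    obtain ⟨hlen, hlab, hspan, hcard⟩ := hspec
    have htake : ∀ i < m, blockRoot L i = blockRoot (L.take m) i := fun i hi => by
      simp [blockRoot, List.getD_eq_getElem?_getD, hi]
    simp only [Option.map_some]
    refine ⟨fun i hi => ?_, ?_⟩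
    · rw [← htake i hi]
      exact (hlab i (by omega)).1
    · rw [← starEdges_congr htake, ← connIndicator_starEdges_add hmn hι hlab hN ha hb]
      apply connIndicator_congr
      · rw [edgeSpan_add, edgeSpan_add, hspan]
      · rw [Multiset.card_add, Multiset.card_add, hcard]

theorem sum_addTerm (φ : List ℕ → ℝ) (c : ℤ) (L : List ℕ) (t : List (ℤ × List ℕ)) :
    ((addTerm c L t).map fun a => (a.1 : ℝ) * φ a.2).sum =
      c * φ L + (t.map fun a => (a.1 : ℝ) * φ a.2).sum := by
  induction t with
  | nil => simp [addTerm]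
  | cons a t ih =>
    obtain ⟨d, K⟩ := a
    rw [addTerm, cond_eq_ite]
    split_ifs with h
    · have h : L = K := by simpa using h
      subst h
      simp only [List.map_cons, List.sum_cons]
      push_cast
      ring
    · simp only [List.map_cons, List.sum_cons, ih]
      ring

/-- The polynomial of an edge sum, for a placement `ι` of the labels. -/
noncomputable def EdgeSum.toPoly (ι : ℕ → α) (s : EdgeSum) : MvPolynomial (Sym2 α) ℝ :=
  (s.map fun a => (a.1 : ℝ) • edgeMonomial (mapEdges ι a.2)).sum

theorem connSum_toPoly_mul (ι : ℕ → α) (s : EdgeSum) (N : Multiset (Sym2 α)) (a b : α) :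
    connSum a b (s.toPoly ι * edgeMonomial N) =
      (s.map fun t => (t.1 : ℝ) * connIndicator a b (mapEdges ι t.2 + N)).sum := by
  induction s with
  | nil => simp [EdgeSum.toPoly]
  | cons t s ih =>
    have : EdgeSum.toPoly ι (t :: s) =
        (t.1 : ℝ) • edgeMonomial (mapEdges ι t.2) + EdgeSum.toPoly ι s := by
      simp [EdgeSum.toPoly]
    rw [this, add_mul, map_add, ih, smul_mul_assoc, ← edgeMonomial_add, map_smul,
      connSum_edgeMonomial]
    simp

theorem mem_of_labelsBelow {n : ℕ} {s : EdgeSum} (h : labelsBelow n s = true) :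
    ∀ a ∈ s, ∀ e ∈ a.2, e.1 < n ∧ e.2 < n := by
  intro a ha e he
  have := List.all_eq_true.1 (List.all_eq_true.1 h a ha) e he
  simpa using this

/-- The contribution of an edge sum is determined by the partitions induced by its forests. -/
theorem connSum_toPoly_mul_eq [Finite α] {ι : ℕ → α} {n m : ℕ} (hmn : m ≤ n)
    (hι : Set.InjOn ι (Set.Iio n)) {s : EdgeSum} (hs : labelsBelow n s = true)
    {N : Multiset (Sym2 α)} {a b : α}
    (hN : ∀ e ∈ N, ∀ k, m ≤ k → k < n → ι k ∉ e) (ha : ∀ k, m ≤ k → k < n → a ≠ ι k)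
    (hb : ∀ k, m ≤ k → k < n → b ≠ ι k) :
    connSum a b (s.toPoly ι * edgeMonomial N) =
      ((partitionSum n m s).map fun t => (t.1 : ℝ) *
        connIndicator a b (starEdges ι (blockRoot t.2) m + N)).sum := by
  have hlab := mem_of_labelsBelow hs
  clear hs
  rw [connSum_toPoly_mul]
  induction s with
  | nil => simp [partitionSum]
  | cons t s ih =>
    obtain ⟨c, F⟩ := t
    have ih := ih fun a ha => hlab a (List.mem_cons_of_mem _ ha)
    have hF := hlab (c, F) (List.mem_cons_self ..)
    have key := connIndicator_mapEdges_add hmn hι hF hN ha hb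
    rw [List.map_cons, List.sum_cons, ih, partitionSum]
    cases h : inducedPartition n m F with
    | none =>
      rw [h] at key
      dsimp only at key ⊢
      rw [key, mul_zero, zero_add]
    | some L =>
      rw [h] at key
      dsimp only at key ⊢
      rw [sum_addTerm fun L => connIndicator a b (starEdges ι (blockRoot L) m + N), key.2]

/-- An edge sum that vanishes for the labels below `m` contributes nothing, provided that the other
labels are not placed in `S`. -/
theorem gluingEquiv_zero_of_vanishes [Finite α] {ι : ℕ → α} {n m : ℕ} (hmn : m ≤ n)
    (hι : Set.InjOn ι (Set.Iio n)) {S : Set α} (hS : ∀ k, m ≤ k → k < n → ι k ∉ S)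
    {s : EdgeSum} (hs : vanishes n m s = true) : GluingEquiv S S (s.toPoly ι) 0 := by
  rw [vanishes, Bool.and_eq_true] at hs
  refine GluingEquiv.of_monomial fun N hN a ha b hb => ?_
  rw [zero_mul, map_zero, connSum_toPoly_mul_eq hmn hι hs.1
    (fun e he k hk hkn hmem => hS k hk hkn (hN e he _ hmem))
    (fun k hk hkn h => hS k hk hkn (h ▸ ha)) (fun k hk hkn h => hS k hk hkn (h ▸ hb))]
  refine List.sum_eq_zero fun x hx => ?_
  obtain ⟨t, ht, rfl⟩ := List.mem_map.1 hx
  have := List.all_eq_true.1 hs.2 t ht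
  have h0 : t.1 = 0 := by simpa using this
  simp [h0]

/-- An isolated vertex contributes nothing to its connections. -/
theorem connIndicator_eq_zero_of_isolated {M : Multiset (Sym2 α)} {a b : α}
    (hM : ∀ e ∈ M, a ∉ e) (hab : b ≠ a) : connIndicator a b M = 0 := by
  rw [connIndicator, if_neg]
  rintro ⟨-, h⟩
  have := edgeSpan_apply_eq_zero hM h
  simp [hab] at this

/-- If only connections of the label `0` are tested, forests in which it is isolated contribute
nothing. -/
theorem gluingEquiv_zero_of_vanishesMarked [Finite α] {ι : ℕ → α} {n m : ℕ} (hmn : m ≤ n)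
    (hm : 0 < m) (hι : Set.InjOn ι (Set.Iio n)) {S : Set α}
    (hS : ∀ k, m ≤ k → k < n → ι k ∉ S) (hS0 : ι 0 ∉ S)
    {s : EdgeSum} (hs : vanishesMarked n m s = true) : GluingEquiv {ι 0} S (s.toPoly ι) 0 := by
  rw [vanishesMarked, Bool.and_eq_true] at hs
  refine GluingEquiv.of_monomial fun N hN a ha b hb => ?_
  rw [Set.mem_singleton_iff] at ha
  subst ha
  have hinj : ∀ i < n, ι 0 = ι i → i = 0 := fun i hi h =>
    (hι (Set.mem_Iio.2 (by omega)) (Set.mem_Iio.2 hi) h).symm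
  rw [zero_mul, map_zero, connSum_toPoly_mul_eq hmn hι hs.1
    (fun e he k hk hkn hmem => hS k hk hkn (hN e he _ hmem))
    (fun k hk hkn h => by have := hinj k hkn h; omega)
    (fun k hk hkn h => hS k hk hkn (h ▸ hb))]
  refine List.sum_eq_zero fun x hx => ?_
  obtain ⟨⟨c, L⟩, ht, rfl⟩ := List.mem_map.1 hx
  have h := List.all_eq_true.1 hs.2 _ ht
  rw [Bool.or_eq_true] at h
  rcases h with h | h
  · have : c = 0 := by simpa using h
    simp [this]
  have hL : ∀ i < m, blockRoot L i ≤ i ∧ (i = 0 ∨ 0 < blockRoot L i) := fun i hi => by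
    have := List.all_eq_true.1 h i (List.mem_range.2 hi)
    simpa only [Bool.and_eq_true, Bool.or_eq_true, Nat.ble_eq, Nat.beq_eq, Nat.blt_eq] using this
  dsimp only
  rw [connIndicator_eq_zero_of_isolated, mul_zero]
  · intro e he
    rcases Multiset.mem_add.1 he with he | he
    · obtain ⟨i, hi, hne, rfl⟩ := mem_starEdges.1 he
      obtain ⟨h1, h2⟩ := hL i hi
      rw [Sym2.mem_iff, not_or]
      constructor <;> intro h3
      · have := hinj i (by omega) h3
        omega
      · have := hinj _ (by omega) h3
        omega
    · exact fun hmem => hS0 (hN e he _ hmem)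
  · rintro rfl
    exact hS0 hb

theorem connSum_toPoly [Finite α] {ι : ℕ → α} {n : ℕ} (hn : 2 ≤ n)
    (hι : Set.InjOn ι (Set.Iio n)) {s : EdgeSum} (hs : labelsBelow n s = true) :
    connSum (ι 0) (ι 1) (s.toPoly ι) = connCount n s := by
  have hlab := mem_of_labelsBelow hs
  have h := connSum_toPoly_mul ι s 0 (ι 0) (ι 1)
  have h1 : edgeMonomial (0 : Multiset (Sym2 α)) = 1 := by simp [edgeMonomial]
  rw [h1, mul_one] at h
  rw [h]
  clear h hs
  have hne : ∀ i < 2, ∀ k, 2 ≤ k → k < n → ι i ≠ ι k := fun i hi k hk hkn heq => by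
    have := hι (Set.mem_Iio.2 (by omega)) (Set.mem_Iio.2 hkn) heq
    omega
  induction s with
  | nil => simp [connCount]
  | cons t s ih =>
    obtain ⟨c, F⟩ := t
    have ih := ih fun a ha => hlab a (List.mem_cons_of_mem _ ha)
    have hF := hlab (c, F) (List.mem_cons_self ..)
    have key := connIndicator_mapEdges_add hn hι hF (N := 0) (a := ι 0) (b := ι 1)
      (by simp) (hne 0 (by omega)) (hne 1 (by omega))
    rw [List.map_cons, List.sum_cons, ih, connCount]
    cases h : inducedPartition n 2 F with
    | none =>
      rw [h] at key
      dsimp only at key ⊢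
      rw [key, mul_zero, zero_add]
    | some L =>
      rw [h] at key
      dsimp only at key ⊢
      obtain ⟨hle, key⟩ := key
      have h01 : ι 0 ≠ ι 1 := fun heq => by
        have := hι (Set.mem_Iio.2 (by omega)) (Set.mem_Iio.2 (by omega)) heq
        omega
      have h0 := hle 0 (by omega)
      have h1 := hle 1 (by omega)
      have h0' : blockRoot L 0 = 0 := by omega
      rw [key, add_zero, cond_eq_ite]
      have hstar : starEdges ι (blockRoot L) 2 =
          if blockRoot L 1 = 1 then 0 else {s(ι 1, ι (blockRoot L 1))} := by
        rw [starEdges_succ, starEdges_succ, if_pos h0']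
        simp [starEdges]
      rw [hstar]
      by_cases hL : blockRoot L 1 = 0
      · have hval : connIndicator (ι 0) (ι 1) {s(ι 1, ι 0)} = 1 := by
          have h2 : (Finsupp.single (ι 1) 1 - Finsupp.single (ι 0) 1 : α →₀ ℚ) ∉
              edgeSpan (0 : Multiset (Sym2 α)) := by
            rw [edgeSpan_zero, Submodule.mem_bot]
            intro h2
            have := DFunLike.congr_fun h2 (ι 1)
            simp [h01] at this
          have h3 := finrank_edgeSpan_cons h2
          rw [connIndicator, if_pos]
          refine ⟨by simpa [-edgeSpan_zero] using h3.trans (by rw [edgeSpan_zero, finrank_bot]), ?_⟩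
          rw [← neg_sub]
          exact neg_mem (single_sub_mem_edgeSpan (Multiset.mem_singleton_self _))
        have hbeq : Nat.beq (L.getD 1 0) 0 = true := by
          rw [show L.getD 1 0 = 0 from hL]
          rfl
        rw [if_pos hbeq, if_neg (by omega), hL, hval]
        push_cast
        ring
      · have hL1 : blockRoot L 1 = 1 := by omega
        have hval : connIndicator (ι 0) (ι 1) 0 = 0 := by
          rw [connIndicator, if_neg]
          rintro ⟨-, h2⟩
          rw [edgeSpan_zero, Submodule.mem_bot] at h2
          have := DFunLike.congr_fun h2 (ι 1)
          simp [h01] at this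
        have hbeq : ¬ Nat.beq (L.getD 1 0) 0 = true := by
          rw [show L.getD 1 0 = 1 from hL1]
          decide
        rw [if_neg hbeq, if_pos hL1, hval]
        ring

theorem EdgeSum.toPoly_append (ι : ℕ → α) (s t : EdgeSum) :
    EdgeSum.toPoly ι (s ++ t) = EdgeSum.toPoly ι s + EdgeSum.toPoly ι t := by
  simp [EdgeSum.toPoly]

theorem EdgeSum.toPoly_smul (ι : ℕ → α) (c : ℤ) (s : EdgeSum) :
    (EdgeSum.smul c s).toPoly ι = (c : ℝ) • s.toPoly ι := by
  simp [EdgeSum.toPoly, EdgeSum.smul, Function.comp_def, List.smul_sum, mul_smul]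

theorem EdgeSum.toPoly_relabel (ι : ℕ → α) (σ : ℕ → ℕ) (s : EdgeSum) :
    (EdgeSum.relabel σ s).toPoly ι = s.toPoly (fun i => ι (σ i)) := by
  simp [EdgeSum.toPoly, EdgeSum.relabel, Function.comp_def, mapEdges]

theorem mapEdges_append (ι : ℕ → α) (F H : List (ℕ × ℕ)) :
    mapEdges ι (F ++ H) = mapEdges ι F + mapEdges ι H := by
  simp [mapEdges]

theorem EdgeSum.toPoly_mul (ι : ℕ → α) (s t : EdgeSum) :
    (EdgeSum.mul s t).toPoly ι = s.toPoly ι * t.toPoly ι := by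
  induction s with
  | nil => simp [EdgeSum.mul, EdgeSum.toPoly]
  | cons a s ih =>
    have h1 : EdgeSum.mul (a :: s) t =
        (t.map fun b => (a.1 * b.1, a.2 ++ b.2)) ++ EdgeSum.mul s t := by
      simp [EdgeSum.mul]
    have h2 : EdgeSum.toPoly ι (a :: s) =
        (a.1 : ℝ) • edgeMonomial (mapEdges ι a.2) + EdgeSum.toPoly ι s := by
      simp [EdgeSum.toPoly]
    rw [h1, EdgeSum.toPoly_append, ih, h2, add_mul]
    congr 1
    simp only [EdgeSum.toPoly, List.map_map, Function.comp_def]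
    rw [← List.sum_map_mul_left]
    congr 1
    refine List.map_congr_left fun b _ => ?_
    rw [mapEdges_append, edgeMonomial_add, smul_mul_smul_comm]
    push_cast
    rfl

theorem EdgeSum.toPoly_mem_edgesWithin {ι : ℕ → α} {n : ℕ} {S : Set α}
    (hι : ∀ i < n, ι i ∈ S) {s : EdgeSum} (hs : labelsBelow n s = true) :
    s.toPoly ι ∈ edgesWithin S := by
  have hlab := mem_of_labelsBelow hs
  refine list_sum_mem fun x hx => ?_
  obtain ⟨a, ha, rfl⟩ := List.mem_map.1 hx
  refine Subalgebra.smul_mem _ ?_ _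
  refine multiset_prod_mem _ fun y hy => ?_
  obtain ⟨e, he, rfl⟩ := Multiset.mem_map.1 hy
  obtain ⟨e, he', rfl⟩ := List.mem_map.1 (Multiset.mem_coe.1 he)
  have := hlab a ha e he'
  exact X_mem_edgesWithin (hι _ this.1) (hι _ this.2)

end Labels

/-! ### The cones of two-terminal states -/

namespace EdgeSum

/- The labels of a state are `0` for the ghost vertex, `1, 2` for the two copies of the left
terminal and `3, 4` for those of the right terminal. -/

/-- A simple edge between the terminals, present on one of the two levels. -/
def straight : EdgeSum := [(1, [(1, 3)]), (1, [(2, 4)])]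

/-- A connection between any copy of the left terminal and any copy of the right terminal; this
is what remains of a post with one edge to each of the terminals. -/
def mixed : EdgeSum := straight ++ [(1, [(1, 4)]), (1, [(2, 3)])]

/-- An edge between the terminals on each of the levels. -/
def double : EdgeSum := [(1, [(1, 3), (2, 4)])]

/-- The double edge, with the levels exchanged at one of the terminals. -/
def crossed : EdgeSum := [(1, [(1, 4), (2, 3)])]

/-- A post at the left terminal. -/
def leftPost : EdgeSum := [(1, [(1, 2)])]

/-- A post at the right terminal. -/
def rightPost : EdgeSum := [(1, [(3, 4)])]

/-- Half the square of `mixed`: two disjoint branches, each containing one post. -/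
def mixedPair : EdgeSum :=
  double ++ crossed ++ mul straight leftPost ++ mul straight rightPost

/-- The ghost is attached to the left terminal, with a sign depending on the level. -/
def leftMark : EdgeSum := [(1, [(0, 1)]), (-1, [(0, 2)])]

/-- The mirror image of `leftMark`. -/
def rightMark : EdgeSum := [(1, [(0, 3)]), (-1, [(0, 4)])]

/-- The ghost is attached to a simple edge between the terminals, with a sign depending on the
level of the edge. -/
def edgeMark : EdgeSum := [(1, [(1, 3), (0, 1)]), (-1, [(2, 4), (0, 2)])]

/-- What remains of a marked vertex with one edge to each of the terminals. -/
def earMark : EdgeSum := leftMark ++ rightMark ++ edgeMark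

/-- What remains of a marked vertex with an edge to the left terminal and a mixed connection to
the right terminal. -/
def leftMixedMark : EdgeSum := smul 2 leftMark ++
  [(1, [(1, 3), (0, 1)]), (1, [(1, 4), (0, 1)]), (-1, [(2, 3), (0, 2)]), (-1, [(2, 4), (0, 2)])]

/-- The mirror image of `leftMixedMark`. -/
def rightMixedMark : EdgeSum := smul 2 rightMark ++
  [(1, [(1, 3), (0, 3)]), (1, [(2, 3), (0, 3)]), (-1, [(1, 4), (0, 4)]), (-1, [(2, 4), (0, 4)])]

/-- Generators for the case of at most one post. -/
def unmarkedGensOne : List EdgeSum :=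
  [[(1, [])], straight, double, mixed, leftPost, rightPost, mul straight leftPost,
    mul straight rightPost, mul double leftPost]

/-- Generators of the cone of states of outerplanar graphs that contain `t` posts (`t ≤ 2`) and
no marked vertex apart from the terminals. -/
def unmarkedGens : ℕ → List EdgeSum
  | 0 => [[(1, [])], straight, double]
  | 1 => unmarkedGensOne
  | _ => unmarkedGensOne ++ [mul leftPost rightPost, mixedPair]

/-- Generators of a cone that contains the states of outerplanar graphs with `t` posts (`t ≤ 1`)
and one marked vertex. For `t = 1` the cone is chosen larger than necessary, which reduces the
number of generators. -/
def markedGens : ℕ → List EdgeSum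
  | 0 => [leftMark, rightMark, mul straight leftMark, mul straight rightMark,
      mul double leftMark, earMark]
  | _ => [leftMark, rightMark, mul straight leftMark, mul straight rightMark,
      mul double leftMark, mul rightPost leftMark, mul leftPost rightMark,
      mul straight (mul rightPost leftMark), mul straight (mul leftPost rightMark),
      mul rightPost earMark, mul leftPost earMark,
      mul mixed leftMark ++ smul (-1) (mul rightPost leftMark),
      mul mixed rightMark ++ smul (-1) (mul leftPost rightMark),
      leftMixedMark ++ smul (-1) (mul rightPost leftMark),
      rightMixedMark ++ smul (-1) (mul leftPost rightMark),
      smul 2 (mul straight leftMark) ++ smul (-1) (mul straight (mul rightPost leftMark)) ++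
        mul rightPost edgeMark ++ smul (-1) (mul leftPost edgeMark),
      smul 2 (mul straight rightMark) ++ smul (-1) (mul straight (mul leftPost rightMark)) ++
        mul leftPost edgeMark ++ smul (-1) (mul rightPost edgeMark),
      leftMixedMark ++ smul 2 (mul straight leftMark) ++ smul (-1) (mul mixed leftMark) ++
        smul (-1) (mul leftPost edgeMark),
      rightMixedMark ++ smul 2 (mul straight rightMark) ++ smul (-1) (mul mixed rightMark) ++
        smul (-1) (mul rightPost edgeMark)]

/-- The labels of the left one of two states that are glued: when two states are glued at a vertex,
the labels `5, 6` are used for its two copies. -/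
def leftLabel (i : ℕ) : ℕ := [0, 1, 2, 5, 6].getD i 0

/-- The labels of the right one of two states that are glued. -/
def rightLabel (i : ℕ) : ℕ := [0, 5, 6, 3, 4].getD i 0

/-- Exchanges the terminals. -/
def flipLabel (i : ℕ) : ℕ := [0, 3, 4, 1, 2].getD i 0

/-- All results of gluing an element of `G` and an element of `H` at a vertex. -/
def glueAll (G H : List EdgeSum) : List EdgeSum :=
  G.flatMap fun g => H.map fun h => mul (relabel leftLabel g) (relabel rightLabel h)

/-- All results of adding edges between the terminals, on one or on both levels. -/
def joinEdge (G : List EdgeSum) : List EdgeSum :=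
  G.map (mul straight) ++ G.map (mul double)

/-- The combination of the sums in `G` given by a list of coefficients and indices. -/
def combination (G : List EdgeSum) (r : List (ℕ × ℕ)) : EdgeSum :=
  r.flatMap fun a => smul a.1 (G.getD a.2 [])

/-- The rows of the certificate express positive multiples of the given sums as nonnegative
combinations of the elements of `G`, up to sums that vanish. -/
def certified (van : EdgeSum → Bool) (G : List EdgeSum) :
    List EdgeSum → List (ℕ × List (ℕ × ℕ)) → Bool
  | [], _ => true
  | _ :: _, [] => false
  | s :: l, r :: rs => Nat.blt 0 r.1 && van (smul r.1 s ++ smul (-1) (combination G r.2)) &&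
      certified van G l rs

/-! ### Certificates -/

/- The following certificates show that the cones are closed under gluing at a vertex, adding an
edge between the terminals, adding a post, exchanging the terminals, and marking a terminal. -/

theorem certified_unmarkedGlue00 : certified (vanishes 7 5) (unmarkedGens 0)
    (glueAll (unmarkedGens 0) (unmarkedGens 0))
    [(1, [(1, 0)]), (1, [(2, 0)]), (1, [(1, 0)]), (1, [(2, 0)]), (1, [(2, 0), (1, 1)]), (1, [(1,
     1)]), (1, [(1, 0)]), (1, [(1, 1)]), (1, [(1, 2)])] = true := by
  decide +kernel

theorem certified_unmarkedGlue01 : certified (vanishes 7 5) (unmarkedGens 1)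
    (glueAll (unmarkedGens 0) (unmarkedGens 1))
    [(1, [(1, 0)]), (1, [(2, 0)]), (1, [(1, 0)]), (1, [(4, 0)]), (1, [(1, 0)]), (1, [(1, 5)]),
     (1, [(2, 0)]), (1, [(2, 5)]), (1, [(1, 5)]), (1, [(2, 0)]), (1, [(2, 0), (1, 1)]), (1, [(1,
     1)]), (1, [(4, 0), (1, 3)]), (1, [(2, 0)]), (1, [(2, 5)]), (1, [(1, 3)]), (1, [(2, 5), (1,
     7)]), (1, [(1, 7)]), (1, [(1, 0)]), (1, [(1, 1)]), (1, [(1, 2)]), (1, [(1, 3)]), (1, [(1,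
     4)]), (1, [(1, 5)]), (1, [(1, 6)]), (1, [(1, 7)]), (1, [(1, 8)])] = true := by
  decide +kernel

theorem certified_unmarkedGlue02 : certified (vanishes 7 5) (unmarkedGens 2)
    (glueAll (unmarkedGens 0) (unmarkedGens 2))
    [(1, [(1, 0)]), (1, [(2, 0)]), (1, [(1, 0)]), (1, [(4, 0)]), (1, [(1, 0)]), (1, [(1, 5)]),
     (1, [(2, 0)]), (1, [(2, 5)]), (1, [(1, 5)]), (1, [(1, 5)]), (1, [(4, 0), (2, 5)]), (1, [(2,
     0)]), (1, [(2, 0), (1, 1)]), (1, [(1, 1)]), (1, [(4, 0), (1, 3)]), (1, [(2, 0)]), (1, [(2,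
     5)]), (1, [(1, 3)]), (1, [(2, 5), (1, 7)]), (1, [(1, 7)]), (1, [(2, 5)]), (1, [(2, 3), (2,
     5), (1, 7)]), (1, [(1, 0)]), (1, [(1, 1)]), (1, [(1, 2)]), (1, [(1, 3)]), (1, [(1, 4)]), (1,
     [(1, 5)]), (1, [(1, 6)]), (1, [(1, 7)]), (1, [(1, 8)]), (1, [(1, 9)]), (1, [(1, 10)])]
    = true := by
  decide +kernel

theorem certified_unmarkedGlue11 : certified (vanishes 7 5) (unmarkedGens 2)
    (glueAll (unmarkedGens 1) (unmarkedGens 1))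
    [(1, [(1, 0)]), (1, [(2, 0)]), (1, [(1, 0)]), (1, [(4, 0)]), (1, [(1, 0)]), (1, [(1, 5)]),
     (1, [(2, 0)]), (1, [(2, 5)]), (1, [(1, 5)]), (1, [(2, 0)]), (1, [(2, 0), (1, 1)]), (1, [(1,
     1)]), (1, [(4, 0), (1, 3)]), (1, [(2, 0)]), (1, [(2, 5)]), (1, [(1, 3)]), (1, [(2, 5), (1,
     7)]), (1, [(1, 7)]), (1, [(1, 0)]), (1, [(1, 1)]), (1, [(1, 2)]), (1, [(1, 3)]), (1, [(1,
     4)]), (1, [(1, 5)]), (1, [(1, 6)]), (1, [(1, 7)]), (1, [(1, 8)]), (1, [(4, 0)]), (1, [(4,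
     0), (1, 3)]), (1, [(1, 3)]), (1, [(8, 0), (2, 3)]), (1, [(4, 0)]), (1, [(4, 5)]), (1, [(2,
     3)]), (1, [(4, 5), (2, 7)]), (1, [(2, 7)]), (1, [(1, 4)]), (1, [(2, 4)]), (1, [(1, 4)]), (1,
     [(4, 4)]), (1, [(1, 4)]), (1, [(1, 9)]), (1, [(2, 4)]), (1, [(2, 9)]), (1, [(1, 9)]), (1,
     [(1, 0)]), (1, [(2, 0)]), (1, [(1, 5)]), (1, [(4, 0)]), (1, []), (1, [(1, 5)]), (1, []), (1,
     [(2, 5)]), (1, []), (1, [(2, 4)]), (1, [(2, 4), (1, 6)]), (1, [(1, 6)]), (1, [(4, 4), (2,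
     6)]), (1, [(2, 4)]), (1, [(2, 9)]), (1, [(2, 6)]), (1, [(2, 8), (2, 9)]), (1, [(2, 8)]), (1,
     [(2, 0)]), (1, [(1, 3)]), (1, [(1, 7)]), (1, [(2, 3)]), (1, []), (1, [(2, 5)]), (1, []), (1,
     [(2, 7)]), (1, []), (1, [(1, 4)]), (1, [(1, 6)]), (1, [(1, 8)]), (1, [(2, 6)]), (1, []), (1,
     [(1, 9)]), (1, []), (1, [(2, 8)]), (1, [])] = true := by
  decide +kernel

theorem certified_unmarkedEdge0 : certified (vanishes 5 5) (unmarkedGens 0)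
    (joinEdge (unmarkedGens 0))
    [(1, [(1, 1)]), (1, [(2, 2)]), (1, []), (1, [(1, 2)]), (1, []), (1, [])] = true := by
  decide +kernel

theorem certified_unmarkedEdge1 : certified (vanishes 5 5) (unmarkedGens 1)
    (joinEdge (unmarkedGens 1))
    [(1, [(1, 1)]), (1, [(2, 2)]), (1, []), (1, [(2, 2), (1, 6), (1, 7)]), (1, [(1, 6)]), (1,
     [(1, 7)]), (1, [(2, 8)]), (1, [(2, 8)]), (1, []), (1, [(1, 2)]), (1, []), (1, []), (1, [(2,
     8)]), (1, [(1, 8)]), (1, [(1, 8)]), (1, []), (1, []), (1, [])] = true := by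
  decide +kernel

theorem certified_unmarkedEdge2 : certified (vanishes 5 5) (unmarkedGens 2)
    (joinEdge (unmarkedGens 2))
    [(1, [(1, 1)]), (1, [(2, 2)]), (1, []), (1, [(2, 2), (1, 6), (1, 7)]), (1, [(1, 6)]), (1,
     [(1, 7)]), (1, [(2, 8)]), (1, [(2, 8)]), (1, []), (1, [(2, 8)]), (1, [(6, 8)]), (1, [(1,
     2)]), (1, []), (1, []), (1, [(2, 8)]), (1, [(1, 8)]), (1, [(1, 8)]), (1, []), (1, []), (1,
     []), (1, []), (1, [])] = true := by
  decide +kernel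

theorem certified_unmarkedPost0 : certified (vanishes 5 5) (unmarkedGens 1)
    ((unmarkedGens 0).map (mul rightPost))
    [(1, [(1, 5)]), (1, [(1, 7)]), (1, [(1, 8)])] = true := by
  decide +kernel

theorem certified_unmarkedPost1 : certified (vanishes 5 5) (unmarkedGens 2)
    ((unmarkedGens 1).map (mul rightPost))
    [(1, [(1, 5)]), (1, [(1, 7)]), (1, [(1, 8)]), (1, [(2, 7)]), (1, [(1, 9)]), (1, []), (1,
     [(2, 8)]), (1, []), (1, [])] = true := by
  decide +kernel

theorem certified_unmarkedFlip0 : certified (vanishes 5 5) (unmarkedGens 0)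
    ((unmarkedGens 0).map (relabel flipLabel))
    [(1, [(1, 0)]), (1, [(1, 1)]), (1, [(1, 2)])] = true := by
  decide +kernel

theorem certified_unmarkedFlip1 : certified (vanishes 5 5) (unmarkedGens 1)
    ((unmarkedGens 1).map (relabel flipLabel))
    [(1, [(1, 0)]), (1, [(1, 1)]), (1, [(1, 2)]), (1, [(1, 3)]), (1, [(1, 5)]), (1, [(1, 4)]),
     (1, [(1, 7)]), (1, [(1, 6)]), (1, [(1, 8)])] = true := by
  decide +kernel

theorem certified_unmarkedFlip2 : certified (vanishes 5 5) (unmarkedGens 2)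
    ((unmarkedGens 2).map (relabel flipLabel))
    [(1, [(1, 0)]), (1, [(1, 1)]), (1, [(1, 2)]), (1, [(1, 3)]), (1, [(1, 5)]), (1, [(1, 4)]),
     (1, [(1, 7)]), (1, [(1, 6)]), (1, [(1, 8)]), (1, [(1, 9)]), (1, [(1, 10)])] = true := by
  decide +kernel

theorem certified_markedGlue00 : certified (vanishesMarked 7 5) (markedGens 0)
    (glueAll (markedGens 0) (unmarkedGens 0))
    [(1, [(1, 0)]), (1, [(2, 0)]), (1, [(1, 0)]), (1, []), (1, [(1, 1)]), (1, [(1, 1)]), (1,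
     [(2, 0)]), (1, [(2, 0), (1, 2)]), (1, [(1, 2)]), (1, [(1, 0)]), (1, [(1, 5)]), (1, [(1,
     3)]), (1, [(1, 0)]), (1, [(1, 2)]), (1, [(1, 4)]), (1, [(2, 0)]), (1, [(2, 0), (1, 5)]), (1,
     [(1, 5)])] = true := by
  decide +kernel

theorem certified_markedGlue01 : certified (vanishesMarked 7 5) (markedGens 1)
    (glueAll (markedGens 0) (unmarkedGens 1))
    [(1, [(1, 0)]), (1, [(2, 0)]), (1, [(1, 0)]), (1, [(4, 0)]), (1, [(1, 0)]), (1, [(1, 5)]),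
     (1, [(2, 0)]), (1, [(2, 5)]), (1, [(1, 5)]), (1, []), (1, [(1, 1)]), (1, [(1, 1)]), (1, []),
     (1, []), (1, []), (1, []), (1, []), (1, []), (1, [(2, 0)]), (1, [(2, 0), (1, 2)]), (1, [(1,
     2)]), (1, [(4, 0), (1, 5), (1, 11)]), (1, [(2, 0)]), (1, [(2, 5)]), (1, [(1, 5), (1, 11)]),
     (1, [(2, 5), (1, 7)]), (1, [(1, 7)]), (1, [(1, 0)]), (2, [(1, 5), (1, 6), (1, 13), (1,
     14)]), (1, [(1, 3)]), (1, [(1, 5), (1, 13)]), (1, []), (1, [(1, 5)]), (1, []), (1, [(1,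
     9)]), (1, []), (1, [(1, 0)]), (1, [(1, 2)]), (1, [(1, 4)]), (1, [(1, 5), (1, 11)]), (1, []),
     (1, [(1, 5)]), (1, []), (1, [(1, 7)]), (1, []), (1, [(2, 0)]), (2, [(4, 0), (1, 5), (1, 6),
     (1, 13), (1, 14)]), (2, [(1, 5), (1, 6), (1, 13), (1, 14)]), (1, [(4, 0), (1, 5), (1, 13)]),
     (1, [(2, 0)]), (1, [(2, 5)]), (1, [(1, 5), (1, 13)]), (1, [(2, 5), (1, 9)]), (1, [(1, 9)])]
    = true := by
  decide +kernel

theorem certified_markedGlue10 : certified (vanishesMarked 7 5) (markedGens 1)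
    (glueAll (markedGens 1) (unmarkedGens 0))
    [(1, [(1, 0)]), (1, [(2, 0)]), (1, [(1, 0)]), (1, []), (1, [(1, 1)]), (1, [(1, 1)]), (1,
     [(2, 0)]), (1, [(2, 0), (1, 2)]), (1, [(1, 2)]), (1, [(1, 0)]), (2, [(1, 5), (1, 6), (1,
     13), (1, 14)]), (1, [(1, 3)]), (1, [(1, 0)]), (1, [(1, 2)]), (1, [(1, 4)]), (1, [(1, 0)]),
     (1, [(2, 0)]), (1, [(1, 5)]), (1, []), (1, [(1, 6)]), (1, [(1, 6)]), (1, [(2, 0)]), (1, [(1,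
     5), (1, 11)]), (1, [(1, 7)]), (1, []), (1, [(1, 10)]), (1, [(1, 8)]), (1, [(2, 0)]), (1,
     [(1, 5), (1, 13)]), (1, [(1, 9)]), (1, []), (1, [(1, 10)]), (1, [(1, 10)]), (1, [(3, 0)]),
     (1, [(2, 0), (1, 5), (1, 11)]), (1, [(1, 11)]), (1, []), (1, [(1, 14)]), (1, [(1, 12)]), (1,
     [(3, 0)]), (1, [(2, 0), (1, 5), (1, 13)]), (1, [(1, 13)]), (1, []), (1, [(1, 14)]), (1, [(1,
     14)]), (1, [(3, 0)]), (1, [(2, 0), (1, 17)]), (1, [(1, 15)]), (1, [(1, 0)]), (1, [(2, 0),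
     (1, 14)]), (1, [(1, 16)]), (1, [(4, 0)]), (1, [(4, 0), (1, 17)]), (1, [(1, 17)]), (1, [(1,
     0)]), (1, [(2, 0), (1, 6), (1, 14)]), (1, [(1, 18)])] = true := by
  decide +kernel

theorem certified_markedEdge0 : certified (vanishesMarked 5 5) (markedGens 0)
    (joinEdge (markedGens 0))
    [(1, [(1, 2)]), (1, [(1, 3)]), (1, [(2, 4)]), (1, [(2, 4)]), (1, []), (1, [(1, 2), (1, 3),
     (1, 4)]), (1, [(1, 4)]), (1, [(1, 4)]), (1, []), (1, []), (1, []), (1, [(2, 4)])] = true := by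
  decide +kernel

theorem certified_markedEdge1 : certified (vanishesMarked 5 5) (markedGens 1)
    (joinEdge (markedGens 1))
    [(1, [(1, 2)]), (1, [(1, 3)]), (1, [(2, 4)]), (1, [(2, 4)]), (1, []), (1, [(1, 7)]), (1,
     [(1, 8)]), (1, []), (1, []), (1, [(1, 7)]), (1, [(1, 8)]), (1, [(2, 4)]), (1, [(2, 4)]), (1,
     [(1, 4), (1, 15)]), (1, [(1, 4), (1, 16)]), (1, [(4, 4)]), (1, [(4, 4)]), (1, [(3, 4), (1,
     15)]), (1, [(3, 4), (1, 16)]), (1, [(1, 4)]), (1, [(1, 4)]), (1, []), (1, []), (1, []), (1,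
     []), (1, []), (1, []), (1, []), (1, []), (1, []), (1, []), (1, []), (1, [(2, 4)]), (1, [(2,
     4)]), (1, []), (1, []), (1, [(2, 4)]), (1, [(2, 4)])] = true := by
  decide +kernel

theorem certified_markedFlip0 : certified (vanishesMarked 5 5) (markedGens 0)
    ((markedGens 0).map (relabel flipLabel))
    [(1, [(1, 1)]), (1, [(1, 0)]), (1, [(1, 3)]), (1, [(1, 2)]), (1, [(1, 4)]), (1, [(1, 5)])]
    = true := by
  decide +kernel

theorem certified_markedFlip1 : certified (vanishesMarked 5 5) (markedGens 1)
    ((markedGens 1).map (relabel flipLabel))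
    [(1, [(1, 1)]), (1, [(1, 0)]), (1, [(1, 3)]), (1, [(1, 2)]), (1, [(1, 4)]), (1, [(1, 6)]),
     (1, [(1, 5)]), (1, [(1, 8)]), (1, [(1, 7)]), (1, [(1, 10)]), (1, [(1, 9)]), (1, [(1, 12)]),
     (1, [(1, 11)]), (1, [(1, 14)]), (1, [(1, 13)]), (1, [(1, 16)]), (1, [(1, 15)]), (1, [(1,
     18)]), (1, [(1, 17)])] = true := by
  decide +kernel

theorem certified_mark0 : certified (vanishesMarked 5 5) (markedGens 0)
    ((unmarkedGens 0).map (mul rightMark))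
    [(1, [(1, 1)]), (1, [(1, 3)]), (1, [(1, 4)])] = true := by
  decide +kernel

theorem certified_mark1 : certified (vanishesMarked 5 5) (markedGens 1)
    ((unmarkedGens 1).map (mul rightMark))
    [(1, [(1, 1)]), (1, [(1, 3)]), (1, [(1, 4)]), (1, [(1, 6), (1, 12)]), (1, [(1, 6)]), (1,
     []), (1, [(1, 8)]), (1, []), (1, [])] = true := by
  decide +kernel

/-- In pairings of two marked states, the labels `0, 1` are used for their ghosts and `2, 3, 4, 5`
for the terminals. This function gives the labels of the first state. -/
def firstLabel (i : ℕ) : ℕ := [0, 2, 3, 4, 5].getD i 0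

/-- The labels of the second one of two marked states that are paired. -/
def secondLabel (i : ℕ) : ℕ := [1, 2, 3, 4, 5].getD i 0

theorem connCount_marked_marked : (markedGens 1).all (fun g => (markedGens 1).all fun h =>
    decide (0 ≤ connCount 6 (mul (relabel firstLabel g) (relabel secondLabel h)))) = true := by
  decide +kernel

theorem connCount_mark_marked : (unmarkedGens 2).all (fun g => (markedGens 0).all fun h =>
    decide (0 ≤ connCount 6 (mul (relabel firstLabel (mul rightMark g))
      (relabel secondLabel h)))) = true := by
  decide +kernel

/-- The labels of the left part of the first state in a pairing, if it is glued from two parts. The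
labels `6, 7` are used for the vertex at which they are glued. -/
def firstLeftLabel (i : ℕ) : ℕ := [0, 2, 3, 6, 7].getD i 0

/-- The labels of the right part of the first state in a pairing. -/
def firstRightLabel (i : ℕ) : ℕ := [0, 6, 7, 4, 5].getD i 0

theorem connCount_glue_marked : (markedGens 0).all (fun g => (unmarkedGens 2).all fun h =>
    (markedGens 0).all fun k => decide (0 ≤ connCount 8
      (mul (mul (relabel firstLeftLabel g) (relabel firstRightLabel h))
        (relabel secondLabel k)))) = true := by
  decide +kernel

theorem labelsBelow_unmarkedGens (t : ℕ) : ∀ s ∈ unmarkedGens t, labelsBelow 5 s = true := by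
  match t with
  | 0 => decide +kernel
  | 1 => decide +kernel
  | t + 2 => exact (by decide +kernel : ∀ s ∈ unmarkedGens 2, labelsBelow 5 s = true)

theorem labelsBelow_markedGens (t : ℕ) : ∀ s ∈ markedGens t, labelsBelow 5 s = true := by
  match t with
  | 0 => decide +kernel
  | t + 1 => exact (by decide +kernel : ∀ s ∈ markedGens 1, labelsBelow 5 s = true)

theorem labelsBelow_marked_marked : (markedGens 1).all (fun g => (markedGens 1).all fun h =>
    labelsBelow 6 (mul (relabel firstLabel g) (relabel secondLabel h))) = true := by
  decide +kernel

theorem labelsBelow_mark_marked : (unmarkedGens 2).all (fun g => (markedGens 0).all fun h =>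
    labelsBelow 6 (mul (relabel firstLabel (mul rightMark g)) (relabel secondLabel h))) = true := by
  decide +kernel

theorem labelsBelow_glue_marked : (markedGens 0).all (fun g => (unmarkedGens 2).all fun h =>
    (markedGens 0).all fun k => labelsBelow 8
      (mul (mul (relabel firstLeftLabel g) (relabel firstRightLabel h))
        (relabel secondLabel k))) = true := by
  decide +kernel

end EdgeSum

open scoped NNReal

/-! ### Cones of polynomials up to gluing equivalence -/

section Cones

variable {α : Type*} {A A' S S' : Set α} {C C' : Set (MvPolynomial (Sym2 α) ℝ)}
  {X Y Z : MvPolynomial (Sym2 α) ℝ}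

/-- The polynomials that are gluing equivalent to a nonnegative combination of elements of `C`. -/
noncomputable def gluingCone (A S : Set α) (C : Set (MvPolynomial (Sym2 α) ℝ)) :
    Submodule ℝ≥0 (MvPolynomial (Sym2 α) ℝ) where
  carrier := {X | ∃ Y ∈ Submodule.span ℝ≥0 C, GluingEquiv A S X Y}
  add_mem' := by
    rintro X X' ⟨Y, hY, h⟩ ⟨Y', hY', h'⟩
    exact ⟨Y + Y', add_mem hY hY', h.add h'⟩
  zero_mem' := ⟨0, zero_mem _, GluingEquiv.refl _ _ _⟩
  smul_mem' := by
    rintro c X ⟨Y, hY, h⟩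
    exact ⟨c • Y, Submodule.smul_mem _ _ hY, h.smul (c : ℝ)⟩

theorem GluingEquiv.mem_gluingCone (h : GluingEquiv A S X Y) (hY : Y ∈ gluingCone A S C) :
    X ∈ gluingCone A S C := by
  obtain ⟨Y', hY', h'⟩ := hY
  exact ⟨Y', hY', h.trans h'⟩

theorem subset_gluingCone : C ⊆ gluingCone A S C := fun X hX =>
  ⟨X, Submodule.subset_span hX, GluingEquiv.refl _ _ _⟩

theorem real_smul_mem_gluingCone {c : ℝ} (hc : 0 ≤ c) (hX : X ∈ gluingCone A S C) :
    c • X ∈ gluingCone A S C :=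
  Submodule.smul_mem _ (⟨c, hc⟩ : ℝ≥0) hX

/-- Membership of a product in a cone can be checked on the generators of a cone that contains one
of the factors. -/
theorem mul_mem_gluingCone (hX : X ∈ gluingCone A' S' C') (hA : A ⊆ A') (hS : S ⊆ S')
    (hZ : Z ∈ edgesWithin S') (h : ∀ g ∈ C', g * Z ∈ gluingCone A S C) :
    X * Z ∈ gluingCone A S C := by
  obtain ⟨Y, hY, hXY⟩ := hX
  refine ((hXY.mul_right hZ).anti hA hS).mem_gluingCone ?_
  clear hXY
  induction hY using Submodule.span_induction with
  | mem g hg => exact h g hg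
  | zero => rw [zero_mul]; exact zero_mem _
  | add x y _ _ hx hy =>
    rw [add_mul]
    exact add_mem hx hy
  | smul c x _ hx =>
    rw [smul_mul_assoc]
    exact Submodule.smul_mem _ _ hx

theorem connSum_mul_nonneg (hX : X ∈ gluingCone A S C) (hZ : Z ∈ edgesWithin S) {a b : α}
    (ha : a ∈ A) (hb : b ∈ S) (h : ∀ g ∈ C, 0 ≤ connSum a b (g * Z)) :
    0 ≤ connSum a b (X * Z) := by
  obtain ⟨Y, hY, hXY⟩ := hX
  rw [hXY.connSum_eq hZ ha hb]
  clear hXY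
  induction hY using Submodule.span_induction with
  | mem g hg => exact h g hg
  | zero => simp
  | add x y _ _ hx hy =>
    rw [add_mul, map_add]
    exact add_nonneg hx hy
  | smul c x _ hx =>
    rw [smul_mul_assoc, NNReal.smul_def, map_smul]
    exact mul_nonneg c.2 hx

theorem connSum_comm (a b : α) (X : MvPolynomial (Sym2 α) ℝ) :
    connSum a b X = connSum b a X := by
  have : connSum a b = connSum b a := by
    classical
    rw [connSum, connSum]
    congr 1
    exact funext fun m => connIndicator_comm a b _
  rw [this]

theorem combination_mem_span (ι : ℕ → α) (G : List EdgeSum) (r : List (ℕ × ℕ)) :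
    (EdgeSum.combination G r).toPoly ι ∈
      Submodule.span ℝ≥0 {X | ∃ g ∈ G, X = EdgeSum.toPoly ι g} := by
  induction r with
  | nil => simp [EdgeSum.combination, EdgeSum.toPoly]
  | cons a r ih =>
    have : EdgeSum.combination G (a :: r) =
        EdgeSum.smul a.1 (G.getD a.2 []) ++ EdgeSum.combination G r := by
      simp [EdgeSum.combination]
    rw [this, EdgeSum.toPoly_append, EdgeSum.toPoly_smul]
    refine add_mem ?_ ih
    have h : EdgeSum.toPoly ι (G.getD a.2 []) ∈
        Submodule.span ℝ≥0 {X | ∃ g ∈ G, X = EdgeSum.toPoly ι g} := by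
      by_cases ha : a.2 < G.length
      · refine Submodule.subset_span ⟨_, ?_, rfl⟩
        rw [List.getD_eq_getElem _ _ ha]
        exact List.getElem_mem ha
      · rw [List.getD_eq_default _ _ (not_lt.1 ha)]
        simp [EdgeSum.toPoly]
    have := Submodule.smul_mem _ (a.1 : ℝ≥0) h
    rw [NNReal.smul_def] at this
    simpa using this

/-- Soundness of the certificates, for any test `van` that implies gluing equivalence to zero. -/
theorem mem_gluingCone_of_certified {van : EdgeSum → Bool} {ι : ℕ → α}
    (hvan : ∀ s, van s = true → GluingEquiv A S (EdgeSum.toPoly ι s) 0) {G : List EdgeSum} :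
    ∀ {l : List EdgeSum} {rs : List (ℕ × List (ℕ × ℕ))}, EdgeSum.certified van G l rs = true →
      ∀ s ∈ l, EdgeSum.toPoly ι s ∈ gluingCone A S {X | ∃ g ∈ G, X = EdgeSum.toPoly ι g}
  | [], _, _, s, hs => by simp at hs
  | _ :: _, [], h, _, _ => by simp [EdgeSum.certified] at h
  | s₀ :: l, r :: rs, h, s, hs => by
    rw [EdgeSum.certified, Bool.and_eq_true, Bool.and_eq_true] at h
    rcases List.mem_cons.1 hs with rfl | hs
    · have hr : 0 < r.1 := by simpa using h.1.1
      have hr' : (r.1 : ℝ) ≠ 0 := by exact_mod_cast hr.ne'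
      have hv := hvan _ h.1.2
      rw [EdgeSum.toPoly_append, EdgeSum.toPoly_smul, EdgeSum.toPoly_smul] at hv
      have hmem : ((r.1 : ℝ)⁻¹) • (EdgeSum.combination G r.2).toPoly ι ∈
          Submodule.span ℝ≥0 {X | ∃ g ∈ G, X = EdgeSum.toPoly ι g} :=
        Submodule.smul_mem _ (⟨(r.1 : ℝ)⁻¹, by positivity⟩ : ℝ≥0) (combination_mem_span ι G r.2)
      refine ⟨_, hmem, ?_⟩
      have h1 := (hv.smul ((r.1 : ℝ)⁻¹)).add
        (GluingEquiv.refl A S (((r.1 : ℝ)⁻¹) • (EdgeSum.combination G r.2).toPoly ι))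
      rw [smul_add, smul_smul, smul_smul] at h1
      push_cast at h1
      rw [inv_mul_cancel₀ hr', one_smul, mul_neg_one, neg_smul, neg_add_cancel_right, smul_zero,
        zero_add] at h1
      exact h1
    · exact mem_gluingCone_of_certified hvan h.2 s hs

theorem EdgeSum.toPoly_congr {ι κ : ℕ → α} {n : ℕ} (h : ∀ i < n, ι i = κ i) {s : EdgeSum}
    (hs : labelsBelow n s = true) : s.toPoly ι = s.toPoly κ := by
  have hlab := mem_of_labelsBelow hs
  rw [EdgeSum.toPoly, EdgeSum.toPoly]
  congr 1
  refine List.map_congr_left fun a ha => ?_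
  have : mapEdges ι a.2 = mapEdges κ a.2 := by
    rw [mapEdges, mapEdges]
    congr 1
    refine List.map_congr_left fun e he => ?_
    rw [h _ (hlab a ha e he).1, h _ (hlab a ha e he).2]
  rw [this]

end Cones

/-! ### States of vertex intervals of a bunkbed graph -/

/-- The vertices of the bunkbed graph together with two ghost vertices, which serve to express
connection events by ghost edges. -/
abbrev GhostVertex (V : Type*) := Fin 2 ⊕ (V × Fin 2)

section States

open EdgeSum

variable {V : Type*} {γ : Fin 2} {p q k : V}

/-- The placement of the labels of a state with terminals `p, q` and ghost `γ`; the labels `5, 6`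
are placed at `w`. -/
def place (γ : Fin 2) (p q w : V) : ℕ → GhostVertex V
  | 0 => .inl γ
  | 1 => .inr (p, 0)
  | 2 => .inr (p, 1)
  | 3 => .inr (q, 0)
  | 4 => .inr (q, 1)
  | 5 => .inr (w, 0)
  | _ => .inr (w, 1)

/-- The placement of the labels of a pairing of two states with terminals `p, q`; the labels `6, 7`
are placed at `w`. -/
def pairPlace (p q w : V) : ℕ → GhostVertex V
  | 0 => .inl 0
  | 1 => .inl 1
  | 2 => .inr (p, 0)
  | 3 => .inr (p, 1)
  | 4 => .inr (q, 0)
  | 5 => .inr (q, 1)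
  | 6 => .inr (w, 0)
  | _ => .inr (w, 1)

theorem injOn_place (hpq : p ≠ q) : Set.InjOn (place γ p q q) (Set.Iio 5) := by
  intro i hi j hj
  rw [Set.mem_Iio] at hi hj
  interval_cases i <;> interval_cases j <;> simp [place, hpq, hpq.symm]

theorem injOn_place_middle (hpq : p ≠ q) (hpk : p ≠ k) (hkq : k ≠ q) :
    Set.InjOn (place γ p q k) (Set.Iio 7) := by
  intro i hi j hj
  rw [Set.mem_Iio] at hi hj
  interval_cases i <;> interval_cases j <;>
    simp [place, hpq, hpq.symm, hpk, hpk.symm, hkq, hkq.symm]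

theorem injOn_pairPlace (hpq : p ≠ q) : Set.InjOn (pairPlace p q q) (Set.Iio 6) := by
  intro i hi j hj
  rw [Set.mem_Iio] at hi hj
  interval_cases i <;> interval_cases j <;> simp [pairPlace, hpq, hpq.symm]

theorem injOn_pairPlace_middle (hpq : p ≠ q) (hpk : p ≠ k) (hkq : k ≠ q) :
    Set.InjOn (pairPlace p q k) (Set.Iio 8) := by
  intro i hi j hj
  rw [Set.mem_Iio] at hi hj
  interval_cases i <;> interval_cases j <;>
    simp [pairPlace, hpq, hpq.symm, hpk, hpk.symm, hkq, hkq.symm]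

/-- The vertices of the extended bunkbed graph which are not copies of vertices in `I`. -/
def outside (I : Set V) : Set (GhostVertex V) := {x | ∀ y ∈ I, ∀ l, x ≠ .inr (y, l)}

/-- All copies of the vertices in `J`. -/
def copies (J : Set V) : Set (GhostVertex V) := {x | ∃ y ∈ J, ∃ l, x = .inr (y, l)}

theorem inl_mem_outside (γ : Fin 2) (I : Set V) : (.inl γ : GhostVertex V) ∈ outside I :=
  fun _ _ _ h => by simp at h

theorem inr_mem_outside {I : Set V} {y : V} {l : Fin 2} :
    (.inr (y, l) : GhostVertex V) ∈ outside I ↔ y ∉ I := by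
  constructor
  · exact fun h hy => h y hy l rfl
  · rintro h z hz l' h'
    simp only [Sum.inr.injEq, Prod.mk.injEq] at h'
    exact h (h'.1 ▸ hz)

theorem inr_mem_copies {J : Set V} {y : V} {l : Fin 2} :
    (.inr (y, l) : GhostVertex V) ∈ copies J ↔ y ∈ J := by
  constructor
  · rintro ⟨z, hz, l', h⟩
    simp only [Sum.inr.injEq, Prod.mk.injEq] at h
    exact h.1 ▸ hz
  · exact fun h => ⟨y, h, l, rfl⟩

theorem copies_mono {J J' : Set V} (h : J ⊆ J') : copies J ⊆ copies J' := by
  rintro x ⟨y, hy, l, rfl⟩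
  exact inr_mem_copies.2 (h hy)

theorem copies_subset_outside {I J : Set V} (h : ∀ y ∈ J, y ∉ I) : copies J ⊆ outside I := by
  rintro x ⟨y, hy, l, rfl⟩
  exact inr_mem_outside.2 (h y hy)

theorem outside_anti {I I' : Set V} (h : I ⊆ I') : outside I' ⊆ outside I :=
  fun _ hx y hy l => hx y (h hy) l

theorem copies_subset_outside_diff {I J : Set V} (h : ∀ y ∈ J, y ∉ I) (γ : Fin 2) :
    copies J ⊆ outside I \ {.inl γ} := by
  rintro x hx
  refine ⟨copies_subset_outside h hx, ?_⟩
  rintro rfl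
  obtain ⟨y, -, l, h⟩ := hx
  simp at h

/-- The polynomials of a list of edge sums, with terminals `p, q` and ghost `γ`. -/
def gens (γ : Fin 2) (p q : V) (L : List EdgeSum) : Set (MvPolynomial (Sym2 (GhostVertex V)) ℝ) :=
  {X | ∃ g ∈ L, X = EdgeSum.toPoly (place γ p q q) g}

theorem toPoly_place_eq {s : EdgeSum} (hs : labelsBelow 5 s = true) (w : V) :
    s.toPoly (place γ p q w) = s.toPoly (place γ p q q) :=
  EdgeSum.toPoly_congr (fun i hi => by interval_cases i <;> rfl) hs

theorem gens_eq_of_labelsBelow {L : List EdgeSum} (hL : ∀ s ∈ L, labelsBelow 5 s = true) (w : V) :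
    {X | ∃ g ∈ L, X = EdgeSum.toPoly (place γ p q w) g} = gens γ p q L := by
  ext X
  constructor
  · rintro ⟨g, hg, rfl⟩
    exact ⟨g, hg, toPoly_place_eq (hL g hg) w⟩
  · rintro ⟨g, hg, rfl⟩
    exact ⟨g, hg, (toPoly_place_eq (hL g hg) w).symm⟩

theorem mem_edgesWithin_of_mem_gens {L : List EdgeSum} (hL : ∀ s ∈ L, labelsBelow 5 s = true)
    {S : Set (GhostVertex V)} (hγ : .inl γ ∈ S) (hp : ∀ l, .inr (p, l) ∈ S)
    (hq : ∀ l, .inr (q, l) ∈ S) {g : MvPolynomial (Sym2 (GhostVertex V)) ℝ}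
    (hg : g ∈ gens γ p q L) : g ∈ edgesWithin S := by
  obtain ⟨s, hs, rfl⟩ := hg
  refine EdgeSum.toPoly_mem_edgesWithin (n := 5) (fun i hi => ?_) (hL s hs)
  interval_cases i
  exacts [hγ, hp _, hp _, hq _, hq _]

section Certificates

variable {A S : Set (GhostVertex V)} {van : EdgeSum → Bool} {L M N : List EdgeSum}
  {rs : List (ℕ × List (ℕ × ℕ))}

theorem mul_mem_of_certified_glue
    (hvan : ∀ s, van s = true → GluingEquiv A S (EdgeSum.toPoly (place γ p q k) s) 0)
    (hc : certified van N (glueAll L M) rs = true) (hL : ∀ s ∈ L, labelsBelow 5 s = true)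
    (hM : ∀ s ∈ M, labelsBelow 5 s = true) (hN : ∀ s ∈ N, labelsBelow 5 s = true)
    {g h : MvPolynomial (Sym2 (GhostVertex V)) ℝ} (hg : g ∈ gens γ p k L)
    (hh : h ∈ gens γ k q M) : g * h ∈ gluingCone A S (gens γ p q N) := by
  obtain ⟨s, hs, rfl⟩ := hg
  obtain ⟨t, ht, rfl⟩ := hh
  have hmem : mul (relabel leftLabel s) (relabel rightLabel t) ∈ glueAll L M := by
    simp only [glueAll, List.mem_flatMap, List.mem_map]
    exact ⟨s, hs, t, ht, rfl⟩
  have h := mem_gluingCone_of_certified hvan hc _ hmem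
  rw [gens_eq_of_labelsBelow hN, EdgeSum.toPoly_mul, EdgeSum.toPoly_relabel,
    EdgeSum.toPoly_relabel] at h
  rw [EdgeSum.toPoly_congr (n := 5) (κ := place γ p k k) (fun i hi => by interval_cases i <;> rfl)
    (hL s hs), EdgeSum.toPoly_congr (n := 5) (κ := place γ k q q)
    (fun i hi => by interval_cases i <;> rfl) (hM t ht)] at h
  exact h

theorem mem_of_certified_map (f : EdgeSum → EdgeSum)
    (hvan : ∀ s, van s = true → GluingEquiv A S (EdgeSum.toPoly (place γ p q q) s) 0)
    (hc : certified van N (L.map f) rs = true) {s : EdgeSum} (hs : s ∈ L) :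
    (f s).toPoly (place γ p q q) ∈ gluingCone A S (gens γ p q N) :=
  mem_gluingCone_of_certified hvan hc _ (List.mem_map_of_mem hs)

theorem gens_flip_mem_of_certified
    (hvan : ∀ s, van s = true → GluingEquiv A S (EdgeSum.toPoly (place γ p q q) s) 0)
    (hc : certified van L (L.map (relabel flipLabel)) rs = true)
    (hL : ∀ s ∈ L, labelsBelow 5 s = true) {g : MvPolynomial (Sym2 (GhostVertex V)) ℝ}
    (hg : g ∈ gens γ q p L) : g ∈ gluingCone A S (gens γ p q L) := by
  obtain ⟨s, hs, rfl⟩ := hg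
  have h := mem_of_certified_map _ hvan hc hs
  rw [EdgeSum.toPoly_relabel, EdgeSum.toPoly_congr (n := 5) (κ := place γ q p p)
    (fun i hi => by interval_cases i <;> rfl) (hL s hs)] at h
  exact h

/-- The generating function of the two copies of the edge `pq`, each of which is present with
weight `lam`. -/
noncomputable def edgeFactor (lam : ℝ) (p q : V) : MvPolynomial (Sym2 (GhostVertex V)) ℝ :=
  (1 + lam • MvPolynomial.X s(.inr (p, 0), .inr (q, 0))) *
    (1 + lam • MvPolynomial.X s(.inr (p, 1), .inr (q, 1)))

theorem edgeFactor_comm (lam : ℝ) (p q : V) : edgeFactor lam p q = edgeFactor lam q p := by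
  rw [edgeFactor, edgeFactor, Sym2.eq_swap, Sym2.eq_swap (a := Sum.inr (p, 1))]

theorem edgeFactor_eq (lam : ℝ) (γ : Fin 2) (p q : V) : edgeFactor lam p q =
    1 + lam • straight.toPoly (place γ p q q) + lam ^ 2 • double.toPoly (place γ p q q) := by
  simp only [edgeFactor, straight, double, EdgeSum.toPoly, edgeMonomial, mapEdges, place,
    List.map_cons, List.map_nil, List.sum_cons, List.sum_nil, Multiset.map_coe,
    Multiset.prod_coe, List.prod_cons, List.prod_nil, Int.cast_one, MvPolynomial.smul_eq_C_mul,
    map_pow, map_one]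
  ring

theorem edgeFactor_mem_edgesWithin (lam : ℝ) {S : Set (GhostVertex V)}
    (hp : ∀ l, .inr (p, l) ∈ S) (hq : ∀ l, .inr (q, l) ∈ S) :
    edgeFactor lam p q ∈ edgesWithin S := by
  refine mul_mem ?_ ?_ <;>
    exact add_mem (one_mem _) (Subalgebra.smul_mem _ (X_mem_edgesWithin (hp _) (hq _)) _)

theorem mul_edgeFactor_mem_of_certified
    (hvan : ∀ s, van s = true → GluingEquiv A S (EdgeSum.toPoly (place γ p q q) s) 0)
    (hc : certified van L (joinEdge L) rs = true) {lam : ℝ} (hlam : 0 < lam)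
    {g : MvPolynomial (Sym2 (GhostVertex V)) ℝ} (hg : g ∈ gens γ p q L) :
    g * edgeFactor lam p q ∈ gluingCone A S (gens γ p q L) := by
  have hg' := subset_gluingCone (A := A) (S := S) hg
  obtain ⟨s, hs, rfl⟩ := hg
  have h1 := mem_gluingCone_of_certified hvan hc (mul straight s)
    (List.mem_append_left _ (List.mem_map_of_mem hs))
  have h2 := mem_gluingCone_of_certified hvan hc (mul double s)
    (List.mem_append_right _ (List.mem_map_of_mem hs))
  rw [EdgeSum.toPoly_mul] at h1 h2
  rw [edgeFactor_eq lam γ, mul_comm, add_mul, add_mul, one_mul, smul_mul_assoc, smul_mul_assoc]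
  exact add_mem (add_mem hg' (real_smul_mem_gluingCone hlam.le h1))
    (real_smul_mem_gluingCone (by positivity) h2)

theorem gluingEquiv_zero_terminals [Finite V] (hpq : p ≠ q) (A : Set (GhostVertex V)) (s : EdgeSum)
    (hs : vanishes 5 5 s = true) : GluingEquiv A A (s.toPoly (place γ p q q)) 0 :=
  gluingEquiv_zero_of_vanishes le_rfl (injOn_place hpq) (fun _ h h' => absurd h' (not_lt.2 h)) hs

theorem gluingEquiv_zero_middle [Finite V] (hpq : p ≠ q) (hpk : p ≠ k) (hkq : k ≠ q) {I : Set V}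
    (hk : k ∈ I) (s : EdgeSum) (hs : vanishes 7 5 s = true) :
    GluingEquiv (outside I) (outside I) (s.toPoly (place γ p q k)) 0 := by
  refine gluingEquiv_zero_of_vanishes (by decide) (injOn_place_middle hpq hpk hkq)
    (fun i h h' => ?_) hs
  interval_cases i <;> exact fun h => h k hk _ rfl

theorem gluingEquiv_zero_terminals_marked [Finite V] (hpq : p ≠ q) (A : Set (GhostVertex V))
    (s : EdgeSum) (hs : vanishesMarked 5 5 s = true) :
    GluingEquiv {.inl γ} (A \ {.inl γ}) (s.toPoly (place γ p q q)) 0 :=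
  gluingEquiv_zero_of_vanishesMarked le_rfl (by decide) (injOn_place hpq)
    (fun _ h h' => absurd h' (not_lt.2 h)) (fun h => h.2 rfl) hs

theorem gluingEquiv_zero_middle_marked [Finite V] (hpq : p ≠ q) (hpk : p ≠ k) (hkq : k ≠ q)
    {I : Set V} (hk : k ∈ I) (s : EdgeSum) (hs : vanishesMarked 7 5 s = true) :
    GluingEquiv {.inl γ} (outside I \ {.inl γ}) (s.toPoly (place γ p q k)) 0 := by
  refine gluingEquiv_zero_of_vanishesMarked (by decide) (by decide)
    (injOn_place_middle hpq hpk hkq) (fun i h h' => ?_) (fun h => h.2 rfl) hs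
  interval_cases i <;> exact fun h => h.1 k hk _ rfl

end Certificates

end States

/-! ### Operations on states -/

section StateOperations

open EdgeSum

variable {V : Type*} {γ : Fin 2} {p q k : V} {I J : Set V} {t : ℕ}
  {X Z : MvPolynomial (Sym2 (GhostVertex V)) ℝ}

/-- `X` is the generating function of a part of the bunkbed graph which is attached to the rest at
the copies of `p` and `q`, has interior vertices `I`, and contains `t` posts in its interior. -/
structure IsUnmarkedState (t : ℕ) (p q : V) (I : Set V)
    (X : MvPolynomial (Sym2 (GhostVertex V)) ℝ) : Prop where
  ne : p ≠ q
  left_notMem : p ∉ I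
  right_notMem : q ∉ I
  mem_edgesWithin : X ∈ edgesWithin (copies (insert p (insert q I)))
  mem_gluingCone (γ : Fin 2) :
    X ∈ gluingCone (outside I) (outside I) (gens γ p q (unmarkedGens t))

/-- The analogue of `IsUnmarkedState` for a part in which the ghost `γ` is attached to a vertex,
with a sign depending on the level. -/
structure IsMarkedState (γ : Fin 2) (t : ℕ) (p q : V) (I : Set V)
    (X : MvPolynomial (Sym2 (GhostVertex V)) ℝ) : Prop where
  ne : p ≠ q
  left_notMem : p ∉ I
  right_notMem : q ∉ I
  mem_edgesWithin : X ∈ edgesWithin (insert (.inl γ) (copies (insert p (insert q I))))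
  mem_gluingCone :
    X ∈ gluingCone {.inl γ} (outside I \ {.inl γ}) (gens γ p q (markedGens t))

theorem edgesWithin_copies_le {K : Set V} (h : ∀ y ∈ K, y ∉ J) (γ : Fin 2) :
    edgesWithin (copies K) ≤ edgesWithin (outside J \ {.inl γ}) :=
  edgesWithin_mono (copies_subset_outside_diff h γ)

theorem edgesWithin_insert_copies_le {K : Set V} (h : ∀ y ∈ K, y ∉ J) {γ δ : Fin 2} (hγ : γ ≠ δ) :
    edgesWithin (insert (.inl γ) (copies K)) ≤ edgesWithin (outside J \ {.inl δ}) :=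
  edgesWithin_mono (Set.insert_subset ⟨inl_mem_outside _ _, by simpa using hγ⟩
    (copies_subset_outside_diff h δ))

theorem gens_unmarked_subset_edgesWithin {I : Set V} (hp : p ∉ I) (hq : q ∉ I)
    {g : MvPolynomial (Sym2 (GhostVertex V)) ℝ} (hg : g ∈ gens γ p q (unmarkedGens t)) :
    g ∈ edgesWithin (outside I) :=
  mem_edgesWithin_of_mem_gens (labelsBelow_unmarkedGens t) (inl_mem_outside _ _)
    (fun _ => inr_mem_outside.2 hp) (fun _ => inr_mem_outside.2 hq) hg

theorem gens_marked_subset_edgesWithin {I : Set V} (hp : p ∉ I) (hq : q ∉ I)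
    {g : MvPolynomial (Sym2 (GhostVertex V)) ℝ} (hg : g ∈ gens γ p q (markedGens t)) :
    g ∈ edgesWithin (outside I) :=
  mem_edgesWithin_of_mem_gens (labelsBelow_markedGens t) (inl_mem_outside _ _)
    (fun _ => inr_mem_outside.2 hp) (fun _ => inr_mem_outside.2 hq) hg

theorem gens_marked_subset_edgesWithin_diff {I : Set V} {δ : Fin 2} (hp : p ∉ I) (hq : q ∉ I)
    (hγ : γ ≠ δ) {g : MvPolynomial (Sym2 (GhostVertex V)) ℝ}
    (hg : g ∈ gens γ p q (markedGens t)) : g ∈ edgesWithin (outside I \ {.inl δ}) := by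
  refine mem_edgesWithin_of_mem_gens (labelsBelow_markedGens t) ?_ ?_ ?_ hg
  · exact ⟨inl_mem_outside γ I, fun h => hγ (Sum.inl_injective h)⟩
  · exact fun l => ⟨inr_mem_outside.2 hp, fun h => Sum.inr_ne_inl h⟩
  · exact fun l => ⟨inr_mem_outside.2 hq, fun h => Sum.inr_ne_inl h⟩

theorem isMarkedState_of_mem_gens (hpq : p ≠ q) {c : MvPolynomial (Sym2 (GhostVertex V)) ℝ}
    (hc : c ∈ gens γ p q (markedGens t)) : IsMarkedState γ t p q ∅ c where
  ne := hpq
  left_notMem := Set.notMem_empty p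
  right_notMem := Set.notMem_empty q
  mem_edgesWithin := mem_edgesWithin_of_mem_gens (labelsBelow_markedGens t) (Set.mem_insert _ _)
    (fun _ => Set.mem_insert_of_mem _ (inr_mem_copies.2 (Set.mem_insert _ _)))
    (fun _ => Set.mem_insert_of_mem _
      (inr_mem_copies.2 (Set.mem_insert_of_mem _ (Set.mem_insert _ _)))) hc
  mem_gluingCone := subset_gluingCone hc

theorem isUnmarkedState_one (hpq : p ≠ q) : IsUnmarkedState 0 p q ∅ (1 : MvPolynomial _ ℝ) where
  ne := hpq
  left_notMem := Set.notMem_empty p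
  right_notMem := Set.notMem_empty q
  mem_edgesWithin := one_mem _
  mem_gluingCone γ := subset_gluingCone ⟨[(1, [])], by simp [unmarkedGens],
    by simp [EdgeSum.toPoly, mapEdges, edgeMonomial]⟩

theorem insert_glue_subset_left :
    insert p (insert k I) ⊆ insert p (insert q (insert k (I ∪ J))) := by
  intro x
  simp only [Set.mem_insert_iff, Set.mem_union]
  tauto

theorem insert_glue_subset_right :
    insert k (insert q J) ⊆ insert p (insert q (insert k (I ∪ J))) := by
  intro x
  simp only [Set.mem_insert_iff, Set.mem_union]
  tauto

/-- The vertex sets of two states which are to be glued at `k` are in general position. -/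
structure Glueable (p k q : V) (I J : Set V) : Prop where
  ne : p ≠ q
  right_notMem : q ∉ I
  left_notMem : p ∉ J
  disjoint : Disjoint I J

theorem Glueable.symm (h : Glueable p k q I J) : Glueable q k p J I :=
  ⟨h.ne.symm, h.left_notMem, h.right_notMem, h.disjoint.symm⟩

theorem Glueable.notMem_left (h : Glueable p k q I J) (hk : k ∉ I) :
    ∀ y ∈ insert k (insert q J), y ∉ I := by
  rintro y (rfl | rfl | hy)
  exacts [hk, h.right_notMem, fun hy' => h.disjoint.ne_of_mem hy' hy rfl]

theorem subset_insert_union_left : I ⊆ insert k (I ∪ J) :=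
  Set.subset_union_left.trans (Set.subset_insert _ _)

theorem subset_insert_union_right : J ⊆ insert k (I ∪ J) :=
  Set.subset_union_right.trans (Set.subset_insert _ _)

theorem IsUnmarkedState.flip [Finite V] (ht : t ≤ 2) (h : IsUnmarkedState t p q I X) :
    IsUnmarkedState t q p I X where
  ne := h.ne.symm
  left_notMem := h.right_notMem
  right_notMem := h.left_notMem
  mem_edgesWithin := by
    rw [Set.insert_comm]
    exact h.mem_edgesWithin
  mem_gluingCone γ := by
    rw [← mul_one X]
    refine mul_mem_gluingCone (h.mem_gluingCone γ) subset_rfl subset_rfl (one_mem _)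
      fun g hg => ?_
    rw [mul_one]
    have hvan := gluingEquiv_zero_terminals (γ := γ) h.ne.symm (outside I)
    interval_cases t
    · exact gens_flip_mem_of_certified hvan certified_unmarkedFlip0 (labelsBelow_unmarkedGens _) hg
    · exact gens_flip_mem_of_certified hvan certified_unmarkedFlip1 (labelsBelow_unmarkedGens _) hg
    · exact gens_flip_mem_of_certified hvan certified_unmarkedFlip2 (labelsBelow_unmarkedGens _) hg

theorem IsMarkedState.flip [Finite V] (ht : t ≤ 1) (h : IsMarkedState γ t p q I X) :
    IsMarkedState γ t q p I X where
  ne := h.ne.symm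
  left_notMem := h.right_notMem
  right_notMem := h.left_notMem
  mem_edgesWithin := by
    rw [Set.insert_comm q]
    exact h.mem_edgesWithin
  mem_gluingCone := by
    rw [← mul_one X]
    refine mul_mem_gluingCone h.mem_gluingCone subset_rfl subset_rfl (one_mem _) fun g hg => ?_
    rw [mul_one]
    have hvan := gluingEquiv_zero_terminals_marked (γ := γ) h.ne.symm (outside I)
    interval_cases t
    · exact gens_flip_mem_of_certified hvan certified_markedFlip0 (labelsBelow_markedGens _) hg
    · exact gens_flip_mem_of_certified hvan certified_markedFlip1 (labelsBelow_markedGens _) hg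

theorem IsUnmarkedState.mul_edgeFactor [Finite V] (ht : t ≤ 2) (h : IsUnmarkedState t p q I X)
    {lam : ℝ} (hlam : 0 < lam) : IsUnmarkedState t p q I (X * edgeFactor lam p q) where
  ne := h.ne
  left_notMem := h.left_notMem
  right_notMem := h.right_notMem
  mem_edgesWithin := mul_mem h.mem_edgesWithin (edgeFactor_mem_edgesWithin lam
    (fun _ => inr_mem_copies.2 (by simp)) (fun _ => inr_mem_copies.2 (by simp)))
  mem_gluingCone γ := by
    refine mul_mem_gluingCone (h.mem_gluingCone γ) subset_rfl subset_rfl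
      (edgeFactor_mem_edgesWithin lam (fun _ => inr_mem_outside.2 h.left_notMem)
        fun _ => inr_mem_outside.2 h.right_notMem) fun g hg => ?_
    have hvan := gluingEquiv_zero_terminals (γ := γ) h.ne (outside I)
    interval_cases t
    · exact mul_edgeFactor_mem_of_certified hvan certified_unmarkedEdge0 hlam hg
    · exact mul_edgeFactor_mem_of_certified hvan certified_unmarkedEdge1 hlam hg
    · exact mul_edgeFactor_mem_of_certified hvan certified_unmarkedEdge2 hlam hg

theorem IsMarkedState.mul_edgeFactor [Finite V] (ht : t ≤ 1) (h : IsMarkedState γ t p q I X)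
    {lam : ℝ} (hlam : 0 < lam) : IsMarkedState γ t p q I (X * edgeFactor lam p q) where
  ne := h.ne
  left_notMem := h.left_notMem
  right_notMem := h.right_notMem
  mem_edgesWithin := mul_mem h.mem_edgesWithin (edgeFactor_mem_edgesWithin lam
    (fun _ => Set.mem_insert_of_mem _ (inr_mem_copies.2 (by simp)))
    (fun _ => Set.mem_insert_of_mem _ (inr_mem_copies.2 (by simp))))
  mem_gluingCone := by
    refine mul_mem_gluingCone h.mem_gluingCone subset_rfl subset_rfl
      (edgeFactor_mem_edgesWithin lam
        (fun _ => ⟨inr_mem_outside.2 h.left_notMem, by simp⟩)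
        fun _ => ⟨inr_mem_outside.2 h.right_notMem, by simp⟩) fun g hg => ?_
    have hvan := gluingEquiv_zero_terminals_marked (γ := γ) h.ne (outside I)
    interval_cases t
    · exact mul_edgeFactor_mem_of_certified hvan certified_markedEdge0 hlam hg
    · exact mul_edgeFactor_mem_of_certified hvan certified_markedEdge1 hlam hg

/-- The variable of the vertical edge at `q`. -/
noncomputable def postFactor (q : V) : MvPolynomial (Sym2 (GhostVertex V)) ℝ :=
  MvPolynomial.X s(.inr (q, 0), .inr (q, 1))

/-- The edges from the ghost `γ` to the two copies of `q`, with opposite signs. -/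
noncomputable def markFactor (γ : Fin 2) (q : V) : MvPolynomial (Sym2 (GhostVertex V)) ℝ :=
  MvPolynomial.X s(.inl γ, .inr (q, 0)) - MvPolynomial.X s(.inl γ, .inr (q, 1))

theorem toPoly_rightPost (γ : Fin 2) (p q w : V) :
    rightPost.toPoly (place γ p q w) = postFactor q := by
  simp [rightPost, EdgeSum.toPoly, edgeMonomial, mapEdges, place, postFactor]

theorem toPoly_rightMark (γ : Fin 2) (p q w : V) :
    rightMark.toPoly (place γ p q w) = markFactor γ q := by
  simp [rightMark, EdgeSum.toPoly, edgeMonomial, mapEdges, place, markFactor, sub_eq_add_neg]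

theorem toPoly_leftMark (γ : Fin 2) (p q w : V) :
    leftMark.toPoly (place γ p q w) = markFactor γ p := by
  simp [leftMark, EdgeSum.toPoly, edgeMonomial, mapEdges, place, markFactor, sub_eq_add_neg]

theorem postFactor_mem_edgesWithin {S : Set (GhostVertex V)} (hq : ∀ l, .inr (q, l) ∈ S) :
    postFactor q ∈ edgesWithin S :=
  X_mem_edgesWithin (hq _) (hq _)

theorem markFactor_mem_edgesWithin {S : Set (GhostVertex V)} (hγ : .inl γ ∈ S)
    (hq : ∀ l, .inr (q, l) ∈ S) : markFactor γ q ∈ edgesWithin S :=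
  sub_mem (X_mem_edgesWithin hγ (hq _)) (X_mem_edgesWithin hγ (hq _))

theorem IsUnmarkedState.mul_postFactor [Finite V] (ht : t ≤ 1) (h : IsUnmarkedState t p q I X) :
    IsUnmarkedState (t + 1) p q I (X * postFactor q) where
  ne := h.ne
  left_notMem := h.left_notMem
  right_notMem := h.right_notMem
  mem_edgesWithin := mul_mem h.mem_edgesWithin (postFactor_mem_edgesWithin
    (fun _ => inr_mem_copies.2 (by simp)))
  mem_gluingCone γ := by
    refine mul_mem_gluingCone (h.mem_gluingCone γ) subset_rfl subset_rfl
      (postFactor_mem_edgesWithin fun _ => inr_mem_outside.2 h.right_notMem) ?_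
    rintro g ⟨s, hs, rfl⟩
    have hvan := gluingEquiv_zero_terminals (γ := γ) h.ne (outside I)
    rw [mul_comm, ← toPoly_rightPost γ p q q, ← EdgeSum.toPoly_mul]
    interval_cases t
    · exact mem_of_certified_map _ hvan certified_unmarkedPost0 hs
    · exact mem_of_certified_map _ hvan certified_unmarkedPost1 hs

theorem IsUnmarkedState.mul_markFactor_mem (h : IsUnmarkedState t p q I X) (γ : Fin 2) :
    X * markFactor γ q ∈ edgesWithin (insert (.inl γ) (copies (insert p (insert q I)))) :=
  mul_mem (edgesWithin_mono (Set.subset_insert _ _) h.mem_edgesWithin)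
    (markFactor_mem_edgesWithin (Set.mem_insert _ _)
      (fun _ => Set.mem_insert_of_mem _ (inr_mem_copies.2 (by simp))))

theorem IsUnmarkedState.mul_markFactor [Finite V] (ht : t ≤ 1) (h : IsUnmarkedState t p q I X)
    (γ : Fin 2) : IsMarkedState γ t p q I (X * markFactor γ q) where
  ne := h.ne
  left_notMem := h.left_notMem
  right_notMem := h.right_notMem
  mem_edgesWithin := h.mul_markFactor_mem γ
  mem_gluingCone := by
    refine mul_mem_gluingCone (h.mem_gluingCone γ)
      (Set.singleton_subset_iff.2 (inl_mem_outside _ _)) Set.sdiff_subset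
      (markFactor_mem_edgesWithin (inl_mem_outside _ _)
        fun _ => inr_mem_outside.2 h.right_notMem) ?_
    rintro g ⟨s, hs, rfl⟩
    have hvan := gluingEquiv_zero_terminals_marked (γ := γ) h.ne (outside I)
    rw [mul_comm, ← toPoly_rightMark γ p q q, ← EdgeSum.toPoly_mul]
    interval_cases t
    · exact mem_of_certified_map _ hvan certified_mark0 hs
    · exact mem_of_certified_map _ hvan certified_mark1 hs

theorem mul_mem_gluingCone_of_certified_glue {A S₁ S₂ : Set (GhostVertex V)}
    {A' S : Set (GhostVertex V)} {van : EdgeSum → Bool} {L M N : List EdgeSum}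
    {rs : List (ℕ × List (ℕ × ℕ))} (hX : X ∈ gluingCone A S₁ (gens γ p k L))
    (hZ : Z ∈ gluingCone S₂ S₂ (gens γ k q M)) (hZ' : Z ∈ edgesWithin S₁)
    (hL' : ∀ g ∈ gens γ p k L, g ∈ edgesWithin S₂) (hA : A' ⊆ A) (hA' : A' ⊆ S₂)
    (hS₁ : S ⊆ S₁) (hS₂ : S ⊆ S₂)
    (hvan : ∀ s, van s = true → GluingEquiv A' S (EdgeSum.toPoly (place γ p q k) s) 0)
    (hc : certified van N (glueAll L M) rs = true) (hL : ∀ s ∈ L, labelsBelow 5 s = true)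
    (hM : ∀ s ∈ M, labelsBelow 5 s = true) (hN : ∀ s ∈ N, labelsBelow 5 s = true) :
    X * Z ∈ gluingCone A' S (gens γ p q N) := by
  refine mul_mem_gluingCone hX hA hS₁ hZ' fun g hg => ?_
  rw [mul_comm]
  refine mul_mem_gluingCone hZ hA' hS₂ (hL' g hg) fun h hh => ?_
  rw [mul_comm]
  exact mul_mem_of_certified_glue hvan hc hL hM hN hg hh

theorem IsUnmarkedState.glue_of_certified [Finite V] {a b : ℕ} (hX : IsUnmarkedState a p k I X)
    (hZ : IsUnmarkedState b k q J Z) (h : Glueable p k q I J) {rs : List (ℕ × List (ℕ × ℕ))}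
    (hc : certified (vanishes 7 5) (unmarkedGens t)
      (glueAll (unmarkedGens a) (unmarkedGens b)) rs = true) :
    IsUnmarkedState t p q (insert k (I ∪ J)) (X * Z) where
  ne := h.ne
  left_notMem := by simp [hX.ne, hX.left_notMem, h.left_notMem]
  right_notMem := by simp [hZ.ne.symm, hZ.right_notMem, h.right_notMem]
  mem_edgesWithin := mul_mem
    (edgesWithin_mono (copies_mono insert_glue_subset_left) hX.mem_edgesWithin)
    (edgesWithin_mono (copies_mono insert_glue_subset_right) hZ.mem_edgesWithin)
  mem_gluingCone γ :=
    mul_mem_gluingCone_of_certified_glue (hX.mem_gluingCone γ) (hZ.mem_gluingCone γ)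
      (edgesWithin_mono (copies_subset_outside (h.notMem_left hX.right_notMem)) hZ.mem_edgesWithin)
      (fun _ => gens_unmarked_subset_edgesWithin h.left_notMem hZ.left_notMem)
      (outside_anti subset_insert_union_left) (outside_anti subset_insert_union_right)
      (outside_anti subset_insert_union_left) (outside_anti subset_insert_union_right)
      (gluingEquiv_zero_middle h.ne hX.ne hZ.ne (Set.mem_insert _ _)) hc
      (labelsBelow_unmarkedGens _) (labelsBelow_unmarkedGens _) (labelsBelow_unmarkedGens _)

theorem IsMarkedState.glue_of_certified [Finite V] {a b : ℕ} (hX : IsMarkedState γ a p k I X)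
    (hZ : IsUnmarkedState b k q J Z) (h : Glueable p k q I J) {rs : List (ℕ × List (ℕ × ℕ))}
    (hc : certified (vanishesMarked 7 5) (markedGens t)
      (glueAll (markedGens a) (unmarkedGens b)) rs = true) :
    IsMarkedState γ t p q (insert k (I ∪ J)) (X * Z) where
  ne := h.ne
  left_notMem := by simp [hX.ne, hX.left_notMem, h.left_notMem]
  right_notMem := by simp [hZ.ne.symm, hZ.right_notMem, h.right_notMem]
  mem_edgesWithin := mul_mem
    (edgesWithin_mono (Set.insert_subset_insert (copies_mono insert_glue_subset_left))
      hX.mem_edgesWithin)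
    (edgesWithin_mono ((copies_mono insert_glue_subset_right).trans (Set.subset_insert _ _))
      hZ.mem_edgesWithin)
  mem_gluingCone :=
    mul_mem_gluingCone_of_certified_glue hX.mem_gluingCone (hZ.mem_gluingCone γ)
      (edgesWithin_copies_le (h.notMem_left hX.right_notMem) γ hZ.mem_edgesWithin)
      (fun _ => gens_marked_subset_edgesWithin h.left_notMem hZ.left_notMem)
      subset_rfl (Set.singleton_subset_iff.2 (inl_mem_outside _ _))
      (Set.sdiff_subset_sdiff_left (outside_anti subset_insert_union_left))
      (Set.sdiff_subset.trans (outside_anti subset_insert_union_right))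
      (gluingEquiv_zero_middle_marked h.ne hX.ne hZ.ne (Set.mem_insert _ _)) hc
      (labelsBelow_markedGens _) (labelsBelow_unmarkedGens _) (labelsBelow_markedGens _)

theorem IsUnmarkedState.glue [Finite V] {a b : ℕ} (hX : IsUnmarkedState a p k I X)
    (hZ : IsUnmarkedState b k q J Z) (h : Glueable p k q I J) (hab : a + b ≤ 2) :
    IsUnmarkedState (a + b) p q (insert k (I ∪ J)) (X * Z) := by
  have key : ∀ {a b : ℕ} {p q : V} {I J : Set V} {X Z : MvPolynomial (Sym2 (GhostVertex V)) ℝ},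
      IsUnmarkedState a p k I X → IsUnmarkedState b k q J Z → Glueable p k q I J → a + b ≤ 2 →
      a ≤ b → IsUnmarkedState (a + b) p q (insert k (I ∪ J)) (X * Z) := by
    intro a b p q I J X Z hX hZ h hab hle
    have ha : a ≤ 1 := by omega
    have hb : b ≤ 2 := by omega
    interval_cases a <;> interval_cases b
    · exact hX.glue_of_certified hZ h certified_unmarkedGlue00
    · exact hX.glue_of_certified hZ h certified_unmarkedGlue01
    · exact hX.glue_of_certified hZ h certified_unmarkedGlue02
    · exact hX.glue_of_certified hZ h certified_unmarkedGlue11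
    · omega
  rcases le_total a b with hle | hle
  · exact key hX hZ h hab hle
  · have := key (hZ.flip (by omega)) (hX.flip (by omega)) h.symm (by omega) hle
    rw [add_comm a, mul_comm X, Set.union_comm I]
    exact this.flip (by omega)

theorem IsMarkedState.glue [Finite V] {a b : ℕ} (hX : IsMarkedState γ a p k I X)
    (hZ : IsUnmarkedState b k q J Z) (h : Glueable p k q I J) (hab : a + b ≤ 1) :
    IsMarkedState γ (a + b) p q (insert k (I ∪ J)) (X * Z) := by
  have ha : a ≤ 1 := by omega
  have hb : b ≤ 1 := by omega
  interval_cases a <;> interval_cases b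
  · exact hX.glue_of_certified hZ h certified_markedGlue00
  · exact hX.glue_of_certified hZ h certified_markedGlue01
  · exact hX.glue_of_certified hZ h certified_markedGlue10
  · omega

end StateOperations

/-! ### Pairings of marked states -/

section Positivity

open EdgeSum

variable {V : Type*} {p q k : V} {I J : Set V} {t : ℕ}
  {X Y Z : MvPolynomial (Sym2 (GhostVertex V)) ℝ}

/-- If a bilinear pairing of two marked states is nonnegative on generators, it is nonnegative. -/
theorem IsMarkedState.connSum_mul_nonneg_of_gens {a b : ℕ} (hX : IsMarkedState 0 a p q I X)
    (hY : IsMarkedState 1 b p q J Y) (h : Disjoint I J)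
    (hpos : ∀ g ∈ gens 0 p q (markedGens a), ∀ g' ∈ gens 1 p q (markedGens b),
      0 ≤ connSum (.inl 0) (.inl 1) (g * g')) :
    0 ≤ connSum (.inl 0) (.inl 1) (X * Y) := by
  have hJ : ∀ y ∈ insert p (insert q J), y ∉ I := by
    rintro y (rfl | rfl | hy)
    exacts [hX.left_notMem, hX.right_notMem, fun hy' => h.ne_of_mem hy' hy rfl]
  refine connSum_mul_nonneg hX.mem_gluingCone
    (edgesWithin_insert_copies_le hJ (by decide) hY.mem_edgesWithin) rfl
    ⟨inl_mem_outside _ _, by simp⟩ fun g hg => ?_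
  rw [mul_comm, connSum_comm]
  refine connSum_mul_nonneg hY.mem_gluingCone ?_ rfl ⟨inl_mem_outside _ _, by simp⟩
    fun g' hg' => ?_
  · exact gens_marked_subset_edgesWithin_diff hY.left_notMem hY.right_notMem (by decide) hg
  · rw [mul_comm, connSum_comm]
    exact hpos g hg g' hg'

theorem IsMarkedState.connSum_mul_nonneg [Finite V] (hX : IsMarkedState 0 1 p q I X)
    (hY : IsMarkedState 1 1 p q J Y) (h : Disjoint I J) :
    0 ≤ connSum (.inl 0) (.inl 1) (X * Y) := by
  refine hX.connSum_mul_nonneg_of_gens hY h ?_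
  rintro _ ⟨s, hs, rfl⟩ _ ⟨s', hs', rfl⟩
  have hn := of_decide_eq_true (List.all_eq_true.1 (List.all_eq_true.1 connCount_marked_marked s hs)
    s' hs')
  have hl := List.all_eq_true.1 (List.all_eq_true.1 labelsBelow_marked_marked s hs) s' hs'
  have h0 := connSum_toPoly (by decide) (injOn_pairPlace hX.ne) hl
  rw [EdgeSum.toPoly_mul, EdgeSum.toPoly_relabel, EdgeSum.toPoly_relabel,
    EdgeSum.toPoly_congr (n := 5) (κ := place 0 p q q) (fun i hi => by interval_cases i <;> rfl)
      (labelsBelow_markedGens 1 s hs),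
    EdgeSum.toPoly_congr (n := 5) (κ := place 1 p q q) (fun i hi => by interval_cases i <;> rfl)
      (labelsBelow_markedGens 1 s' hs')] at h0
  refine le_of_le_of_eq ?_ h0.symm
  exact_mod_cast hn

/-- A marked part with two posts is only tested against marked parts without posts. -/
structure IsMarkedStateTwo (p q : V) (I : Set V)
    (X : MvPolynomial (Sym2 (GhostVertex V)) ℝ) : Prop where
  ne : p ≠ q
  left_notMem : p ∉ I
  right_notMem : q ∉ I
  mem_edgesWithin : X ∈ edgesWithin (insert (.inl 0) (copies (insert p (insert q I))))
  nonneg : ∀ c ∈ gens 1 p q (markedGens 0), 0 ≤ connSum (.inl 0) (.inl 1) (X * c)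

theorem IsMarkedStateTwo.connSum_mul_nonneg (hX : IsMarkedStateTwo p q I X)
    (hY : IsMarkedState 1 0 p q J Y) (h : Disjoint I J) :
    0 ≤ connSum (.inl 0) (.inl 1) (X * Y) := by
  have hI : ∀ y ∈ insert p (insert q I), y ∉ J := by
    rintro y (rfl | rfl | hy)
    exacts [hY.left_notMem, hY.right_notMem, fun hy' => h.ne_of_mem hy hy' rfl]
  rw [mul_comm, connSum_comm]
  refine _root_.connSum_mul_nonneg hY.mem_gluingCone
    (edgesWithin_insert_copies_le hI (by decide) hX.mem_edgesWithin) rfl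
    ⟨inl_mem_outside _ _, by simp⟩ fun g hg => ?_
  rw [mul_comm, connSum_comm]
  exact hX.nonneg g hg

theorem IsMarkedStateTwo.flip [Finite V] (hX : IsMarkedStateTwo p q I X) :
    IsMarkedStateTwo q p I X where
  ne := hX.ne.symm
  left_notMem := hX.right_notMem
  right_notMem := hX.left_notMem
  mem_edgesWithin := by
    rw [Set.insert_comm q]
    exact hX.mem_edgesWithin
  nonneg c hc := hX.connSum_mul_nonneg
    ((isMarkedState_of_mem_gens hX.ne.symm hc).flip (by decide)) (Set.disjoint_empty I)

theorem IsMarkedStateTwo.mul_edgeFactor [Finite V] (hX : IsMarkedStateTwo p q I X) {lam : ℝ}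
    (hlam : 0 < lam) : IsMarkedStateTwo p q I (X * edgeFactor lam p q) where
  ne := hX.ne
  left_notMem := hX.left_notMem
  right_notMem := hX.right_notMem
  mem_edgesWithin := mul_mem hX.mem_edgesWithin (edgeFactor_mem_edgesWithin lam
    (fun _ => Set.mem_insert_of_mem _ (inr_mem_copies.2 (by simp)))
    (fun _ => Set.mem_insert_of_mem _ (inr_mem_copies.2 (by simp))))
  nonneg c hc := by
    rw [mul_assoc, mul_comm (edgeFactor _ _ _)]
    exact hX.connSum_mul_nonneg
      ((isMarkedState_of_mem_gens hX.ne hc).mul_edgeFactor (by decide) hlam) (Set.disjoint_empty I)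

theorem IsUnmarkedState.mul_markFactor_two [Finite V] (hX : IsUnmarkedState 2 p q I X) :
    IsMarkedStateTwo p q I (X * markFactor 0 q) where
  ne := hX.ne
  left_notMem := hX.left_notMem
  right_notMem := hX.right_notMem
  mem_edgesWithin := hX.mul_markFactor_mem 0
  nonneg := by
    rintro _ ⟨s', hs', rfl⟩
    rw [mul_assoc]
    refine _root_.connSum_mul_nonneg (hX.mem_gluingCone 0) ?_ (inl_mem_outside _ _)
      (inl_mem_outside _ _) ?_
    · refine mul_mem (markFactor_mem_edgesWithin (inl_mem_outside _ _)
        fun _ => inr_mem_outside.2 hX.right_notMem) ?_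
      exact gens_marked_subset_edgesWithin hX.left_notMem hX.right_notMem ⟨s', hs', rfl⟩
    · rintro _ ⟨s, hs, rfl⟩
      have hn := of_decide_eq_true (List.all_eq_true.1 (List.all_eq_true.1
        connCount_mark_marked s hs) s' hs')
      have hl := List.all_eq_true.1 (List.all_eq_true.1 labelsBelow_mark_marked s hs) s' hs'
      have h0 := connSum_toPoly (by decide) (injOn_pairPlace hX.ne) hl
      rw [EdgeSum.toPoly_mul, EdgeSum.toPoly_relabel, EdgeSum.toPoly_relabel, EdgeSum.toPoly_mul,
        EdgeSum.toPoly_congr (n := 5) (κ := place 0 p q q)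
          (fun i hi => by interval_cases i <;> rfl) (labelsBelow_unmarkedGens 2 s hs),
        EdgeSum.toPoly_congr (n := 5) (κ := place 0 p q q)
          (fun i hi => by interval_cases i <;> rfl) (by decide : labelsBelow 5 rightMark = true),
        EdgeSum.toPoly_congr (n := 5) (κ := place 1 p q q)
          (fun i hi => by interval_cases i <;> rfl) (labelsBelow_markedGens 0 s' hs'),
        toPoly_rightMark] at h0
      rw [← mul_assoc, mul_comm (EdgeSum.toPoly _ s)]
      refine le_of_le_of_eq ?_ h0.symm
      exact_mod_cast hn

/-- Gluing a marked part without posts and an unmarked part with two posts. -/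
theorem IsMarkedState.glue_zero_two [Finite V] (hX : IsMarkedState 0 0 p k I X)
    (hZ : IsUnmarkedState 2 k q J Z) (h : Glueable p k q I J)
    {c : MvPolynomial (Sym2 (GhostVertex V)) ℝ} (hc : c ∈ gens 1 p q (markedGens 0)) :
    0 ≤ connSum (.inl 0) (.inl 1) (X * Z * c) := by
  rw [mul_assoc]
  have hcI : c ∈ edgesWithin (outside I \ {.inl 0}) :=
    gens_marked_subset_edgesWithin_diff hX.left_notMem h.right_notMem (by decide) hc
  have hcJ : c ∈ edgesWithin (outside J) :=
    gens_marked_subset_edgesWithin h.left_notMem hZ.right_notMem hc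
  refine _root_.connSum_mul_nonneg hX.mem_gluingCone
    (mul_mem (edgesWithin_copies_le (h.notMem_left hX.right_notMem) 0 hZ.mem_edgesWithin) hcI) rfl
    ⟨inl_mem_outside _ _, by simp⟩ fun g hg => ?_
  rw [mul_left_comm]
  refine _root_.connSum_mul_nonneg (hZ.mem_gluingCone 0)
    (mul_mem (gens_marked_subset_edgesWithin h.left_notMem hZ.left_notMem hg) hcJ)
    (inl_mem_outside _ _) (inl_mem_outside _ _) fun z hz => ?_
  obtain ⟨s, hs, rfl⟩ := hg
  obtain ⟨r, hr, rfl⟩ := hz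
  obtain ⟨s', hs', rfl⟩ := hc
  have hn := of_decide_eq_true (List.all_eq_true.1 (List.all_eq_true.1 (List.all_eq_true.1
    connCount_glue_marked s hs) r hr) s' hs')
  have hl := List.all_eq_true.1 (List.all_eq_true.1 (List.all_eq_true.1
    labelsBelow_glue_marked s hs) r hr) s' hs'
  have h0 := connSum_toPoly (by decide) (injOn_pairPlace_middle h.ne hX.ne hZ.ne) hl
  rw [EdgeSum.toPoly_mul, EdgeSum.toPoly_relabel, EdgeSum.toPoly_mul, EdgeSum.toPoly_relabel,
    EdgeSum.toPoly_relabel,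
    EdgeSum.toPoly_congr (n := 5) (κ := place 0 p k k)
      (fun i hi => by interval_cases i <;> rfl) (labelsBelow_markedGens 0 s hs),
    EdgeSum.toPoly_congr (n := 5) (κ := place 0 k q q)
      (fun i hi => by interval_cases i <;> rfl) (labelsBelow_unmarkedGens 2 r hr),
    EdgeSum.toPoly_congr (n := 5) (κ := place 1 p q q)
      (fun i hi => by interval_cases i <;> rfl) (labelsBelow_markedGens 0 s' hs')] at h0
  rw [← mul_assoc, mul_comm (EdgeSum.toPoly _ r)]
  refine le_of_le_of_eq ?_ h0.symm
  exact_mod_cast hn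

/-- The states of parts that contain a marked vertex and `t` posts, for `t ≤ 2`. -/
structure IsMarkedPart (t : ℕ) (p q : V) (I : Set V)
    (X : MvPolynomial (Sym2 (GhostVertex V)) ℝ) : Prop where
  isMarkedState : t ≤ 1 → IsMarkedState 0 t p q I X
  isMarkedStateTwo : t = 2 → IsMarkedStateTwo p q I X

theorem IsMarkedPart.flip [Finite V] (hX : IsMarkedPart t p q I X) : IsMarkedPart t q p I X :=
  ⟨fun ht => (hX.isMarkedState ht).flip ht, fun ht => (hX.isMarkedStateTwo ht).flip⟩

theorem IsMarkedPart.mul_edgeFactor [Finite V] (hX : IsMarkedPart t p q I X) {lam : ℝ}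
    (hlam : 0 < lam) : IsMarkedPart t p q I (X * edgeFactor lam p q) :=
  ⟨fun ht => (hX.isMarkedState ht).mul_edgeFactor ht hlam,
    fun ht => (hX.isMarkedStateTwo ht).mul_edgeFactor hlam⟩

theorem IsUnmarkedState.isMarkedPart [Finite V] (hX : IsUnmarkedState t p q I X) :
    IsMarkedPart t p q I (X * markFactor 0 q) :=
  ⟨fun ht => hX.mul_markFactor ht 0, fun ht => by subst ht; exact hX.mul_markFactor_two⟩

/-- Gluing an unmarked part to a marked one. If there are two posts in total, the unmarked part is
paired with the test state instead, unless it contains both posts. -/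
theorem IsMarkedPart.glue [Finite V] {a b : ℕ} (hX : IsMarkedPart a p k I X)
    (hZ : IsUnmarkedState b k q J Z) (h : Glueable p k q I J) (hab : a + b ≤ 2) :
    IsMarkedPart (a + b) p q (insert k (I ∪ J)) (X * Z) := by
  refine ⟨fun ht => (hX.isMarkedState (by omega)).glue hZ h ht, fun ht => ?_⟩
  have hX' : p ≠ k ∧ p ∉ I ∧ k ∉ I ∧
      X ∈ edgesWithin (insert (.inl 0) (copies (insert p (insert k I)))) := by
    rcases hab.lt_or_eq.imp_left (fun _ => ‹a + b < 2›) with h2 | h2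
    · omega
    by_cases ha : a ≤ 1
    · have hX := hX.isMarkedState ha
      exact ⟨hX.ne, hX.left_notMem, hX.right_notMem, hX.mem_edgesWithin⟩
    · have hX := hX.isMarkedStateTwo (by omega)
      exact ⟨hX.ne, hX.left_notMem, hX.right_notMem, hX.mem_edgesWithin⟩
  obtain ⟨hpk, hpI, hkI, hXmem⟩ := hX'
  refine ⟨h.ne, by simp [hpk, hpI, h.left_notMem],
    by simp [hZ.ne.symm, hZ.right_notMem, h.right_notMem], mul_mem
    (edgesWithin_mono (Set.insert_subset_insert (copies_mono insert_glue_subset_left)) hXmem)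
    (edgesWithin_mono ((copies_mono insert_glue_subset_right).trans (Set.subset_insert _ _))
      hZ.mem_edgesWithin), fun c hc => ?_⟩
  have ha : a ≤ 2 := by omega
  -- The unmarked part is moved to the other side of the pairing, where `q` is eliminated.
  have hg : Glueable p q k ∅ J := ⟨hpk, Set.notMem_empty _, h.left_notMem, Set.empty_disjoint _⟩
  have hd : Disjoint I (insert q (∅ ∪ J)) := by
    rw [Set.empty_union, Set.disjoint_insert_right]
    exact ⟨h.right_notMem, h.disjoint⟩
  have hcs := isMarkedState_of_mem_gens h.ne hc
  interval_cases a
  · obtain rfl : b = 2 := by omega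
    exact (hX.isMarkedState (by decide)).glue_zero_two hZ h hc
  · obtain rfl : b = 1 := by omega
    rw [mul_assoc, mul_comm Z]
    exact (hX.isMarkedState le_rfl).connSum_mul_nonneg
      (hcs.glue (hZ.flip (by decide)) hg (by decide)) hd
  · obtain rfl : b = 0 := by omega
    rw [mul_assoc, mul_comm Z]
    exact (hX.isMarkedStateTwo rfl).connSum_mul_nonneg
      (hcs.glue (hZ.flip (by decide)) hg (by decide)) hd

/-- A whole graph whose last vertex `q` is not a post, with a second mark at its first vertex. -/
theorem IsMarkedPart.connSum_mul_markFactor_nonneg (hX : IsMarkedPart 2 p q I X) :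
    0 ≤ connSum (.inl 0) (.inl 1) (X * markFactor 1 p) := by
  rw [← toPoly_leftMark 1 p q q]
  exact (hX.isMarkedStateTwo rfl).nonneg _ ⟨leftMark, by simp [markedGens], rfl⟩

/-- A whole graph whose last vertex `q` is a post, with a second mark at its first vertex. -/
theorem IsMarkedPart.connSum_mul_postFactor_nonneg [Finite V] (hX : IsMarkedPart 1 p q I X) :
    0 ≤ connSum (.inl 0) (.inl 1) (X * postFactor q * markFactor 1 p) := by
  have hX := hX.isMarkedState le_rfl
  rw [mul_assoc, ← toPoly_leftMark 1 p q q, ← toPoly_rightPost 1 p q q, ← EdgeSum.toPoly_mul]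
  exact hX.connSum_mul_nonneg (isMarkedState_of_mem_gens hX.ne
    ⟨mul rightPost leftMark, by simp [markedGens], rfl⟩) (Set.disjoint_empty I)

end Positivity

/-! ### Induction over intervals of the circle -/

section Intervals

open EdgeSum

variable {V : Type*}

/-- The function `edgeFactor` on unordered pairs. -/
noncomputable def edgePairFactor (lam : ℝ) : Sym2 V → MvPolynomial (Sym2 (GhostVertex V)) ℝ :=
  Sym2.lift ⟨edgeFactor lam, edgeFactor_comm lam⟩

open Classical in
/-- The contribution of a vertex: a vertical edge at the posts, and the mark at `u`. -/
noncomputable def vertexFactor (T : Finset V) (u k : V) : MvPolynomial (Sym2 (GhostVertex V)) ℝ :=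
  (if k = u then markFactor 0 k else 1) * if k ∈ T then postFactor k else 1

open Classical in
/-- The generating function of the part of the bunkbed graph between the vertices `p` and `q`. -/
noncomputable def intervalPoly [Fintype V] [LinearOrder V] (G : SimpleGraph V) (T : Finset V)
    (lam : ℝ) (u p q : V) : MvPolynomial (Sym2 (GhostVertex V)) ℝ :=
  (∏ e ∈ G.edgeFinset, if ∀ x ∈ e, x ∈ Set.Icc p q then edgePairFactor lam e else 1) *
    ∏ k, if k ∈ Set.Ioo p q then vertexFactor T u k else 1

open Classical in
/-- The factor of `pq`, if it is an edge of `G`. -/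
noncomputable def optionalEdgeFactor (G : SimpleGraph V) (lam : ℝ) (p q : V) :
    MvPolynomial (Sym2 (GhostVertex V)) ℝ :=
  if G.Adj p q then edgeFactor lam p q else 1

variable {G : SimpleGraph V} {T : Finset V} {lam : ℝ} {u p q k : V}

open Classical in
theorem prod_vertexFactor [Fintype V] (T : Finset V) (u : V) :
    ∏ k, vertexFactor T u k = markFactor 0 u * ∏ k ∈ T, postFactor k := by
  simp only [vertexFactor]
  rw [Finset.prod_mul_distrib, Finset.prod_ite_eq', if_pos (Finset.mem_univ u), Finset.prod_ite_mem,
    Finset.univ_inter]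

theorem IsUnmarkedState.mul_optionalEdgeFactor [Finite V] {t : ℕ} {I : Set V}
    {X : MvPolynomial (Sym2 (GhostVertex V)) ℝ} (ht : t ≤ 2) (h : IsUnmarkedState t p q I X)
    (hlam : 0 < lam) : IsUnmarkedState t p q I (X * optionalEdgeFactor G lam p q) := by
  classical
  rw [optionalEdgeFactor]
  split_ifs
  · exact h.mul_edgeFactor ht hlam
  · rwa [mul_one]

theorem IsMarkedPart.mul_optionalEdgeFactor [Finite V] {t : ℕ} {I : Set V}
    {X : MvPolynomial (Sym2 (GhostVertex V)) ℝ} (h : IsMarkedPart t p q I X)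
    (hlam : 0 < lam) : IsMarkedPart t p q I (X * optionalEdgeFactor G lam p q) := by
  classical
  rw [optionalEdgeFactor]
  split_ifs
  · exact h.mul_edgeFactor hlam
  · rwa [mul_one]

theorem IsUnmarkedState.mul_vertexFactor [Finite V] [Decidable (q ∈ T)] {t : ℕ} {I : Set V}
    {X : MvPolynomial (Sym2 (GhostVertex V)) ℝ} (h : IsUnmarkedState t p q I X) (hq : q ≠ u)
    (ht : (t + if q ∈ T then 1 else 0) ≤ 2) :
    IsUnmarkedState (t + if q ∈ T then 1 else 0) p q I (X * vertexFactor T u q) := by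
  rw [vertexFactor, if_neg hq, one_mul]
  by_cases hqT : q ∈ T
  · rw [if_pos hqT] at ht ⊢
    rw [if_pos hqT]
    exact h.mul_postFactor (by omega)
  · rwa [if_neg hqT, if_neg hqT, mul_one, add_zero]

variable [LinearOrder V]

open Classical in
theorem prod_edge_eq [Fintype V] (G : SimpleGraph V) (lam : ℝ) (p q : V) :
    (∏ e ∈ G.edgeFinset, if e = s(p, q) then edgePairFactor lam e else 1) =
      optionalEdgeFactor G lam p q := by
  rw [Finset.prod_ite_eq', optionalEdgeFactor]
  simp [edgePairFactor]

theorem edge_induction {P : Sym2 V → Prop} (h : ∀ a b, a < b → G.Adj a b → P s(a, b)) :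
    ∀ e ∈ G.edgeSet, P e := by
  intro e he
  induction e with
  | h a b =>
    rw [SimpleGraph.mem_edgeSet] at he
    rcases lt_or_gt_of_ne he.ne with hab | hab
    · exact h a b hab he
    · rw [Sym2.eq_swap]
      exact h b a hab he.symm

/-- If `pq` is the only possible edge that jumps over `k`, the part between `p` and `q` is glued
from the parts between `p` and `k` and between `k` and `q`. -/
theorem intervalPoly_eq_glue [Fintype V] (hpk : p < k) (hkq : k < q)
    (hcross : ∀ a b, G.Adj a b → a < k → k < b → p ≤ a → b ≤ q → a = p ∧ b = q) :
    intervalPoly G T lam u p q =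
      intervalPoly G T lam u p k * vertexFactor T u k * intervalPoly G T lam u k q *
        optionalEdgeFactor G lam p q := by
  classical
  have h1 : (∏ e ∈ G.edgeFinset, if ∀ x ∈ e, x ∈ Set.Icc p q then edgePairFactor lam e else 1) =
      (∏ e ∈ G.edgeFinset, if ∀ x ∈ e, x ∈ Set.Icc p k then edgePairFactor lam e else 1) *
      (∏ e ∈ G.edgeFinset, if ∀ x ∈ e, x ∈ Set.Icc k q then edgePairFactor lam e else 1) *
      ∏ e ∈ G.edgeFinset, if e = s(p, q) then edgePairFactor lam e else 1 := by
    rw [← Finset.prod_mul_distrib, ← Finset.prod_mul_distrib]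
    refine Finset.prod_congr rfl fun e he => ?_
    rw [SimpleGraph.mem_edgeFinset] at he
    revert e
    refine edge_induction fun a b hab hadj => ?_
    have hp : ∀ x y : V, (∀ z ∈ s(a, b), z ∈ Set.Icc x y) ↔ x ≤ a ∧ b ≤ y := by
      intro x y
      simp only [Sym2.mem_iff, forall_eq_or_imp, forall_eq, Set.mem_Icc]
      constructor
      · exact fun h => ⟨h.1.1, h.2.2⟩
      · exact fun h => ⟨⟨h.1, hab.le.trans h.2⟩, h.1.trans hab.le, h.2⟩
    have he : s(a, b) = s(p, q) ↔ a = p ∧ b = q := by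
      rw [Sym2.eq_iff]
      refine or_iff_left ?_
      rintro ⟨rfl, rfl⟩
      exact lt_asymm hab (hpk.trans hkq)
    simp only [hp, he]
    rcases le_or_gt b k with hbk | hbk
    · have e1 : ¬(k ≤ a ∧ b ≤ q) := fun h => absurd (hab.trans_le hbk) (not_lt.2 h.1)
      have e2 : ¬(a = p ∧ b = q) := fun h => absurd hkq (not_lt.2 (h.2 ▸ hbk))
      rw [if_neg e1, if_neg e2, mul_one, mul_one]
      exact if_congr (and_congr_right fun _ => ⟨fun _ => hbk, fun _ => hbk.trans hkq.le⟩) rfl rfl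
    · have e1 : ¬(p ≤ a ∧ b ≤ k) := fun h => absurd hbk (not_lt.2 h.2)
      rw [if_neg e1, one_mul]
      rcases le_or_gt k a with hka | hka
      · have e2 : ¬(a = p ∧ b = q) := fun h => absurd hpk (not_lt.2 (h.1 ▸ hka))
        rw [if_neg e2, mul_one]
        exact if_congr (and_congr_left fun _ => ⟨fun _ => hka, fun _ => hpk.le.trans hka⟩) rfl rfl
      · have e2 : ¬(k ≤ a ∧ b ≤ q) := fun h => absurd hka (not_lt.2 h.1)
        rw [if_neg e2, one_mul]
        refine if_congr ⟨fun h => hcross a b hadj hka hbk h.1 h.2, ?_⟩ rfl rfl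
        rintro ⟨rfl, rfl⟩
        exact ⟨le_rfl, le_rfl⟩
  have h2 : (∏ x, if x ∈ Set.Ioo p q then vertexFactor T u x else 1) =
      (∏ x, if x ∈ Set.Ioo p k then vertexFactor T u x else 1) *
      (∏ x, if x ∈ Set.Ioo k q then vertexFactor T u x else 1) * vertexFactor T u k := by
    have : vertexFactor T u k = ∏ x, if x = k then vertexFactor T u x else 1 := by
      rw [Finset.prod_ite_eq', if_pos (Finset.mem_univ k)]
    rw [this, ← Finset.prod_mul_distrib, ← Finset.prod_mul_distrib]
    refine Finset.prod_congr rfl fun x _ => ?_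
    simp only [Set.mem_Ioo]
    rcases lt_trichotomy x k with hx | rfl | hx
    · simp [hx, hx.ne, hx.not_gt, hx.trans hkq]
    · simp [hpk, hkq]
    · simp [hx, hx.ne', hx.not_gt, hpk.trans hx]
  rw [intervalPoly, intervalPoly, intervalPoly, h1, h2, prod_edge_eq]
  ring

theorem intervalPoly_eq_edge [Fintype V] (hpq : p < q) (h : Set.Ioo p q = ∅) :
    intervalPoly G T lam u p q = 1 * optionalEdgeFactor G lam p q := by
  classical
  rw [intervalPoly, ← prod_edge_eq, one_mul,
    Finset.prod_eq_one (s := Finset.univ) fun x _ => if_neg (by simp [h]), mul_one]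
  refine Finset.prod_congr rfl fun e he => ?_
  rw [SimpleGraph.mem_edgeFinset] at he
  revert e
  refine edge_induction fun a b hab hadj => if_congr ⟨fun h' => ?_, fun h' x hx => ?_⟩ rfl rfl
  · have ha := h' a (Sym2.mem_mk_left a b)
    have hb := h' b (Sym2.mem_mk_right a b)
    have ha' : a = p := by
      by_contra hne
      have : a ∈ Set.Ioo p q := ⟨lt_of_le_of_ne ha.1 (Ne.symm hne), hab.trans_le hb.2⟩
      simp [h] at this
    have hb' : b = q := by
      by_contra hne
      have : b ∈ Set.Ioo p q := ⟨ha.1.trans_lt hab, lt_of_le_of_ne hb.2 hne⟩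
      simp [h] at this
    rw [ha', hb']
  · rw [h'] at hx
    rcases Sym2.mem_iff.1 hx with rfl | rfl
    exacts [⟨le_rfl, hpq.le⟩, ⟨hpq.le, le_rfl⟩]

open Classical in
/-- The number of posts between `p` and `q`. -/
noncomputable def postCount (T : Finset V) (p q : V) : ℕ := {x ∈ T | x ∈ Set.Ioo p q}.card

theorem postCount_le (hT : T.card = 2) (p q : V) : postCount T p q ≤ 2 :=
  hT ▸ Finset.card_filter_le _ _

open Classical in
theorem postCount_eq_add (hpk : p < k) (hkq : k < q) :
    postCount T p q = postCount T p k + (if k ∈ T then 1 else 0) + postCount T k q := by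
  have : (if k ∈ T then 1 else 0) = ∑ x ∈ T, if x = k then 1 else 0 := by
    rw [Finset.sum_ite_eq']
  rw [postCount, postCount, postCount, Finset.card_filter, Finset.card_filter, Finset.card_filter,
    this, ← Finset.sum_add_distrib, ← Finset.sum_add_distrib]
  refine Finset.sum_congr rfl fun x _ => ?_
  simp only [Set.mem_Ioo]
  rcases lt_trichotomy x k with hx | rfl | hx
  · simp [hx, hx.ne, hx.not_gt, hx.trans hkq]
  · simp [hpk, hkq]
  · simp [hx, hx.ne', hx.not_gt, hpk.trans hx]

/-- The edges of `G`, drawn as arcs above the line, do not cross. -/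
def IsNoncrossing (G : SimpleGraph V) : Prop :=
  ∀ a b c d : V, a < b → b < c → c < d → G.Adj a c → G.Adj b d → False

/-- Every interval of a noncrossing graph can be split at one of its vertices. -/
theorem IsNoncrossing.exists_split [Finite V] (hG : IsNoncrossing G) (h : (Set.Ioo p q).Nonempty) :
    ∃ k, p < k ∧ k < q ∧
      ∀ a b, G.Adj a b → a < k → k < b → p ≤ a → b ≤ q → a = p ∧ b = q := by
  classical
  have hfin := Set.toFinite (Set.Ioo p q)
  by_cases hn : ({x ∈ hfin.toFinset | G.Adj p x}).Nonempty
  · -- The last neighbour of `p` in the interval.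
    obtain ⟨k, hk, hmax⟩ := Finset.exists_max_image _ id hn
    simp only [Finset.mem_filter, Set.Finite.mem_toFinset, Set.mem_Ioo, id, and_imp] at hk hmax
    refine ⟨k, hk.1.1, hk.1.2, fun a b hab hak hkb hpa hbq => ?_⟩
    rcases hpa.eq_or_lt with rfl | hpa
    · refine ⟨rfl, ?_⟩
      by_contra hne
      exact absurd hkb (not_lt.2 (hmax b (hk.1.1.trans hkb) (lt_of_le_of_ne hbq hne) hab))
    · exact (hG p a k b hpa hak hkb hk.2 hab).elim
  · -- If there is none, `p` is only adjacent to `q`, and the next vertex can be taken.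
    obtain ⟨k, hk, hmin⟩ := Finset.exists_min_image hfin.toFinset id (by simpa using h)
    simp only [Set.Finite.mem_toFinset, Set.mem_Ioo, id, and_imp] at hk hmin
    refine ⟨k, hk.1, hk.2, fun a b hab hak hkb hpa hbq => ?_⟩
    rcases hpa.eq_or_lt with rfl | hpa
    · refine ⟨rfl, ?_⟩
      by_contra hne
      refine hn ⟨b, ?_⟩
      simp only [Finset.mem_filter, Set.Finite.mem_toFinset, Set.mem_Ioo]
      exact ⟨⟨hk.1.trans hkb, lt_of_le_of_ne hbq hne⟩, hab⟩
    · exact absurd hak (not_lt.2 (hmin a hpa (hak.trans hk.2)))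

theorem Ioo_eq_insert (hpk : p < k) (hkq : k < q) :
    Set.Ioo p q = insert k (Set.Ioo p k ∪ Set.Ioo k q) := by
  ext x
  simp only [Set.mem_Ioo, Set.mem_insert_iff, Set.mem_union]
  rcases lt_trichotomy x k with hx | rfl | hx
  · simp [hx, hx.ne, hx.not_gt, hx.trans hkq]
  · simp [hpk, hkq]
  · simp [hx, hx.ne', hx.not_gt, hpk.trans hx]

theorem glueable_Ioo (hpk : p < k) (hkq : k < q) :
    Glueable p k q (Set.Ioo p k) (Set.Ioo k q) where
  ne := (hpk.trans hkq).ne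
  right_notMem h := absurd hkq h.2.not_gt
  left_notMem h := absurd hpk h.1.not_gt
  disjoint := Set.disjoint_left.2 fun _ h h' => absurd h.2 h'.1.not_gt

/-- The part between any two vertices is a state of the appropriate kind, by induction over the
number of vertices in between. -/
theorem isState_intervalPoly [Fintype V] (hG : IsNoncrossing G) (hT : T.card = 2) (hu : u ∉ T)
    (hlam : 0 < lam) : ∀ (n : ℕ) (p q : V), p < q → (Set.Ioo p q).ncard = n →
    (u ∉ Set.Ioo p q → IsUnmarkedState (postCount T p q) p q (Set.Ioo p q)
      (intervalPoly G T lam u p q)) ∧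
    (u ∈ Set.Ioo p q → IsMarkedPart (postCount T p q) p q (Set.Ioo p q)
      (intervalPoly G T lam u p q)) := by
  classical
  intro n
  induction n using Nat.strong_induction_on with
  | _ n ih =>
  intro p q hpq hn
  have hle := postCount_le hT p q
  rcases (Set.Ioo p q).eq_empty_or_nonempty with hemp | hne
  · have hcount : postCount T p q = 0 := by simp [postCount, hemp]
    rw [hcount, intervalPoly_eq_edge hpq hemp, hemp]
    exact ⟨fun _ => (isUnmarkedState_one hpq.ne).mul_optionalEdgeFactor (by decide) hlam,
      fun h => absurd h (Set.notMem_empty u)⟩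
  obtain ⟨k, hpk, hkq, hcross⟩ := hG.exists_split hne
  have hg := glueable_Ioo hpk hkq
  have hunion := Ioo_eq_insert hpk hkq
  have hlt1 : (Set.Ioo p k).ncard < n := hn ▸ Set.ncard_lt_ncard
    ⟨fun x hx => ⟨hx.1, hx.2.trans hkq⟩, fun h => absurd (h ⟨hpk, hkq⟩).2 (lt_irrefl k)⟩
  have hlt2 : (Set.Ioo k q).ncard < n := hn ▸ Set.ncard_lt_ncard
    ⟨fun x hx => ⟨hpk.trans hx.1, hx.2⟩, fun h => absurd (h ⟨hpk, hkq⟩).1 (lt_irrefl k)⟩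
  obtain ⟨hX, hX'⟩ := ih _ hlt1 p k hpk rfl
  obtain ⟨hZ, hZ'⟩ := ih _ hlt2 k q hkq rfl
  have hcount := postCount_eq_add (T := T) hpk hkq
  rw [hcount] at hle
  rw [intervalPoly_eq_glue hpk hkq hcross, hcount]
  have hle' := postCount_le hT p k
  have hle'' := postCount_le hT k q
  constructor
  · intro h
    have h' : u ≠ k ∧ u ∉ Set.Ioo p k ∧ u ∉ Set.Ioo k q := by
      rw [hunion] at h
      simpa only [Set.mem_insert_iff, Set.mem_union, not_or] using h
    rw [hunion]
    have hXk := (hX h'.2.1).mul_vertexFactor (T := T) h'.1.symm (by omega)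
    exact (hXk.glue (hZ h'.2.2) hg hle).mul_optionalEdgeFactor hle hlam
  · intro h
    rw [hunion] at h
    refine IsMarkedPart.mul_optionalEdgeFactor ?_ hlam
    rw [hunion]
    rcases h with rfl | h | h
    · rw [if_neg hu, add_zero] at hle ⊢
      have hXk := (hX fun h => lt_irrefl _ h.2).isMarkedPart
      have hfac : vertexFactor T u u = markFactor 0 u := by simp [vertexFactor, hu]
      rw [hfac]
      exact hXk.glue (hZ fun h => lt_irrefl _ h.1) hg hle
    · have hZk := ((hZ fun h' => lt_asymm h.2 h'.1).flip hle'').mul_vertexFactor (T := T) (u := u)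
        h.2.ne' (by omega)
      have := (hX' h).glue (hZk.flip (by omega)) hg (by omega)
      rw [add_assoc, add_comm (ite _ _ _), mul_assoc, mul_comm (vertexFactor _ _ _)]
      exact this
    · have hXk := (hX fun h' => lt_asymm h.1 h'.2).mul_vertexFactor (T := T) (u := u) h.1.ne
        (by omega)
      have := ((hZ' h).flip.glue (hXk.flip (by omega)) hg.symm (by omega)).flip
      rw [add_comm, mul_comm (_ * _), Set.union_comm]
      exact this

/-- The whole graph is the interval from the first vertex `v` to the last vertex, multiplied by the
factor of the last vertex, which may be the mark `u` or a post. -/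
theorem connSum_bunkbed_nonneg [Fintype V] (hG : IsNoncrossing G) (hT : T.card = 2) (hu : u ∉ T)
    (hlam : 0 < lam) {v : V} (hv : v ∉ T) (hmin : ∀ x, v ≤ x) (huv : u ≠ v)
    [DecidableRel G.Adj] :
    0 ≤ connSum (.inl 0) (.inl 1)
      ((∏ e ∈ G.edgeFinset, edgePairFactor lam e) * (∏ k ∈ T, postFactor k) * markFactor 0 u *
        markFactor 1 v) := by
  classical
  obtain ⟨q, -, hmax⟩ := Finset.exists_max_image Finset.univ (id : V → V) ⟨v, Finset.mem_univ v⟩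
  replace hmax : ∀ x, x ≤ q := fun x => hmax x (Finset.mem_univ x)
  have hvu : v < u := lt_of_le_of_ne (hmin u) huv.symm
  have hvq : v < q := hvu.trans_le (hmax u)
  have hprod : (∏ e ∈ G.edgeFinset, edgePairFactor lam e) * (∏ k ∈ T, postFactor k) *
      markFactor 0 u = intervalPoly G T lam u v q * vertexFactor T u q := by
    have h1 : (∏ x, if x ∈ Set.Ioo v q then vertexFactor T u x else 1) * vertexFactor T u q =
        ∏ x, vertexFactor T u x := by
      have : vertexFactor T u q = ∏ x, if x = q then vertexFactor T u x else 1 := by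
        rw [Finset.prod_ite_eq', if_pos (Finset.mem_univ q)]
      rw [this, ← Finset.prod_mul_distrib]
      refine Finset.prod_congr rfl fun x _ => ?_
      rcases (hmin x).eq_or_lt with rfl | hx
      · simp [vertexFactor, hv, huv.symm, hvq.ne]
      rcases (hmax x).eq_or_lt with rfl | hx'
      · simp
      · simp [hx, hx', hx'.ne]
    have h2 : (∏ e ∈ G.edgeFinset, if ∀ x ∈ e, x ∈ Set.Icc v q then edgePairFactor lam e else 1) =
        ∏ e ∈ G.edgeFinset, edgePairFactor lam e :=
      Finset.prod_congr (by ext; simp) fun e _ => if_pos fun x _ => ⟨hmin x, hmax x⟩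
    rw [intervalPoly, mul_assoc, mul_assoc, h1, prod_vertexFactor, ← h2, mul_comm (markFactor _ _)]
    congr 1
    refine Finset.prod_congr (by ext; simp) fun _ _ => rfl
  rw [hprod]
  obtain ⟨h1, h2⟩ := isState_intervalPoly hG hT hu hlam _ v q hvq rfl
  have hcount : postCount T v q + (if q ∈ T then 1 else 0) = 2 := by
    have : (if q ∈ T then 1 else 0) = ∑ x ∈ T, if x = q then 1 else 0 := by
      rw [Finset.sum_ite_eq']
    rw [postCount, Finset.card_filter, this, ← Finset.sum_add_distrib, ← hT,
      Finset.card_eq_sum_ones]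
    refine Finset.sum_congr rfl fun x hx => ?_
    have hxv : v < x := lt_of_le_of_ne (hmin x) fun h => hv (h ▸ hx)
    rcases (hmax x).eq_or_lt with rfl | hx'
    · simp
    · simp [hxv, hx', hx'.ne]
  by_cases hqu : q = u
  · subst hqu
    rw [if_neg hu, add_zero] at hcount
    have hfac : vertexFactor T q q = markFactor 0 q := by simp [vertexFactor, hu]
    have hX := (h1 fun h => lt_irrefl _ h.2).isMarkedPart
    rw [hcount] at hX
    rw [hfac]
    exact hX.connSum_mul_markFactor_nonneg
  · have hX := h2 ⟨hvu, lt_of_le_of_ne (hmax u) (Ne.symm hqu)⟩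
    by_cases hqT : q ∈ T
    · rw [if_pos hqT] at hcount
      have hfac : vertexFactor T u q = postFactor q := by simp [vertexFactor, hqu, hqT]
      obtain hc : postCount T v q = 1 := by omega
      rw [hc] at hX
      rw [hfac]
      exact hX.connSum_mul_postFactor_nonneg
    · rw [if_neg hqT, add_zero] at hcount
      have hfac : vertexFactor T u q = 1 := by simp [vertexFactor, hqu, hqT]
      rw [hcount] at hX
      rw [hfac, mul_one]
      exact hX.connSum_mul_markFactor_nonneg

end Intervals

/-! ### The cyclic order of points on a circle -/

section Circle

theorem four_mul_sin_mul_sin (x y : ℝ) :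
    Real.sin (2 * x) + Real.sin (2 * y) - Real.sin (2 * (x + y)) =
      4 * Real.sin x * Real.sin y * Real.sin (x + y) := by
  rw [Real.sin_two_mul, Real.sin_two_mul, Real.sin_two_mul, Real.sin_add, Real.cos_add]
  have hx := Real.sin_sq_add_cos_sq x
  have hy := Real.sin_sq_add_cos_sq y
  linear_combination (-2 * Real.sin y * Real.cos y) * hx + (-2 * Real.sin x * Real.cos x) * hy

/-- Twice the signed area of the triangle on the unit circle with the angles `x, y, z`. -/
noncomputable def triangleArea (x y z : ℝ) : ℝ :=
  Real.sin (y - x) + Real.sin (z - y) - Real.sin (z - x)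

theorem triangleArea_pos {x y z : ℝ} (hxy : x < y) (hyz : y < z) (hzx : z < x + 2 * Real.pi) :
    0 < triangleArea x y z := by
  have h := four_mul_sin_mul_sin ((y - x) / 2) ((z - y) / 2)
  have e1 : 2 * ((y - x) / 2) = y - x := by ring
  have e2 : 2 * ((z - y) / 2) = z - y := by ring
  have e3 : 2 * ((y - x) / 2 + (z - y) / 2) = z - x := by ring
  rw [e1, e2, e3] at h
  rw [triangleArea, h]
  have h1 : 0 < Real.sin ((y - x) / 2) := Real.sin_pos_of_pos_of_lt_pi (by linarith) (by linarith)
  have h2 : 0 < Real.sin ((z - y) / 2) := Real.sin_pos_of_pos_of_lt_pi (by linarith) (by linarith)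
  have h3 : 0 < Real.sin ((y - x) / 2 + (z - y) / 2) :=
    Real.sin_pos_of_pos_of_lt_pi (by linarith) (by linarith)
  positivity

/-- The point of the unit circle with angle `x`. -/
noncomputable def circlePoint (x : ℝ) : ℂ := ⟨Real.cos x, Real.sin x⟩

/-- Interleaved chords of a circle cross: the affine dependency between the four endpoints has
the areas of the triangles formed by three of them as coefficients. -/
theorem not_disjoint_chords {a b c d : ℝ} (hab : a < b) (hbc : b < c) (hcd : c < d)
    (hda : d < a + 2 * Real.pi) (w : ℂ) :
    ¬Disjoint (openSegment ℝ (w * circlePoint a) (w * circlePoint c))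
      (openSegment ℝ (w * circlePoint b) (w * circlePoint d)) := by
  have hA : 0 < triangleArea b c d := triangleArea_pos hbc hcd (by linarith)
  have hB : 0 < triangleArea a c d := triangleArea_pos (hab.trans hbc) hcd hda
  have hC : 0 < triangleArea a b d := triangleArea_pos hab (hbc.trans hcd) hda
  have hD : 0 < triangleArea a b c := triangleArea_pos hab hbc (by linarith)
  have hsum : triangleArea b c d + triangleArea a b d =
      triangleArea a c d + triangleArea a b c := by
    simp only [triangleArea]
    ring
  have hpos : 0 < triangleArea b c d + triangleArea a b d := by positivity
  have hdep : (triangleArea b c d : ℂ) * circlePoint a + triangleArea a b d * circlePoint c =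
      triangleArea a c d * circlePoint b + triangleArea a b c * circlePoint d := by
    apply Complex.ext <;>
    · simp only [triangleArea, circlePoint, Real.sin_sub, Complex.add_re, Complex.add_im,
        Complex.re_ofReal_mul, Complex.im_ofReal_mul]
      ring
  set s : ℝ := triangleArea b c d + triangleArea a b d with hs
  refine Set.not_disjoint_iff.2 ⟨(triangleArea b c d / s) • (w * circlePoint a) +
    (triangleArea a b d / s) • (w * circlePoint c),
    ⟨_, _, div_pos hA hpos, div_pos hC hpos, ?_, rfl⟩,
    triangleArea a c d / s, triangleArea a b c / s, div_pos hB hpos, div_pos hD hpos, ?_, ?_⟩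
  · rw [← add_div, ← hs, div_self hpos.ne']
  · rw [← add_div, ← hsum, div_self hpos.ne']
  · have hs0 : (s : ℂ) ≠ 0 := by exact_mod_cast hpos.ne'
    simp only [Complex.real_smul, Complex.ofReal_div]
    field_simp
    linear_combination (-w) * hdep

/-- The angle of a complex number, in `[0, 2π)`. -/
noncomputable def posArg (z : ℂ) : ℝ := if 0 ≤ z.arg then z.arg else z.arg + 2 * Real.pi

theorem posArg_nonneg (z : ℂ) : 0 ≤ posArg z := by
  rw [posArg]
  split_ifs with h
  · exact h
  · have := Complex.neg_pi_lt_arg z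
    have := Real.pi_pos
    linarith

theorem posArg_lt (z : ℂ) : posArg z < 2 * Real.pi := by
  have := Complex.arg_le_pi z
  have := Real.pi_pos
  rw [posArg]
  split_ifs with h <;> linarith

theorem circlePoint_posArg {z : ℂ} (hz : ‖z‖ = 1) : circlePoint (posArg z) = z := by
  have h : circlePoint (posArg z) = circlePoint z.arg := by
    rw [posArg]
    split_ifs
    · rfl
    · rw [circlePoint, Real.cos_add_two_pi, Real.sin_add_two_pi, circlePoint]
  rw [h, circlePoint]
  have h1 := Complex.norm_mul_cos_arg z
  have h2 := Complex.norm_mul_sin_arg z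
  rw [hz, one_mul] at h1 h2
  exact Complex.ext h1 h2

/-- The vertices of an outerplanar graph can be ordered, starting from any given vertex, such that
the edges do not cross. -/
theorem IsOuterplanar.exists_linearOrder {V : Type*} {G : SimpleGraph V} (hG : IsOuterplanar G)
    (v : V) : ∃ _ : LinearOrder V, IsNoncrossing G ∧ ∀ x, v ≤ x := by
  obtain ⟨f, hf, hnorm, hdisj⟩ := hG
  have hv0 : f v ≠ 0 := by
    intro h
    simpa [h] using hnorm v
  have hpoint : ∀ x, f v * circlePoint (posArg (f x / f v)) = f x := by
    intro x
    rw [circlePoint_posArg (by rw [norm_div, hnorm, hnorm, div_one]), mul_div_cancel₀ _ hv0]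
  have hinj : Function.Injective fun x => posArg (f x / f v) := by
    intro x y hxy
    refine hf ?_
    rw [← hpoint x, ← hpoint y]
    exact congrArg (fun θ => f v * circlePoint θ) hxy
  refine ⟨LinearOrder.lift' _ hinj, ?_, fun x => ?_⟩
  · intro a b c d hab hbc hcd hac hbd
    have h1 : posArg (f a / f v) < posArg (f b / f v) := hab
    have h2 : posArg (f b / f v) < posArg (f c / f v) := hbc
    have h3 : posArg (f c / f v) < posArg (f d / f v) := hcd
    have h4 := posArg_lt (f d / f v)
    have h5 := posArg_nonneg (f a / f v)
    have key := not_disjoint_chords h1 h2 h3 (by linarith) (f v)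
    simp only [hpoint] at key
    refine key (hdisj a c b d hac hbd ?_)
    rw [Ne, Sym2.eq_iff]
    rintro (⟨rfl, -⟩ | ⟨rfl, -⟩)
    · exact lt_irrefl _ h1
    · exact lt_irrefl _ (h1.trans (h2.trans h3))
  · have : posArg (f v / f v) = 0 := by simp [div_self hv0, posArg]
    change posArg (f v / f v) ≤ posArg (f x / f v)
    rw [this]
    exact posArg_nonneg _

end Circle

/-! ### Forests and their generating functions -/

section Forests

variable {α β : Type*}

/-- The difference of two vertices lies in the cut space exactly if they are connected. -/
theorem single_sub_mem_edgeSpan_iff_reachable (F : Finset (Sym2 α)) (a b : α) :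
    (Finsupp.single a 1 - Finsupp.single b 1 : α →₀ ℚ) ∈ edgeSpan F.val ↔
      (SimpleGraph.fromEdgeSet (F : Set (Sym2 α))).Reachable a b := by
  classical
  constructor
  · intro h
    -- The indicator function of the component of `a` vanishes on the cut space.
    let φ : (α →₀ ℚ) →ₗ[ℚ] ℚ := Finsupp.linearCombination ℚ fun x =>
      if (SimpleGraph.fromEdgeSet (F : Set (Sym2 α))).Reachable a x then (1 : ℚ) else 0
    have hle : edgeSpan F.val ≤ LinearMap.ker φ := by
      rw [edgeSpan_le_iff]
      intro x y hxy
      have hxy' : (SimpleGraph.fromEdgeSet (F : Set (Sym2 α))).Reachable x y := by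
        by_cases hne : x = y
        · rw [hne]
        · exact SimpleGraph.Adj.reachable ((SimpleGraph.fromEdgeSet_adj _).2 ⟨hxy, hne⟩)
      have hiff : (SimpleGraph.fromEdgeSet (F : Set (Sym2 α))).Reachable a x ↔
          (SimpleGraph.fromEdgeSet (F : Set (Sym2 α))).Reachable a y :=
        ⟨fun h => h.trans hxy', fun h => h.trans hxy'.symm⟩
      simp [φ, hiff]
    have := hle h
    by_contra hab
    simp [φ, hab] at this
  · rintro ⟨p⟩
    induction p with
    | nil => rw [sub_self]; exact zero_mem _
    | cons hadj _ ih =>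
      have h := single_sub_mem_edgeSpan ((SimpleGraph.fromEdgeSet_adj _).1 hadj).1
      simpa using add_mem h ih

/-- A graph is a forest exactly if its rank is its number of edges. -/
theorem finrank_edgeSpan_eq_card_iff [Finite α] (F : Finset (Sym2 α)) (hF : ∀ e ∈ F, ¬e.IsDiag) :
    Module.finrank ℚ (edgeSpan F.val) = F.card ↔
      (SimpleGraph.fromEdgeSet (F : Set (Sym2 α))).IsAcyclic := by
  classical
  induction F using Finset.induction_on with
  | empty =>
    have h : Module.finrank ℚ (edgeSpan (0 : Multiset (Sym2 α))) = 0 := by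
      rw [edgeSpan_zero]
      exact finrank_bot ℚ _
    exact iff_of_true h (by simp)
  | insert e F he ih =>
    have ih := ih fun e he => hF e (Finset.mem_insert_of_mem he)
    have hdiag := hF e (Finset.mem_insert_self _ _)
    induction e with
    | h a b =>
      rw [Sym2.mk_isDiag_iff] at hdiag
      have hnadj : ¬(SimpleGraph.fromEdgeSet (F : Set (Sym2 α))).Adj a b := fun h =>
        he ((SimpleGraph.fromEdgeSet_adj _).1 h).1
      have hgraph : SimpleGraph.fromEdgeSet ((insert s(a, b) F : Finset _) : Set (Sym2 α)) =
          SimpleGraph.fromEdgeSet (F : Set (Sym2 α)) ⊔ SimpleGraph.edge a b := by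
        rw [SimpleGraph.edge, Finset.coe_insert, Set.insert_eq, Set.union_comm,
          SimpleGraph.fromEdgeSet_union]
      rw [hgraph, SimpleGraph.isAcyclic_sup_fromEdgeSet_iff, ← ih,
        ← single_sub_mem_edgeSpan_iff_reachable, Finset.insert_val_of_notMem he,
        Finset.card_insert_of_notMem he]
      by_cases hmem : (Finsupp.single a 1 - Finsupp.single b 1 : α →₀ ℚ) ∈ edgeSpan F.val
      · have hspan : edgeSpan (s(a, b) ::ₘ F.val) = edgeSpan F.val := by
          rw [edgeSpan_cons, edgeLine_mk, sup_eq_right, Submodule.span_singleton_le_iff_mem]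
          exact hmem
        have hle := finrank_edgeSpan_le_card F.val
        rw [hspan]
        constructor
        · intro h
          rw [Finset.card_val] at hle
          omega
        · intro h
          exact absurd (h.2 hmem) (not_or.2 ⟨hdiag, hnadj⟩)
      · rw [finrank_edgeSpan_cons hmem, Nat.add_right_cancel_iff]
        exact (and_iff_left fun h => absurd h hmem).symm

theorem lmapDomain_single_sub (ι : α → β) (a b : α) :
    Finsupp.lmapDomain ℚ ℚ ι (Finsupp.single a 1 - Finsupp.single b 1) =
      Finsupp.single (ι a) 1 - Finsupp.single (ι b) 1 := by
  rw [map_sub]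
  simp

theorem edgeSpan_map (ι : α → β) (M : Multiset (Sym2 α)) :
    edgeSpan (M.map (Sym2.map ι)) = (edgeSpan M).map (Finsupp.lmapDomain ℚ ℚ ι) := by
  induction M using Multiset.induction with
  | empty => simp
  | cons e M ih =>
    induction e with
    | h a b =>
      rw [Multiset.map_cons, edgeSpan_cons, edgeSpan_cons, ih, Submodule.map_sup, Sym2.map_mk,
        edgeLine_mk, edgeLine_mk, Submodule.map_span, Set.image_singleton,
        lmapDomain_single_sub]

theorem connIndicator_map {ι : α → β} (hι : Function.Injective ι) (a b : α)
    (M : Multiset (Sym2 α)) :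
    connIndicator (ι a) (ι b) (M.map (Sym2.map ι)) = connIndicator a b M := by
  have hinj : Function.Injective (Finsupp.lmapDomain ℚ ℚ ι) := Finsupp.mapDomain_injective hι
  have h1 : Module.finrank ℚ (edgeSpan (M.map (Sym2.map ι))) = Module.finrank ℚ (edgeSpan M) := by
    rw [edgeSpan_map]
    exact (Submodule.equivMapOfInjective _ hinj _).finrank_eq.symm
  have h2 : (Finsupp.single (ι a) 1 - Finsupp.single (ι b) 1 : β →₀ ℚ) ∈
      edgeSpan (M.map (Sym2.map ι)) ↔
      (Finsupp.single a 1 - Finsupp.single b 1 : α →₀ ℚ) ∈ edgeSpan M := by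
    rw [edgeSpan_map, ← lmapDomain_single_sub]
    exact hinj.mem_set_image
  rw [connIndicator, connIndicator, h1, h2, Multiset.card_map]

theorem eq_sum_edgeMonomial (X : MvPolynomial (Sym2 α) ℝ) :
    X = ∑ m ∈ X.support, X.coeff m • edgeMonomial (Finsupp.toMultiset m) := by
  classical
  conv_lhs => rw [X.as_sum]
  refine Finset.sum_congr rfl fun m _ => ?_
  rw [edgeMonomial_eq_monomial, MvPolynomial.smul_monomial]
  simp

theorem rename_edgeMonomial (ι : α → β) (M : Multiset (Sym2 α)) :
    MvPolynomial.rename (Sym2.map ι) (edgeMonomial M) = edgeMonomial (M.map (Sym2.map ι)) := by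
  rw [edgeMonomial, edgeMonomial, map_multiset_prod, Multiset.map_map, Multiset.map_map]
  simp

theorem connSum_rename {ι : α → β} (hι : Function.Injective ι) (a b : α)
    (X : MvPolynomial (Sym2 α) ℝ) :
    connSum (ι a) (ι b) (MvPolynomial.rename (Sym2.map ι) X) = connSum a b X := by
  rw [eq_sum_edgeMonomial X]
  simp only [map_sum, map_smul, rename_edgeMonomial, connSum_edgeMonomial, connIndicator_map hι]

end Forests

section GhostEdges

variable {V : Type*} [Finite V]

/-- Two ghost edges express the connection of their endpoints. -/
theorem connSum_mul_ghost_edges {X : MvPolynomial (Sym2 (V × Fin 2)) ℝ} (x y : V × Fin 2) :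
    connSum (.inl 0) (.inl 1) (MvPolynomial.rename (Sym2.map Sum.inr) X *
      MvPolynomial.X (s(.inl 0, .inr x) : Sym2 (GhostVertex V)) *
      MvPolynomial.X (s(.inl 1, .inr y) : Sym2 (GhostVertex V))) = connSum x y X := by
  rw [eq_sum_edgeMonomial X]
  simp only [map_sum, map_smul, rename_edgeMonomial, connSum_edgeMonomial, Finset.sum_mul,
    smul_mul_assoc]
  refine Finset.sum_congr rfl fun m _ => ?_
  congr 1
  generalize Finsupp.toMultiset m = M
  have hno : ∀ γ : Fin 2, ∀ e ∈ M.map (Sym2.map (Sum.inr : _ → GhostVertex V)), .inl γ ∉ e := by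
    intro γ e he hmem
    obtain ⟨e, -, rfl⟩ := Multiset.mem_map.1 he
    obtain ⟨z, -, hz⟩ := Sym2.mem_map.1 hmem
    exact Sum.inr_ne_inl hz
  have h1 : edgeMonomial (M.map (Sym2.map Sum.inr)) *
      MvPolynomial.X (s(.inl 0, .inr x) : Sym2 (GhostVertex V)) *
      MvPolynomial.X (s(.inl 1, .inr y) : Sym2 (GhostVertex V)) =
      edgeMonomial (s(.inl 0, .inr x) ::ₘ s(.inl 1, .inr y) ::ₘ M.map (Sym2.map Sum.inr)) := by
    simp only [edgeMonomial, Multiset.map_cons, Multiset.prod_cons]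
    ring
  rw [h1, connSum_edgeMonomial, connIndicator_cons_leaf_left, connIndicator_comm,
    connIndicator_cons_leaf_left (hno 1) Sum.inr_ne_inl Sum.inr_ne_inl, connIndicator_comm,
    connIndicator_map Sum.inr_injective]
  · intro e he
    rcases Multiset.mem_cons.1 he with rfl | he
    · simp
    · exact hno 0 e he
  · exact Sum.inr_ne_inl
  · simp

end GhostEdges

/-! ### The arboreal gas on the bunkbed graph -/

section Bunkbed

open Classical

variable {V : Type*} {G : SimpleGraph V} {T : Finset V} {lam : ℝ}

/-- The edges of the bunkbed graph on the two levels. -/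
noncomputable def levelEdges [Fintype V] (G : SimpleGraph V) : Finset (Sym2 (V × Fin 2)) :=
  (G.edgeFinset ×ˢ Finset.univ).image fun a => a.1.map fun x => (x, a.2)

/-- The vertical edges at the posts. -/
noncomputable def postEdges (T : Finset V) : Finset (Sym2 (V × Fin 2)) :=
  T.image fun t => s((t, 0), (t, 1))

theorem map_level_injective :
    Function.Injective fun a : Sym2 V × Fin 2 => a.1.map fun x => (x, a.2) := by
  rintro ⟨e, l⟩ ⟨e', l'⟩ h
  induction e with
  | h a b =>
    induction e' with
    | h a' b' =>
      simp only [Sym2.map_mk, Sym2.eq_iff, Prod.mk.injEq] at h ⊢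
      tauto

theorem mem_levelEdges [Fintype V] {x y : V × Fin 2} :
    s(x, y) ∈ levelEdges G ↔ x.2 = y.2 ∧ G.Adj x.1 y.1 := by
  obtain ⟨x, i⟩ := x
  obtain ⟨y, j⟩ := y
  simp only [levelEdges, Finset.mem_image, Finset.mem_product, Finset.mem_univ, and_true,
    SimpleGraph.mem_edgeFinset, Prod.exists]
  constructor
  · rintro ⟨e, l, he, h⟩
    induction e with
    | h a b =>
      simp only [Sym2.map_mk, Sym2.eq_iff, Prod.mk.injEq] at h
      rw [SimpleGraph.mem_edgeSet] at he
      rcases h with ⟨⟨rfl, rfl⟩, rfl, rfl⟩ | ⟨⟨rfl, rfl⟩, rfl, rfl⟩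
      exacts [⟨rfl, he⟩, ⟨rfl, he.symm⟩]
  · rintro ⟨h1, h2⟩
    subst h1
    exact ⟨s(x, y), i, h2, rfl⟩

theorem mem_postEdges {x y : V × Fin 2} :
    s(x, y) ∈ postEdges T ↔ x.1 = y.1 ∧ x.2 ≠ y.2 ∧ x.1 ∈ T := by
  obtain ⟨x, i⟩ := x
  obtain ⟨y, j⟩ := y
  simp only [postEdges, Finset.mem_image, Sym2.eq_iff, Prod.mk.injEq]
  constructor
  · rintro ⟨t, ht, ⟨⟨rfl, rfl⟩, rfl, rfl⟩ | ⟨⟨rfl, rfl⟩, rfl, rfl⟩⟩ <;> simp [ht]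
  · rintro ⟨rfl, hij, hx⟩
    refine ⟨x, hx, ?_⟩
    fin_cases i <;> fin_cases j <;> simp at hij ⊢

theorem edgeSet_bunkbedGraph [Fintype V] (G : SimpleGraph V) (T : Finset V) :
    (bunkbedGraph G T).edgeSet = (levelEdges G ∪ postEdges T : Finset _) := by
  ext e
  induction e with
  | h x y =>
    rw [Finset.mem_coe, Finset.mem_union, mem_levelEdges, mem_postEdges]
    rfl

theorem disjoint_levelEdges_postEdges [Fintype V] (G : SimpleGraph V) (T : Finset V) :
    Disjoint (levelEdges G) (postEdges T) := by
  rw [Finset.disjoint_left]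
  intro e
  induction e with
  | h x y =>
    rw [mem_levelEdges, mem_postEdges]
    exact fun h h' => h'.2.1 h.1

theorem mem_postsOpen {F : Finset (Sym2 (V × Fin 2))} : F ∈ postsOpen T ↔ postEdges T ⊆ F := by
  simp [postsOpen, postEdges, Finset.subset_iff]

/-- The generating function of the edges of the bunkbed graph, with the posts being present. -/
noncomputable def bunkbedPoly [Fintype V] (G : SimpleGraph V) (T : Finset V) (lam : ℝ) :
    MvPolynomial (Sym2 (V × Fin 2)) ℝ :=
  (∏ e ∈ levelEdges G, (1 + lam • MvPolynomial.X e)) * ∏ e ∈ postEdges T, MvPolynomial.X e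

theorem bunkbedPoly_eq [Fintype V] (G : SimpleGraph V) (T : Finset V) (lam : ℝ) :
    bunkbedPoly G T lam =
    (∏ e ∈ G.edgeFinset, (1 + lam • MvPolynomial.X (e.map fun x => (x, (0 : Fin 2)))) *
      (1 + lam • MvPolynomial.X (e.map fun x => (x, (1 : Fin 2))))) *
    ∏ t ∈ T, MvPolynomial.X s((t, 0), (t, 1)) := by
  rw [bunkbedPoly, levelEdges, Finset.prod_image map_level_injective.injOn, Finset.prod_product,
    postEdges, Finset.prod_image]
  · simp only [Fin.prod_univ_two]
  · intro s _ t _ h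
    simpa [Sym2.eq_iff] using h

theorem rename_inr_bunkbedPoly [Fintype V] (G : SimpleGraph V) (T : Finset V) (lam : ℝ) :
    MvPolynomial.rename (Sym2.map Sum.inr) (bunkbedPoly G T lam) =
      (∏ e ∈ G.edgeFinset, edgePairFactor lam e) * ∏ t ∈ T, postFactor t := by
  rw [bunkbedPoly_eq, map_mul, map_prod, map_prod]
  congr 1
  · refine Finset.prod_congr rfl fun e _ => ?_
    induction e with
    | h a b => simp [edgePairFactor, edgeFactor]
  · refine Finset.prod_congr rfl fun t _ => ?_
    simp [postFactor]

theorem rename_swap_bunkbedPoly [Fintype V] (G : SimpleGraph V) (T : Finset V) (lam : ℝ) :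
    MvPolynomial.rename (Sym2.map (Prod.map id (Equiv.swap (0 : Fin 2) 1))) (bunkbedPoly G T lam) =
      bunkbedPoly G T lam := by
  rw [bunkbedPoly_eq, map_mul, map_prod, map_prod]
  congr 1
  · refine Finset.prod_congr rfl fun e _ => ?_
    induction e with
    | h a b => simp [mul_comm]
  · refine Finset.prod_congr rfl fun t _ => ?_
    simp [Sym2.eq_swap]

/-- Exchanging the two levels does not change the weights. -/
theorem connSum_bunkbedPoly_swap [Fintype V] (G : SimpleGraph V) (T : Finset V) (lam : ℝ) (u v : V)
    (i j : Fin 2) : connSum (u, Equiv.swap 0 1 i) (v, Equiv.swap 0 1 j) (bunkbedPoly G T lam) =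
      connSum (u, i) (v, j) (bunkbedPoly G T lam) := by
  have hinj : Function.Injective (Prod.map (id : V → V) (Equiv.swap (0 : Fin 2) 1)) :=
    Function.injective_id.prodMap (Equiv.injective _)
  have h := connSum_rename hinj (u, i) (v, j) (bunkbedPoly G T lam)
  rw [rename_swap_bunkbedPoly] at h
  exact h

/-- The total weight of the forests that contain all posts and connect `x` and `y`. -/
noncomputable def forestSum [Fintype V] (G : SimpleGraph V) (T : Finset V) (lam : ℝ)
    (x y : V × Fin 2) : ℝ :=
  ∑ F : Finset (Sym2 (V × Fin 2)),
    if IsForestOf (bunkbedGraph G T) F ∧ F ∈ postsOpen T ∩ connectionEvent x y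
      then lam ^ F.card else 0

theorem connIndicator_eq_ite [Fintype V] (x y : V × Fin 2) {F : Finset (Sym2 (V × Fin 2))}
    (hF : (F : Set (Sym2 (V × Fin 2))) ⊆ (bunkbedGraph G T).edgeSet) :
    connIndicator x y F.val =
      if IsForestOf (bunkbedGraph G T) F ∧ F ∈ connectionEvent x y then 1 else 0 := by
  rw [connIndicator]
  refine if_congr ?_ rfl rfl
  rw [single_sub_mem_edgeSpan_iff_reachable, Finset.card_val,
    finrank_edgeSpan_eq_card_iff F fun e he => (bunkbedGraph G T).not_isDiag_of_mem_edgeSet (hF he)]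
  exact and_congr_left fun _ => (and_iff_right hF).symm

theorem bunkbedPoly_eq_sum [Fintype V] (G : SimpleGraph V) (T : Finset V) (lam : ℝ) :
    bunkbedPoly G T lam =
    ∑ A ∈ (levelEdges G).powerset, lam ^ A.card • edgeMonomial (A ∪ postEdges T).val := by
  rw [bunkbedPoly, Finset.prod_one_add, Finset.sum_mul]
  refine Finset.sum_congr rfl fun A hA => ?_
  have hd := (disjoint_levelEdges_postEdges G T).mono_left (Finset.mem_powerset.1 hA)
  have h1 : edgeMonomial (A ∪ postEdges T).val =
      ∏ e ∈ A ∪ postEdges T, (MvPolynomial.X e : MvPolynomial _ ℝ) := rfl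
  rw [h1, Finset.prod_union hd, ← smul_mul_assoc]
  simp only [MvPolynomial.smul_eq_C_mul, Finset.prod_mul_distrib, Finset.prod_const, map_pow]

/-- The weights of forests are read off from the generating function. -/
theorem forestSum_eq [Fintype V] (G : SimpleGraph V) (T : Finset V) (lam : ℝ) (x y : V × Fin 2) :
    forestSum G T lam x y =
      lam ^ (postEdges T).card * connSum x y (bunkbedPoly G T lam) := by
  have hinj : Set.InjOn (fun A => A ∪ postEdges T) ((levelEdges G).powerset : Set (Finset _)) := by
    intro A hA A' hA' h
    have hd := (disjoint_levelEdges_postEdges G T).mono_left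
      (Finset.mem_powerset.1 (Finset.mem_coe.1 hA))
    have hd' := (disjoint_levelEdges_postEdges G T).mono_left
      (Finset.mem_powerset.1 (Finset.mem_coe.1 hA'))
    have := congrArg (· \ postEdges T) h
    simpa [Finset.union_sdiff_distrib, hd.sdiff_eq_left, hd'.sdiff_eq_left] using this
  rw [bunkbedPoly_eq_sum, map_sum, Finset.mul_sum, forestSum,
    ← Finset.sum_subset (Finset.subset_univ ((levelEdges G).powerset.image (· ∪ postEdges T))),
    Finset.sum_image hinj]
  · refine Finset.sum_congr rfl fun A hA => ?_
    have hd := (disjoint_levelEdges_postEdges G T).mono_left (Finset.mem_powerset.1 hA)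
    have hsub : ((A ∪ postEdges T : Finset _) : Set (Sym2 (V × Fin 2))) ⊆
        (bunkbedGraph G T).edgeSet := by
      rw [edgeSet_bunkbedGraph, Finset.coe_subset]
      exact Finset.union_subset_union_left (Finset.mem_powerset.1 hA)
    have hopen : A ∪ postEdges T ∈ postsOpen T := mem_postsOpen.2 Finset.subset_union_right
    rw [map_smul, connSum_edgeMonomial, connIndicator_eq_ite x y hsub,
      Finset.card_union_of_disjoint hd,
      smul_eq_mul, mul_ite, mul_ite, mul_one, mul_zero, mul_zero, pow_add, mul_comm (lam ^ A.card)]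
    exact if_congr (and_congr_right fun _ => and_iff_right hopen) rfl rfl
  · intro F _ hF
    refine if_neg ?_
    rintro ⟨⟨h1, -⟩, h2, -⟩
    refine hF (Finset.mem_image.2 ⟨F \ postEdges T, ?_, ?_⟩)
    · rw [edgeSet_bunkbedGraph, Finset.coe_subset] at h1
      rw [Finset.mem_powerset]
      rw [Finset.union_comm] at h1
      exact sdiff_le_iff.2 h1
    · exact Finset.sdiff_union_of_subset (mem_postsOpen.1 h2)

theorem forestSum_mono [Fintype V] (hlam : 0 < lam) {x y x' y' : V × Fin 2}
    (h : postsOpen T ∩ connectionEvent x y ⊆ postsOpen T ∩ connectionEvent x' y') :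
    forestSum G T lam x y ≤ forestSum G T lam x' y' := by
  refine Finset.sum_le_sum fun F _ => ?_
  split_ifs with h1 h2 h2
  · exact le_rfl
  · exact absurd ⟨h1.1, h h1.2⟩ h2
  · positivity
  · exact le_rfl

theorem bunkbedArborealGas_eq [Fintype V] (hlam : 0 < lam) (x y : V × Fin 2) :
    bunkbedArborealGas G T lam (connectionEvent x y) =
      (arborealGas (bunkbedGraph G T) lam (postsOpen T))⁻¹ *
        (ENNReal.ofReal (forestSum G T lam x y) *
          (∑' F, arborealWeight (bunkbedGraph G T) lam F)⁻¹) := by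
  rw [bunkbedArborealGas, ProbabilityTheory.cond_apply MeasurableSpace.measurableSet_top]
  congr 1
  rw [arborealGas, PMF.toMeasure_apply_fintype, forestSum, ENNReal.ofReal_sum_of_nonneg,
    Finset.sum_mul]
  · refine Finset.sum_congr rfl fun F _ => ?_
    by_cases hF : F ∈ postsOpen T ∩ connectionEvent x y
    · rw [Set.indicator_of_mem hF, PMF.normalize_apply, arborealWeight]
      congr 1
      by_cases hF' : IsForestOf (bunkbedGraph G T) F
      · rw [if_pos hF', if_pos ⟨hF', hF⟩, ENNReal.ofReal_pow hlam.le]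
      · rw [if_neg hF', if_neg fun h => hF' h.1, ENNReal.ofReal_zero]
    · rw [Set.indicator_of_notMem hF, if_neg fun h => hF h.2, ENNReal.ofReal_zero, zero_mul]
  · intro F _
    split_ifs
    · positivity
    · exact le_rfl

theorem inter_connectionEvent_subset_of_mem {T : Finset V} {t : V} (ht : t ∈ T) (y : V × Fin 2)
    (i j : Fin 2) : postsOpen T ∩ connectionEvent (t, i) y ⊆
      postsOpen T ∩ connectionEvent (t, j) y := by
  rintro F ⟨hF, h⟩
  refine ⟨hF, ?_⟩
  rcases eq_or_ne i j with rfl | hij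
  · exact h
  · refine SimpleGraph.Reachable.trans (SimpleGraph.Adj.reachable ?_) h
    rw [SimpleGraph.fromEdgeSet_adj]
    exact ⟨mem_postsOpen.1 hF (mem_postEdges.2 ⟨rfl, hij.symm, ht⟩), by simp [hij.symm]⟩

theorem connectionEvent_comm {W : Type*} (x y : W) : connectionEvent x y = connectionEvent y x := by
  ext F
  exact SimpleGraph.reachable_comm

theorem forestSum_swap [Fintype V] (u v : V) (i j : Fin 2) :
    forestSum G T lam (u, Equiv.swap 0 1 i) (v, Equiv.swap 0 1 j) =
      forestSum G T lam (u, i) (v, j) := by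
  rw [forestSum_eq, forestSum_eq, connSum_bunkbedPoly_swap]

theorem forestSum_le [Fintype V] (hG : IsOuterplanar G) (hT : T.card = 2) (hlam : 0 < lam)
    (u v : V) :
    forestSum G T lam (u, 0) (v, 1) ≤ forestSum G T lam (u, 0) (v, 0) := by
  by_cases huv : u = v
  · subst huv
    refine forestSum_mono hlam (Set.inter_subset_inter_right _ fun F _ => ?_)
    exact SimpleGraph.Reachable.refl _
  by_cases hv : v ∈ T
  · refine forestSum_mono hlam ?_
    rw [connectionEvent_comm, connectionEvent_comm (u, 0)]
    exact inter_connectionEvent_subset_of_mem hv _ _ _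
  by_cases hu : u ∈ T
  · -- The symmetry turns the event into the connection of `(u, 1)` and `(v, 0)`.
    rw [← forestSum_swap]
    exact forestSum_mono hlam (inter_connectionEvent_subset_of_mem hu _ _ _)
  rw [forestSum_eq, forestSum_eq]
  refine mul_le_mul_of_nonneg_left ?_ (by positivity)
  obtain ⟨_, hnc, hmin⟩ := hG.exists_linearOrder v
  have key := connSum_bunkbed_nonneg hnc hT hu hlam hv hmin huv
  have e1 := connSum_bunkbedPoly_swap G T lam u v 0 1
  have e2 := connSum_bunkbedPoly_swap G T lam u v 0 0
  rw [Equiv.swap_apply_left] at e1 e2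
  rw [Equiv.swap_apply_right] at e1
  have hren := rename_inr_bunkbedPoly G T lam
  -- The product of the two marks is the signed sum over the copies of `u` and `v`.
  have hexp : (∏ e ∈ G.edgeFinset, edgePairFactor lam e) * (∏ k ∈ T, postFactor k) *
      markFactor 0 u * markFactor 1 v =
      MvPolynomial.rename (Sym2.map Sum.inr) (bunkbedPoly G T lam) *
        MvPolynomial.X (s(.inl 0, .inr (u, 0)) : Sym2 (GhostVertex V)) *
        MvPolynomial.X (s(.inl 1, .inr (v, 0)) : Sym2 (GhostVertex V)) -
      MvPolynomial.rename (Sym2.map Sum.inr) (bunkbedPoly G T lam) *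
        MvPolynomial.X (s(.inl 0, .inr (u, 0)) : Sym2 (GhostVertex V)) *
        MvPolynomial.X (s(.inl 1, .inr (v, 1)) : Sym2 (GhostVertex V)) -
      MvPolynomial.rename (Sym2.map Sum.inr) (bunkbedPoly G T lam) *
        MvPolynomial.X (s(.inl 0, .inr (u, 1)) : Sym2 (GhostVertex V)) *
        MvPolynomial.X (s(.inl 1, .inr (v, 0)) : Sym2 (GhostVertex V)) +
      MvPolynomial.rename (Sym2.map Sum.inr) (bunkbedPoly G T lam) *
        MvPolynomial.X (s(.inl 0, .inr (u, 1)) : Sym2 (GhostVertex V)) *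
        MvPolynomial.X (s(.inl 1, .inr (v, 1)) : Sym2 (GhostVertex V)) := by
    rw [hren, markFactor, markFactor]
    ring
  rw [hexp, map_add, map_sub, map_sub, connSum_mul_ghost_edges, connSum_mul_ghost_edges,
    connSum_mul_ghost_edges, connSum_mul_ghost_edges] at key
  linarith

end Bunkbed

theorem mainTheorem5 {V : Type*} [Finite V] (G : SimpleGraph V) (hG : IsOuterplanar G)
    (T : Finset V) (hT : T.card = 2) (lam : ℝ) (hlam : 0 < lam) (u v : V) :
    bunkbedArborealGas G T lam (connectionEvent (u, 0) (v, 1)) ≤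
      bunkbedArborealGas G T lam (connectionEvent (u, 0) (v, 0)) := by
  cases nonempty_fintype V
  rw [bunkbedArborealGas_eq hlam, bunkbedArborealGas_eq hlam]
  gcongr
  exact forestSum_le hG hT hlam u v
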